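/- **Setting.** Let $d,m\ge 0$ be integers, $r>0$, $\tfrac12<\nu\le 1$ and $1-\nu<\beta_0<\beta<\nu$. For an interval $[a,b]$ put $|||x|||_{\alpha,[a,b]}=\sup_{a\le s<t\le b}\|x(t)-x(s)\|/(t-s)^{\alpha}$, let $C^{\alpha}([a,b])$ be the space of paths $x$ with finite norm $\|x\|_{\infty,[a,b]}+|||x|||_{\alpha,[a,b]}$, and let $C^{0,\alpha}([a,b])$ be the closure of the smooth paths in $C^{\alpha}([a,b])$. Write $\mathcal C_r=C([-r,0],\mathbb R^d)$ with the supremum norm, $S=C^{0,\beta_0}([-r,0],\mathbb R^d)$ with the $\beta_0$-Hölder norm, and $y_t(s)=y(t+s)$ for $s\in[-r,0]$. *Noise.* Let $\Omega$ be the space of paths $\omega:\mathbb R\to\mathbb R^m$ with $\omega(0)=0$ and $\omega|_{[a,b]}\in C^{0,\nu}([a,b],\mathbb R^m)$ for all $a<b$, with the topology of convergence in $\nu$-Hölder norm on compact intervals and its Borel $\sigma$-algebra; let $(\theta_t\omega)(s)=\omega(t+s)-\omega(t)$ for $t,s\in\mathbb R$, and let $Z(\omega)=\omega$. Let $\mathbb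 P$ be a probability measure on $\Omega$ which is invariant under every $\theta_t$ (i.e. $Z$ has stationary increments) and ergodic (measurable sets invariant under all $\theta_t$ have probability $0$ or $1$), and assume the moment condition $$\Gamma:=\Big(\mathbb E\,|||Z|||_{\nu,[-r,r]}^{\frac1{\nu-\beta}}\Big)^{\nu-\beta}<\infty .$$ *Coefficients.* Let $A\in\mathbb R^{d\times d}$ have only eigenvalues with negative real part, and let $C_A,\lambda>0$ be such that $\|e^{At}\|\le C_Ae^{-\lambda t}$ for all $t\ge0$. Let $f:\mathcal C_r\to\mathbb R^d$ be globally Lipschitz with constant $C_f$, and assume $C_AC_f<\lambda e^{-\lambda r}$. **Theorem.** There is $\varepsilon>0$ such that for every $C_g<\varepsilon$ and every $C^1$ map $g:\mathcal C_r\to\mathbb R^{d\times m}$ with $\|Dg(\xi)\|\le C_g$ for all $\xi\in\mathcal C_r$ and with $Dg$ Lipschitz on every ball of $\mathcal C_r$, the following holds. 1. The equation $$dy(t)=[Ay(t)+f(y_t)]\,dt+g(y_t)\,dZ(t),\qquad y_0=\eta\in S,$$ understood path-wise (for each $\omega\in\Omega$, with the $dZ$-integral a Young integral, i.e. a limit of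 Riemann–Stieltjes sums), has for every $\omega\in\Omega$ and $\eta\in S$ a unique solution $y(\cdot,\omega,\eta)$ on $[-r,\infty)$ that is $\beta_0$-Hölder on every $[-r,T]$, and $\varphi(t,\omega,\eta):=y_t(\cdot,\omega,\eta)$ defines a continuous random dynamical system $\varphi:\mathbb R^+\times\Omega\times S\to S$ over $(\Omega,\mathbb P,\theta)$: it is measurable, continuous in $(t,\eta)$ for each $\omega$, $\varphi(0,\omega,\cdot)=\mathrm{id}_S$, and $\varphi(t+s,\omega,\cdot)=\varphi(t,\theta_s\omega,\cdot)\circ\varphi(s,\omega,\cdot)$ for all $s,t\ge0$ and $\omega\in\Omega$. 2. $\varphi$ has a random pullback attractor $\mathcal A$ for the universe $\mathcal D$ of tempered random sets, and $\mathcal A(\omega)\subset C^{\beta}([-r,0],\mathbb R^d)$ for every $\omega\in\Omega$. That is: every $\mathcal A(\omega)\subset S$ is nonempty and compact, $\mathcal A$ has measurable graph and $\omega\mapsto d(\eta,\mathcal A(\omega))$ is measurable for every $\eta\in S$; almost surely $\varphi(t,\omega)\mathcal A(\omega)=\mathcal A(\theta_t\omega)$ for all $t\ge0$; and for every $D\in\mathcal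 D$, almost surely $$\lim_{t\to\infty}\ \sup_{\eta\in D(\theta_{-t}\omega)} d\big(\varphi(t,\theta_{-t}\omega,\eta),\mathcal A(\omega)\big)=0 .$$ Here $\mathcal D$ consists of the families $D=\{D(\omega)\}_{\omega\in\Omega}$ of subsets of $S$ with measurable graph for which there is a tempered random variable $\rho\ge0$ (measurable, with $\frac1t\log^+\rho(\theta_t\omega)\to0$ as $t\to\pm\infty$ almost surely) such that, almost surely, $D(\theta_t\omega)\subset \bar B(0,\rho(\theta_t\omega))$ for all $t\in\mathbb R$. -/

import Mathlib

open Set Filter Topology MeasureTheory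
open scoped NNReal ENNReal

noncomputable section

namespace YoungDelay

/-- Euclidean space `ℝ^d`. -/
abbrev Vec (d : ℕ) := EuclideanSpace ℝ (Fin d)

/-- The history space `C([-r,0], ℝ^d)` with the supremum norm. -/
abbrev Hist (r : ℝ) (d : ℕ) := C(Icc (-r) 0, Vec d)

/-! ### The separable Hölder spaces `C^{0,α}([a,b], ℝ^d)` -/

/-- The closure of the smooth paths in the `α`-Hölder norm (supremum norm plus Hölder seminorm) on
`[a,b]`: paths `η` with finite Hölder norm which for every `ε > 0` are `ε`-close, in the supremum
norm and in the Hölder seminorm, to (the restriction of) a smooth path `p`. -/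
def littleHolder (α : ℝ≥0) (a b : ℝ) (d : ℕ) : Submodule ℝ C(Icc a b, Vec d) where
  carrier := {η | MemHolder α (η : Icc a b → Vec d) ∧ ∀ ε : ℝ≥0, 0 < ε → ∃ p : ℝ → Vec d,
    ContDiff ℝ ((⊤ : ℕ∞) : WithTop ℕ∞) p ∧ (∀ s : Icc a b, ‖η s - p s‖ ≤ ε) ∧
      HolderWith ε α (fun s : Icc a b => η s - p s)}
  zero_mem' := by
    refine ⟨memHolder_zero, fun ε hε => ⟨0, contDiff_const, fun s => by simp, ?_⟩⟩
    intro x y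
    simp
  add_mem' := by
    rintro η ξ ⟨hη, hη'⟩ ⟨hξ, hξ'⟩
    refine ⟨hη.add hξ, fun ε hε => ?_⟩
    obtain ⟨p, hp, hp1, hp2⟩ := hη' (ε / 2) (half_pos hε)
    obtain ⟨q, hq, hq1, hq2⟩ := hξ' (ε / 2) (half_pos hε)
    refine ⟨fun s => p s + q s, hp.add hq, fun s => ?_, ?_⟩
    · have h1 := hp1 s
      have h2 := hq1 s
      have h3 : (η + ξ) s - (p s + q s) = (η s - p s) + (ξ s - q s) := by
        simp only [ContinuousMap.add_apply]; abel
      rw [h3]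
      refine (norm_add_le _ _).trans ?_
      push_cast at h1 h2
      linarith
    · have h := hp2.add hq2
      rw [add_halves] at h
      have e : (fun s : Icc a b => (η + ξ) s - (p s + q s)) =
          (fun s : Icc a b => η s - p s) + fun s : Icc a b => ξ s - q s := by
        funext s
        simp only [ContinuousMap.add_apply, Pi.add_apply]; abel
      rw [e]
      exact h
  smul_mem' := by
    rintro c η ⟨hη, hη'⟩
    refine ⟨hη.smul, fun ε hε => ?_⟩
    have hc : (0 : ℝ≥0) < ‖c‖₊ + 1 := by positivity
    obtain ⟨p, hp, hp1, hp2⟩ := hη' (ε / (‖c‖₊ + 1)) (div_pos hε hc)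
    have hle : ε / (‖c‖₊ + 1) * ‖c‖₊ ≤ ε := by
      rw [div_mul_eq_mul_div]
      refine div_le_of_le_mul₀ (by positivity) (by positivity) ?_
      gcongr
      simp
    refine ⟨fun s => c • p s, hp.const_smul c, fun s => ?_, ?_⟩
    · rw [ContinuousMap.smul_apply, ← smul_sub, norm_smul, mul_comm]
      refine (mul_le_mul_of_nonneg_right (hp1 s) (norm_nonneg c)).trans ?_
      exact_mod_cast hle
    · have h := (hp2.smul c).mono hle
      have e : (fun s : Icc a b => (c • η) s - c • p s) =
          c • fun s : Icc a b => η s - p s := by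
        funext s
        simp only [ContinuousMap.smul_apply, Pi.smul_apply, smul_sub]
      rw [e]
      exact h

/-- `C^{0,α}([a,b], ℝ^d)` as a type, to be normed by the Hölder norm. -/
def LittleHolder (α : ℝ≥0) (a b : ℝ) (d : ℕ) : Type := littleHolder α a b d

namespace LittleHolder

variable {α : ℝ≥0} {a b : ℝ} {d : ℕ}

instance : AddCommGroup (LittleHolder α a b d) :=
  inferInstanceAs (AddCommGroup (littleHolder α a b d))

instance : Module ℝ (LittleHolder α a b d) :=
  inferInstanceAs (Module ℝ (littleHolder α a b d))

/-- The underlying continuous path. -/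
def path (η : LittleHolder α a b d) : C(Icc a b, Vec d) := Subtype.val η

/-- The norm `‖η‖_∞ + sup_{s<t} ‖η t - η s‖ / (t-s)^α`. -/
instance : Norm (LittleHolder α a b d) :=
  ⟨fun η => ‖η.path‖ + (nnHolderNorm α (η.path : Icc a b → Vec d) : ℝ)⟩

theorem norm_def (η : LittleHolder α a b d) :
    ‖η‖ = ‖η.path‖ + (nnHolderNorm α (η.path : Icc a b → Vec d) : ℝ) := rfl

theorem memHolder (η : LittleHolder α a b d) : MemHolder α (η.path : Icc a b → Vec d) :=
  η.2.1

instance : NormedAddCommGroup (LittleHolder α a b d) :=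
  NormedAddCommGroup.ofCore (𝕜 := ℝ)
    { norm_nonneg := fun η => by rw [norm_def]; positivity
      norm_smul := fun c η => by
        have h := η.memHolder.nnHolderNorm_smul (α := ℝ) c
        have h1 : (c • η).path = c • η.path := rfl
        rw [norm_def, norm_def, h1, norm_smul, ContinuousMap.coe_smul, h, mul_add]
        simp
      norm_triangle := fun η ξ => by
        have h := η.memHolder.nnHolderNorm_add_le ξ.memHolder
        have h0 : (η + ξ).path = η.path + ξ.path := rfl
        have h1 := norm_add_le η.path ξ.path
        have h2 : (nnHolderNorm α ((η.path : Icc a b → Vec d) + (ξ.path : Icc a b → Vec d)) : ℝ)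
          ≤ nnHolderNorm α (η.path : Icc a b → Vec d)
            + nnHolderNorm α (ξ.path : Icc a b → Vec d) := by exact_mod_cast h
        rw [norm_def, norm_def, norm_def, h0, ContinuousMap.coe_add]
        linarith
      norm_eq_zero_iff := fun η => by
        constructor
        · intro h
          rw [norm_def] at h
          have h1 : ‖η.path‖ = 0 := by
            have := norm_nonneg η.path
            have := NNReal.coe_nonneg (nnHolderNorm α (η.path : Icc a b → Vec d))
            linarith
          exact Subtype.ext (norm_eq_zero.mp h1)
        · rintro rfl
          have h0 : (0 : LittleHolder α a b d).path = 0 := rfl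
          rw [norm_def, h0, ContinuousMap.coe_zero, nnHolderNorm_zero]
          simp }

instance : NormedSpace ℝ (LittleHolder α a b d) where
  norm_smul_le := fun c η => by
    have h := η.memHolder.nnHolderNorm_smul (α := ℝ) c
    have h1 : (c • η).path = c • η.path := rfl
    rw [norm_def, norm_def, h1, norm_smul, ContinuousMap.coe_smul, h, mul_add]
    simp

instance : MeasurableSpace (LittleHolder α a b d) := borel _

instance : BorelSpace (LittleHolder α a b d) := ⟨rfl⟩

end LittleHolder

/-! ### The canonical noise space `C^{0,ν}_0(ℝ, ℝ^m)` and the Wiener shift -/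

/-- Paths on `ℝ` vanishing at `0` whose restriction to every compact interval lies in `C^{0,ν}`. -/
def NoisePath (ν : ℝ≥0) (m : ℕ) : Type :=
  {ω : C(ℝ, Vec m) // ω 0 = 0 ∧ ∀ a b : ℝ, ω.restrict (Icc a b) ∈ littleHolder ν a b m}

namespace NoisePath

variable {ν : ℝ≥0} {m : ℕ}

/-- The underlying continuous path. -/
def path (ω : NoisePath ν m) : C(ℝ, Vec m) := Subtype.val ω

/-- Restriction to a compact interval, as an element of the Hölder space. -/
def restr (a b : ℝ) (ω : NoisePath ν m) : LittleHolder ν a b m :=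
  ⟨ω.path.restrict (Icc a b), ω.2.2 a b⟩

/-- The topology of convergence in the `ν`-Hölder norm on every interval `[-n,n]`, i.e. the
topology of the metric `∑ₙ 2⁻ⁿ (‖x - y‖_{∞,ν,[-n,n]} ∧ 1)`. -/
instance : TopologicalSpace (NoisePath ν m) :=
  ⨅ n : ℕ, TopologicalSpace.induced (restr (-(n : ℝ)) (n : ℝ)) inferInstance

instance : MeasurableSpace (NoisePath ν m) := borel _

instance : BorelSpace (NoisePath ν m) := ⟨rfl⟩

/-- The Wiener shift `(θ_t ω)(s) = ω(t+s) - ω(t)`. -/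
def shift (t : ℝ) (ω : NoisePath ν m) : NoisePath ν m :=
  ⟨⟨fun s => ω.path (t + s) - ω.path t, by fun_prop⟩, by simp, fun a b => by
    have key : ∀ {C : ℝ≥0} {h : Icc (t + a) (t + b) → Vec m}, HolderWith C ν h →
        HolderWith C ν (fun s : Icc a b => h ⟨t + s, by
          have := s.2.1; have := s.2.2; constructor <;> linarith⟩) := by
      intro C h hh x y
      refine (hh _ _).trans (le_of_eq ?_)
      simp [edist_dist, Subtype.dist_eq]
    obtain ⟨⟨C, hC⟩, h2⟩ := ω.2.2 (t + a) (t + b)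
    refine ⟨⟨C, ?_⟩, fun ε hε => ?_⟩
    · intro x y
      have := key hC x y
      simpa [edist_sub_right, path] using this
    · obtain ⟨p, hp, hp1, hp2⟩ := h2 ε hε
      refine ⟨fun s => p (t + s) - ω.path t, ?_, fun s => ?_, ?_⟩
      · exact (hp.comp (contDiff_const.add contDiff_id)).sub contDiff_const
      · have := hp1 ⟨t + s, by have := s.2.1; have := s.2.2; constructor <;> linarith⟩
        simpa [path] using this
      · have := key hp2
        simpa [path] using this⟩

end NoisePath

/-- `P` is invariant and ergodic under the flow `θ`: every measurable set which is
invariant under all `θ_t` has probability `0` or `1`. For `θ` the Wiener shift, invariance of the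
law means that the canonical process has stationary increments. -/
structure IsErgodicFlow {Ω : Type*} [MeasurableSpace Ω] (θ : ℝ → Ω → Ω) (P : Measure Ω) :
    Prop where
  measurePreserving : ∀ t : ℝ, MeasurePreserving (θ t) P P
  ergodic : ∀ B : Set Ω, MeasurableSet B → (∀ t : ℝ, θ t ⁻¹' B = B) → P B = 0 ∨ P B = 1

/-! ### The delay equation -/

/-- The segment `y_t(s) = y(t+s)`, `s ∈ [-r,0]`. -/
def segment {d : ℕ} (r : ℝ) (y : C(ℝ, Vec d)) (t : ℝ) : Hist r d :=
  ⟨fun s => y (t + s), by fun_prop⟩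

/-- `I` is the Young integral `∫_a^b h(u) dx(u)`: the limit of the Riemann–Stieltjes sums as
the mesh of the partition `a = t_0 ≤ … ≤ t_n = b` tends to `0`, for arbitrary tags `ξ_i`. -/
def HasYoungIntegral {d m : ℕ} (h : ℝ → Vec m →L[ℝ] Vec d) (x : ℝ → Vec m) (a b : ℝ)
    (I : Vec d) : Prop :=
  ∀ ε > 0, ∃ δ > 0, ∀ (n : ℕ) (t ξ : ℕ → ℝ), t 0 = a → t n = b →
    (∀ i < n, t i ≤ ξ i ∧ ξ i ≤ t (i + 1) ∧ t (i + 1) - t i < δ) →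
    ‖∑ i ∈ Finset.range n, h (ξ i) (x (t (i + 1)) - x (t i)) - I‖ < ε

/-- `y` solves `dy = [A y + f(y_t)] dt + g(y_t) dx`, `y_0 = η` on `[-r,∞)`, in the class of paths
which are `β₀`-Hölder on `[-r,T]` for every `T`. Only the values of `y` on `[-r,∞)` matter; taking
`y` defined on `ℝ` is a convenience. -/
structure IsSolution {d m : ℕ} (r : ℝ) (β₀ : ℝ≥0) (A : Matrix (Fin d) (Fin d) ℝ)
    (f : Hist r d → Vec d) (g : Hist r d → Vec m →L[ℝ] Vec d) (x : ℝ → Vec m) (η : Hist r d)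
    (y : C(ℝ, Vec d)) : Prop where
  initial : segment r y 0 = η
  holder : ∀ T : ℝ, MemHolder β₀ ((Icc (-r) T).domRestrict y)
  equation : ∀ t : ℝ, 0 ≤ t → HasYoungIntegral (fun u => g (segment r y u)) x 0 t
    (y t - y 0 - ∫ u in (0 : ℝ)..t, (Matrix.toEuclideanCLM (𝕜 := ℝ) A (y u) + f (segment r y u)))

/-- `φ` is the solution flow of the equation on the phase space `C^{0,β₀}([-r,0], ℝ^d)`: for every
noise path `ω` and initial segment `η` there is a solution `y`, it is unique on `[-r,∞)`, and
`φ(t,ω,η)(s) = y(t+s)`. -/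
def IsSolutionFlow {d m : ℕ} {ν : ℝ≥0} (r : ℝ) (β₀ : ℝ≥0) (A : Matrix (Fin d) (Fin d) ℝ)
    (f : Hist r d → Vec d) (g : Hist r d → Vec m →L[ℝ] Vec d)
    (φ : ℝ≥0 → NoisePath ν m → LittleHolder β₀ (-r) 0 d → LittleHolder β₀ (-r) 0 d) : Prop :=
  ∀ ω η, ∃ y : C(ℝ, Vec d), IsSolution r β₀ A f g ω.path η.path y ∧
    (∀ z : C(ℝ, Vec d), IsSolution r β₀ A f g ω.path η.path z → EqOn z y (Ici (-r))) ∧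
    ∀ t : ℝ≥0, (φ t ω η).path = segment r y t

/-! ### Random dynamical systems and attractors -/

section RDS

variable {Ω S : Type*} [MeasurableSpace Ω]

/-- A continuous random dynamical system over the flow `θ`: jointly measurable, continuous
in time and state, with the cocycle property. -/
structure IsContinuousRDS [TopologicalSpace S] [MeasurableSpace S] (θ : ℝ → Ω → Ω)
    (φ : ℝ≥0 → Ω → S → S) : Prop where
  measurable : Measurable (fun p : ℝ≥0 × Ω × S => φ p.1 p.2.1 p.2.2)
  continuous : ∀ ω, Continuous (fun p : ℝ≥0 × S => φ p.1 ω p.2)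
  map_zero : ∀ ω η, φ 0 ω η = η
  cocycle : ∀ (s t : ℝ≥0) (ω : Ω) (η : S), φ (t + s) ω η = φ t (θ s ω) (φ s ω η)

/-- A random set: its graph is measurable. -/
def IsRandomSet [MeasurableSpace S] (D : Ω → Set S) : Prop :=
  MeasurableSet {p : Ω × S | p.2 ∈ D p.1}

/-- A compact random set. -/
structure IsCompactRandomSet [MetricSpace S] [MeasurableSpace S] (A : Ω → Set S) : Prop where
  isRandomSet : IsRandomSet A
  nonempty : ∀ ω, (A ω).Nonempty
  isCompact : ∀ ω, IsCompact (A ω)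
  measurable_infDist : ∀ η : S, Measurable (fun ω => Metric.infDist η (A ω))

/-- A tempered random variable. -/
structure IsTempered (θ : ℝ → Ω → Ω) (P : Measure Ω) (ρ : Ω → ℝ) : Prop where
  measurable : Measurable ρ
  nonneg : ∀ ω, 0 ≤ ρ ω
  atTop : ∀ᵐ ω ∂P, Tendsto (fun t : ℝ => 1 / t * Real.posLog (ρ (θ t ω))) atTop (𝓝 0)
  atBot : ∀ᵐ ω ∂P, Tendsto (fun t : ℝ => 1 / t * Real.posLog (ρ (θ t ω))) atBot (𝓝 0)

/-- The universe of tempered random sets: random sets `D` with `D(ω) ⊆ B(0, ρ(ω))` almost surely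
for a tempered radius `ρ`, the exceptional null set being invariant under `θ`, i.e. almost surely
the inclusion holds along the whole orbit. -/
def temperedUniverse [NormedAddCommGroup S] [MeasurableSpace S] (θ : ℝ → Ω → Ω)
    (P : Measure Ω) : Set (Ω → Set S) :=
  {D | IsRandomSet D ∧ ∃ ρ : Ω → ℝ, IsTempered θ P ρ ∧
    ∀ᵐ ω ∂P, ∀ t : ℝ, D (θ t ω) ⊆ Metric.closedBall 0 (ρ (θ t ω))}

/-- The Hausdorff semi-distance `sup_{x ∈ E} inf_{y ∈ F} d(x,y)`. -/
def hausdorffSemidist [MetricSpace S] (E F : Set S) : ℝ≥0∞ := ⨆ x ∈ E, Metric.infEDist x F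

/-- A random pullback attractor for the family `𝒟`. -/
structure IsPullbackAttractor [MetricSpace S] [MeasurableSpace S] (θ : ℝ → Ω → Ω)
    (P : Measure Ω) (φ : ℝ≥0 → Ω → S → S) (𝒟 : Set (Ω → Set S)) (A : Ω → Set S) : Prop where
  isCompactRandomSet : IsCompactRandomSet A
  invariant : ∀ᵐ ω ∂P, ∀ t : ℝ≥0, φ t ω '' A ω = A (θ t ω)
  attracts : ∀ D ∈ 𝒟, ∀ᵐ ω ∂P, Tendsto
    (fun t : ℝ≥0 => hausdorffSemidist (φ t (θ (-t) ω) '' D (θ (-t) ω)) (A ω)) atTop (𝓝 0)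

end RDS

end YoungDelay

end

open YoungDelay

/-! Pathwise calculus. A solution is encoded by its germ (`IsGermSol`): apart from the drift, its
increment over [s,t] is g(y_s)(x_t - x_s) up to an error of some order larger than 1. The sewing
lemma turns any such error into one of order α + ν, with a constant linear in the Hölder bound M of
y and carrying the factor Cg·X, where X is the ν-Hölder constant of the driver. The increments of y
are thus controlled, with the better exponent ν, by the α-Hölder norm of y itself. Steps on which
this is a contraction yield `growth`: over [0,T] the Hölder norm grows at most by a factor
exponential in a power 1/(ν - α) of L, the constant of that linear control. Applied to one solution
this is the a priori bound; applied to the difference of two it is the stability estimate, where the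
local Lipschitz bound on Dg enters. Stability yields uniqueness, existence (the driver is a ν-Hölder
limit of smooth paths, for which the equation is an ordinary delay equation) and continuity of the
flow.

Dissipativity. Remove the noise from y: the remainder v is differentiable, and variation of
constants together with C_A·C_f < λ makes it decay exponentially, up to the size of the noise. Hence
there is a block length T over which the flow contracts by exp(-1 + C(Cg X)^p), up to an additive
term, with p = 1/(ν - β): for small Cg·X by the decay, for large Cg·X because C(Cg X)^p pays for the
whole growth factor (`exists_block_estimate`). T and C do not depend on g, which is why ε can be
chosen before g.

Ergodicity. Let X_j be the Hölder constants of the noise on the past blocks. On a shift-invariant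
set of full measure, the sum of X_j^p over n blocks is at most c(n + N) (`NoisePath.exists_tame`).
The map of time T need not be ergodic; the maximal ergodic inequality gives positive probability,
and ergodicity of the whole flow then gives probability one. If Cg^p·c is small, the contraction
wins in the product over blocks, and even initial values growing like exp(t/(2T)) are absorbed.

Attractor. The attractor consists of the pullback limits of initial values of exponential growth
rate δ, which include the points of tempered sets. After time r solutions are ν-Hölder, and bounded
sets of ν-Hölder paths are compact in the β₀-norm; this gives compactness, attraction and the C^β
regularity. Countably many initial values at discrete times suffice to describe the limit set,
whence measurability. Invariance costs a little of the rate, but the rates δ and 2δ give the same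
set. -/

noncomputable section

namespace YoungDelay


/-! ### Sewing -/

section Sewing

variable {E : Type*} [NormedAddCommGroup E]

/-- The constant of the sewing lemma with exponent `θ > 1`. -/
def sewConst (θ : ℝ) : ℝ := 2 / (1 - 2 ^ (1 - θ))

theorem two_rpow_one_sub_lt {θ : ℝ} (hθ : 1 < θ) : (2 : ℝ) ^ (1 - θ) < 1 :=
  Real.rpow_lt_one_of_one_lt_of_neg (by norm_num) (by linarith)

theorem sewConst_pos {θ : ℝ} (hθ : 1 < θ) : 0 < sewConst θ :=
  div_pos two_pos (by linarith [two_rpow_one_sub_lt hθ])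

theorem exists_cell {p : ℕ → ℝ} {i j : ℕ} (hij : i < j) {c : ℝ} (hi : p i ≤ c) (hj : c ≤ p j) :
    ∃ l, i ≤ l ∧ l < j ∧ p l ≤ c ∧ c ≤ p (l + 1) := by
  induction j, hij using Nat.le_induction with
  | base => exact ⟨i, le_rfl, Nat.lt_succ_self _, hi, hj⟩
  | succ n hn ih =>
    rcases le_total c (p n) with h | h
    · obtain ⟨l, h1, h2, h3⟩ := ih h
      exact ⟨l, h1, by omega, h3⟩
    · exact ⟨n, by omega, by omega, h, hj⟩

theorem sewing_self {Ξ : ℝ → ℝ → E} {C θ a b : ℝ} (hθ : 1 < θ)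
    (hΞ : ∀ s u t, a ≤ s → s ≤ u → u ≤ t → t ≤ b → ‖Ξ s t - Ξ s u - Ξ u t‖ ≤ C * (t - s) ^ θ)
    {s : ℝ} (hs : a ≤ s) (hs' : s ≤ b) : Ξ s s = 0 := by
  have := hΞ s s s hs le_rfl le_rfl hs'
  rw [sub_self, sub_self, Real.zero_rpow (by linarith), mul_zero] at this
  simpa using norm_le_zero_iff.mp this

/-- Riemann sums of an almost additive germ stay close to the germ. -/
theorem sewing_sum {Ξ : ℝ → ℝ → E} {C θ a b : ℝ} (hC : 0 ≤ C) (hθ : 1 < θ)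
    (hΞ : ∀ s u t, a ≤ s → s ≤ u → u ≤ t → t ≤ b → ‖Ξ s t - Ξ s u - Ξ u t‖ ≤ C * (t - s) ^ θ)
    {p : ℕ → ℝ} (hp : Monotone p) {i j : ℕ} (hij : i ≤ j) (ha : a ≤ p i) (hb : p j ≤ b) :
    ‖∑ k ∈ Finset.Ico i j, Ξ (p k) (p (k + 1)) - Ξ (p i) (p j)‖
      ≤ sewConst θ * C * (p j - p i) ^ θ := by
  obtain ⟨n, hn⟩ : ∃ n, n = j - i := ⟨_, rfl⟩
  induction n using Nat.strong_induction_on generalizing i j with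
  | _ n ih =>
  have hK := sewConst_pos hθ
  rcases hij.eq_or_lt with rfl | hlt
  · rw [Finset.Ico_self, Finset.sum_empty, sewing_self hθ hΞ ha hb, sub_self, norm_zero]
    have : 0 ≤ p i - p i := by simp
    positivity
  · have hd : p i ≤ p j := hp hij
    -- Split at the cell containing the midpoint. Both outer pieces have at most half the length and
    -- contribute 2·(d/2)^θ = 2^(1-θ)·d^θ by induction; the two defects around the cell cost 2·d^θ.
    -- `sewConst` is the solution of K = 2^(1-θ)·K + 2.
    obtain ⟨l, h1, h2, h3, h4⟩ := exists_cell (p := p) hlt (c := (p i + p j) / 2) (by linarith) (by linarith)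
    have hil : p i ≤ p l := hp h1
    have hl : p l ≤ p (l + 1) := hp (Nat.le_succ l)
    have hlj : p (l + 1) ≤ p j := hp h2
    have e1 := ih (l - i) (by omega) h1 ha (by linarith) rfl
    have e2 := ih (j - (l + 1)) (by omega) (i := l + 1) (j := j) h2 (by linarith) hb rfl
    have e3 := hΞ (p i) (p l) (p j) ha hil (by linarith) hb
    have e4 := hΞ (p l) (p (l + 1)) (p j) (by linarith) hl hlj hb
    set d := p j - p i with hdd
    have hd0 : 0 ≤ d := by linarith
    have f1 : (p l - p i) ^ θ ≤ (d / 2) ^ θ :=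
      Real.rpow_le_rpow (by linarith) (by linarith) (by linarith)
    have f2 : (p j - p (l + 1)) ^ θ ≤ (d / 2) ^ θ :=
      Real.rpow_le_rpow (by linarith) (by linarith) (by linarith)
    have f4 : (p j - p l) ^ θ ≤ d ^ θ :=
      Real.rpow_le_rpow (by linarith) (by linarith) (by linarith)
    have hsum : ∑ k ∈ Finset.Ico i j, Ξ (p k) (p (k + 1)) =
        ∑ k ∈ Finset.Ico i l, Ξ (p k) (p (k + 1)) + Ξ (p l) (p (l + 1)) +
          ∑ k ∈ Finset.Ico (l + 1) j, Ξ (p k) (p (k + 1)) := by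
      rw [← Finset.sum_Ico_succ_top h1, Finset.sum_Ico_consecutive _ (by omega) (by omega)]
    have hdec : ∑ k ∈ Finset.Ico i j, Ξ (p k) (p (k + 1)) - Ξ (p i) (p j) =
        (∑ k ∈ Finset.Ico i l, Ξ (p k) (p (k + 1)) - Ξ (p i) (p l)) +
        (∑ k ∈ Finset.Ico (l + 1) j, Ξ (p k) (p (k + 1)) - Ξ (p (l + 1)) (p j)) -
        (Ξ (p i) (p j) - Ξ (p i) (p l) - Ξ (p l) (p j)) -
        (Ξ (p l) (p j) - Ξ (p l) (p (l + 1)) - Ξ (p (l + 1)) (p j)) := by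
      rw [hsum]; abel
    rw [hdec]
    refine (norm_sub_le _ _).trans ((add_le_add ((norm_sub_le _ _).trans
      (add_le_add (norm_add_le _ _) le_rfl)) le_rfl).trans ?_)
    have g1 : (d / 2) ^ θ * 2 = 2 ^ (1 - θ) * d ^ θ := by
      rw [Real.div_rpow hd0 (by norm_num), Real.rpow_sub (by norm_num), Real.rpow_one]
      field_simp
    have g2 : sewConst θ * (1 - 2 ^ (1 - θ)) = 2 := by
      unfold sewConst
      exact div_mul_cancel₀ _ (by linarith [two_rpow_one_sub_lt hθ])
    have k1 : sewConst θ * C * (p l - p i) ^ θ ≤ sewConst θ * C * (d / 2) ^ θ := by gcongr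
    have k2 : sewConst θ * C * (p j - p (l + 1)) ^ θ ≤ sewConst θ * C * (d / 2) ^ θ := by gcongr
    have k4 : C * (p j - p l) ^ θ ≤ C * d ^ θ := by gcongr
    have fin : sewConst θ * C * (d / 2) ^ θ * 2 + 2 * (C * d ^ θ) = sewConst θ * C * d ^ θ := by
      linear_combination sewConst θ * C * g1 - C * d ^ θ * g2
    linarith

/-- The uniform partition of `[s,t]`. -/
def unif (s t : ℝ) (n k : ℕ) : ℝ := s + (t - s) * (k / n)

theorem unif_mono {s t : ℝ} (hst : s ≤ t) (n : ℕ) : Monotone (unif s t n) := by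
  intro k l hkl
  unfold unif
  have : 0 ≤ t - s := by linarith
  gcongr

theorem unif_zero (s t : ℝ) (n : ℕ) : unif s t n 0 = s := by simp [unif]

theorem unif_self (s t : ℝ) {n : ℕ} (hn : n ≠ 0) : unif s t n n = t := by
  have : (n : ℝ) ≠ 0 := by exact_mod_cast hn
  simp [unif, div_self this]

theorem unif_succ_sub (s t : ℝ) (n k : ℕ) : unif s t n (k + 1) - unif s t n k = (t - s) / n := by
  unfold unif; push_cast; ring

theorem tendsto_mul_div_rpow {θ : ℝ} (hθ : 1 < θ) {c : ℝ} (hc : 0 ≤ c) (C : ℝ) :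
    Tendsto (fun n : ℕ => (n : ℝ) * (C * (c / n) ^ θ)) atTop (𝓝 0) := by
  have h : Tendsto (fun n : ℕ => C * c ^ θ * (n : ℝ) ^ (-(θ - 1))) atTop (𝓝 (C * c ^ θ * 0)) :=
    ((tendsto_rpow_neg_atTop (by linarith : 0 < θ - 1)).comp
      tendsto_natCast_atTop_atTop).const_mul _
  rw [mul_zero] at h
  refine h.congr' ?_
  filter_upwards [eventually_gt_atTop 0] with n hn
  have hn' : (0 : ℝ) < n := by exact_mod_cast hn
  rw [Real.div_rpow hc hn'.le, neg_sub, Real.rpow_sub hn', Real.rpow_one]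
  ring

/-- An additive function close to an almost additive germ to some order `> 1` is close to it with
the constant of the sewing lemma. -/
theorem sewing_improve {Ξ : ℝ → ℝ → E} {G : ℝ → E} {C C' θ θ' a b : ℝ} (hC : 0 ≤ C) (hθ : 1 < θ)
    (hθ' : 1 < θ')
    (hΞ : ∀ s u t, a ≤ s → s ≤ u → u ≤ t → t ≤ b → ‖Ξ s t - Ξ s u - Ξ u t‖ ≤ C * (t - s) ^ θ)
    (hG : ∀ s t, a ≤ s → s ≤ t → t ≤ b → ‖G t - G s - Ξ s t‖ ≤ C' * (t - s) ^ θ')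
    {s t : ℝ} (hs : a ≤ s) (hst : s ≤ t) (ht : t ≤ b) :
    ‖G t - G s - Ξ s t‖ ≤ sewConst θ * C * (t - s) ^ θ := by
  -- Along the uniform partition the increments of `G` telescope and differ from the Riemann sum of
  -- the germ by at most n·C'((t-s)/n)^θ', which vanishes as n grows because θ' > 1. So `C'` and
  -- `θ'` leave no trace in the result.
  have key : ∀ n : ℕ, n ≠ 0 → ‖G t - G s - Ξ s t‖ ≤
      sewConst θ * C * (t - s) ^ θ + n * (C' * ((t - s) / n) ^ θ') := by
    intro n hn
    set p := unif s t n with hp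
    have hm : Monotone p := unif_mono hst n
    have p0 : p 0 = s := unif_zero s t n
    have pn : p n = t := unif_self s t hn
    have h1 := sewing_sum hC hθ hΞ hm (Nat.zero_le n) (by rw [p0]; exact hs) (by rw [pn]; exact ht)
    rw [p0, pn] at h1
    have h2 : ‖∑ k ∈ Finset.Ico 0 n, (G (p (k + 1)) - G (p k) - Ξ (p k) (p (k + 1)))‖
        ≤ n * (C' * ((t - s) / n) ^ θ') := by
      refine (norm_sum_le_of_le _ (f := fun k => G (p (k + 1)) - G (p k) - Ξ (p k) (p (k + 1)))
        (n := fun _ => C' * ((t - s) / n) ^ θ') fun k hk => ?_).trans (by simp)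
      have hk' : k < n := (Finset.mem_Ico.mp hk).2
      have := hG (p k) (p (k + 1)) (by rw [← p0] at hs; exact hs.trans (hm (Nat.zero_le _)))
        (hm (Nat.le_succ _)) (by rw [← pn] at ht; exact (hm (by omega : k + 1 ≤ n)).trans ht)
      rwa [show p (k + 1) - p k = (t - s) / n from unif_succ_sub s t n k] at this
    rw [Finset.sum_sub_distrib, ← Finset.range_eq_Ico, Finset.sum_range_sub (fun k => G (p k)), p0, pn] at h2
    rw [← Finset.range_eq_Ico] at h1
    calc ‖G t - G s - Ξ s t‖ = ‖(G t - G s - ∑ k ∈ Finset.range n, Ξ (p k) (p (k + 1))) +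
          (∑ k ∈ Finset.range n, Ξ (p k) (p (k + 1)) - Ξ s t)‖ := by congr 1; abel
      _ ≤ _ := (norm_add_le _ _).trans (by linarith)
  have hlim := (tendsto_mul_div_rpow hθ' (sub_nonneg.mpr hst) C').const_add
    (sewConst θ * C * (t - s) ^ θ)
  rw [add_zero] at hlim
  refine ge_of_tendsto hlim ?_
  filter_upwards [eventually_ne_atTop 0] with n hn using key n hn

end Sewing

/-- `y` is `α`-Hölder on `[a,b]` with constant `H`. -/
def HolOn {E : Type*} [NormedAddCommGroup E] (α H a b : ℝ) (y : ℝ → E) : Prop :=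
  ∀ s t, a ≤ s → s ≤ t → t ≤ b → ‖y t - y s‖ ≤ H * (t - s) ^ α

/-! ### Young integrals and germs of order larger than one. -/

section Young

variable {d m : ℕ}

/-- Up to sign the defect is (h u - h s)(x t - x u), a product of an α-Hölder and a ν-Hölder
increment. This is the almost additivity that sewing needs. -/
theorem young_delta {α ν H X a b : ℝ} (hα : 0 < α) (hν : 0 < ν) (hH : 0 ≤ H) (hX : 0 ≤ X)
    {h : ℝ → Vec m →L[ℝ] Vec d} {x : ℝ → Vec m} (hh : HolOn α H a b h) (hx : HolOn ν X a b x)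
    (s u t : ℝ) (h1 : a ≤ s) (h2 : s ≤ u) (h3 : u ≤ t) (h4 : t ≤ b) :
    ‖h s (x t - x s) - h s (x u - x s) - h u (x t - x u)‖ ≤ H * X * (t - s) ^ (α + ν) := by
  have e : h s (x t - x s) - h s (x u - x s) - h u (x t - x u) = -((h u - h s) (x t - x u)) := by
    simp only [map_sub, sub_apply]; abel
  rw [e, norm_neg]
  have e1 := hh s u h1 h2 (by linarith)
  have e2 := hx u t (by linarith) h3 h4
  have e3 : (u - s) ^ α ≤ (t - s) ^ α := Real.rpow_le_rpow (by linarith) (by linarith) hα.le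
  have e4 : (t - u) ^ ν ≤ (t - s) ^ ν := Real.rpow_le_rpow (by linarith) (by linarith) hν.le
  have e5 : (0 : ℝ) ≤ (t - s) ^ α := Real.rpow_nonneg (by linarith) _
  have e6 : (0 : ℝ) ≤ (u - s) ^ α := Real.rpow_nonneg (by linarith) _
  rcases eq_or_lt_of_le (show s ≤ t by linarith) with rfl | hst
  · have hu : u = s := le_antisymm h3 h2
    subst hu
    rw [sub_self, sub_self, sub_self, zero_apply, norm_zero]
    have : (0 : ℝ) ≤ 0 ^ (α + ν) := Real.rpow_nonneg le_rfl _
    positivity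
  rw [Real.rpow_add (by linarith)]
  calc _ ≤ ‖h u - h s‖ * ‖x t - x u‖ := ContinuousLinearMap.le_opNorm _ _
    _ ≤ (H * (t - s) ^ α) * (X * (t - s) ^ ν) := by
        gcongr
        · exact e1.trans (by gcongr)
        · exact e2.trans (by gcongr)
    _ = _ := by ring

/-- A function with the increments of a Young integral up to order `> 1` is the Young integral. -/
theorem hasYoungIntegral_of_germ {α ν θ H X C a b : ℝ} (hα : 0 < α) (hν : 0 < ν) (hθ : 1 < θ)
    (hαν : 1 < α + ν)
    (hH : 0 ≤ H) (hX : 0 ≤ X)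
    {h : ℝ → Vec m →L[ℝ] Vec d} {x : ℝ → Vec m} (hh : HolOn α H a b h) (hx : HolOn ν X a b x)
    {G : ℝ → Vec d}
    (hG : ∀ s t, a ≤ s → s ≤ t → t ≤ b → ‖G t - G s - h s (x t - x s)‖ ≤ C * (t - s) ^ θ) :
    HasYoungIntegral h x a b (G b - G a) := by
  have hG' := fun s t (hs : a ≤ s) (hst : s ≤ t) (ht : t ≤ b) =>
    sewing_improve (mul_nonneg hH hX) hαν hθ (young_delta hα hν hH hX hh hx) hG hs hst ht
  -- The first summand pays for replacing the increment of `G` by the germ at the left endpoint, the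
  -- second for moving the tag from the left endpoint to `ξ i`.
  set C₁ := sewConst (α + ν) * (H * X) + H * X with hC₁
  have hC₁0 : 0 ≤ C₁ := by have := (sewConst_pos hαν).le; positivity
  intro ε hε
  -- Each cell contributes at most C₁·δ^(α+ν-1) times its length, and the lengths add up to b - a.
  obtain ⟨δ, hδ, hδ'⟩ : ∃ δ > 0, C₁ * δ ^ (α + ν - 1) * (b - a) < ε := by
    have hc : Tendsto (fun δ : ℝ => C₁ * δ ^ (α + ν - 1) * (b - a)) (𝓝[>] 0) (𝓝 0) := by
      have : ContinuousAt (fun δ : ℝ => C₁ * δ ^ (α + ν - 1) * (b - a)) 0 :=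
        ((Real.continuousAt_rpow_const _ _ (Or.inr (by linarith))).const_mul _).mul_const _
      have h0 := this.tendsto
      rw [Real.zero_rpow (by linarith), mul_zero, zero_mul] at h0
      exact h0.mono_left nhdsWithin_le_nhds
    have := (hc.eventually (gt_mem_nhds hε)).and self_mem_nhdsWithin
    obtain ⟨δ, h1, h2⟩ := this.exists
    exact ⟨δ, h2, h1⟩
  refine ⟨δ, hδ, fun n p ξ p0 pn hp => ?_⟩
  have hmono : ∀ k l, k ≤ l → l ≤ n → p k ≤ p l := by
    intro k l hkl
    induction l, hkl using Nat.le_induction with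
    | base => intro _; exact le_rfl
    | succ l _ ih =>
      intro hl
      obtain ⟨h1, h2, -⟩ := hp l (by omega)
      exact (ih (by omega)).trans (h1.trans h2)
  have hsum : ∑ i ∈ Finset.range n, h (ξ i) (x (p (i + 1)) - x (p i)) - (G b - G a) =
      ∑ i ∈ Finset.range n, (h (ξ i) (x (p (i + 1)) - x (p i)) - (G (p (i + 1)) - G (p i))) := by
    rw [Finset.sum_sub_distrib, Finset.sum_range_sub (fun i => G (p i)), p0, pn]
  rw [hsum]
  have hterm : ∀ i ∈ Finset.range n,
      ‖h (ξ i) (x (p (i + 1)) - x (p i)) - (G (p (i + 1)) - G (p i))‖ ≤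
        C₁ * δ ^ (α + ν - 1) * (p (i + 1) - p i) := by
    intro i hi
    have hi' := Finset.mem_range.mp hi
    obtain ⟨h1, h2, h3⟩ := hp i hi'
    have ha : a ≤ p i := p0 ▸ hmono 0 i (Nat.zero_le _) hi'.le
    have hb : p (i + 1) ≤ b := pn ▸ hmono (i + 1) n hi' le_rfl
    rcases eq_or_lt_of_le (h1.trans h2) with he | hlt
    · rw [← he]; simp
    have hd : 0 < p (i + 1) - p i := by linarith
    have e1 := hG' _ _ ha (h1.trans h2) hb
    have e2 := hh _ _ ha h1 (by linarith)
    have e3 := hx _ _ ha (h1.trans h2) hb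
    have e4 : (ξ i - p i) ^ α ≤ (p (i + 1) - p i) ^ α :=
      Real.rpow_le_rpow (by linarith) (by linarith) hα.le
    have e5 : ‖(h (ξ i) - h (p i)) (x (p (i + 1)) - x (p i))‖ ≤
        H * X * (p (i + 1) - p i) ^ (α + ν) := by
      rw [Real.rpow_add hd]
      calc _ ≤ ‖h (ξ i) - h (p i)‖ * ‖x (p (i + 1)) - x (p i)‖ :=
            ContinuousLinearMap.le_opNorm _ _
        _ ≤ (H * (p (i + 1) - p i) ^ α) * (X * (p (i + 1) - p i) ^ ν) := by
            gcongr
            exact e2.trans (by gcongr)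
        _ = _ := by ring
    have e6 : h (ξ i) (x (p (i + 1)) - x (p i)) - (G (p (i + 1)) - G (p i)) =
        (h (ξ i) - h (p i)) (x (p (i + 1)) - x (p i)) -
          (G (p (i + 1)) - G (p i) - h (p i) (x (p (i + 1)) - x (p i))) := by
      rw [sub_apply]; abel
    have e7 : (p (i + 1) - p i) ^ (α + ν) ≤ δ ^ (α + ν - 1) * (p (i + 1) - p i) := by
      have : (p (i + 1) - p i) ^ (α + ν) =
          (p (i + 1) - p i) ^ (α + ν - 1) * (p (i + 1) - p i) := by
        rw [← Real.rpow_add_one hd.ne']; ring_nf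
      rw [this]
      gcongr
    rw [e6]
    refine (norm_sub_le _ _).trans ((add_le_add e5 e1).trans ?_)
    calc _ = C₁ * (p (i + 1) - p i) ^ (α + ν) := by rw [hC₁]; ring
      _ ≤ C₁ * (δ ^ (α + ν - 1) * (p (i + 1) - p i)) := by gcongr
      _ = _ := by ring
  refine lt_of_le_of_lt (norm_sum_le_of_le _ hterm) ?_
  rw [← Finset.mul_sum, Finset.sum_range_sub, p0, pn]
  exact hδ'

/-- Converse of `hasYoungIntegral_of_germ`: compare both integrals with Riemann sums over one
partition passing through s. The cells before s cancel, and `sewing_sum` compares the rest with the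
germ. -/
theorem HasYoungIntegral.increment {α ν H X a s t : ℝ} (hα : 0 < α) (hν : 0 < ν)
    (hαν : 1 < α + ν) (hH : 0 ≤ H) (hX : 0 ≤ X) (has : a ≤ s) (hst : s ≤ t)
    {h : ℝ → Vec m →L[ℝ] Vec d} {x : ℝ → Vec m} (hh : HolOn α H a t h) (hx : HolOn ν X a t x)
    {I J : Vec d} (hI : HasYoungIntegral h x a s I) (hJ : HasYoungIntegral h x a t J) :
    ‖J - I - h s (x t - x s)‖ ≤ sewConst (α + ν) * (H * X) * (t - s) ^ (α + ν) := by
  refine le_of_forall_pos_le_add fun ε hε => ?_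
  obtain ⟨δ₁, hδ₁, h1⟩ := hI (ε / 2) (by linarith)
  obtain ⟨δ₂, hδ₂, h2⟩ := hJ (ε / 2) (by linarith)
  obtain ⟨n, hn⟩ : ∃ n : ℕ, (t - a) / min δ₁ δ₂ < n := exists_nat_gt _
  have hδ : 0 < min δ₁ δ₂ := lt_min hδ₁ hδ₂
  have hn0 : n ≠ 0 := by
    rintro rfl
    have : 0 ≤ (t - a) / min δ₁ δ₂ := div_nonneg (by linarith) hδ.le
    simp at hn; linarith
  have hnpos : (0 : ℝ) < n := by positivity
  have hnδ : (t - a) / n < min δ₁ δ₂ := by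
    rw [div_lt_iff₀ hδ] at hn; rw [div_lt_iff₀ hnpos]; linarith
  -- n uniform cells on [a,s] followed by n uniform cells on [s,t].
  set p : ℕ → ℝ := fun k => if k ≤ n then unif a s n k else unif s t n (k - n) with hp
  have pl : ∀ k, k ≤ n → p k = unif a s n k := fun k hk => by simp [hp, hk]
  have pr : ∀ k, p (n + k) = unif s t n k := fun k => by
    rcases Nat.eq_zero_or_pos k with rfl | hk
    · simp [hp, unif_zero, unif_self a s hn0]
    · have : ¬ (n + k ≤ n) := by omega
      simp [hp, this]
  have hm : Monotone p := by
    refine monotone_nat_of_le_succ fun k => ?_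
    rcases lt_or_ge k n with hk | hk
    · rw [pl k hk.le, pl (k + 1) hk]; exact unif_mono has n (Nat.le_succ k)
    · obtain ⟨l, rfl⟩ := Nat.exists_eq_add_of_le hk
      rw [pr, add_assoc, pr]; exact unif_mono hst n (Nat.le_succ l)
  have p0 : p 0 = a := by rw [pl 0 (Nat.zero_le n), unif_zero]
  have pn : p n = s := by rw [pl n le_rfl, unif_self a s hn0]
  have p2n : p (n + n) = t := by rw [pr, unif_self s t hn0]
  have hmesh : ∀ k < n + n, p (k + 1) - p k < min δ₁ δ₂ := by
    intro k hk
    rcases lt_or_ge k n with hk | hk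
    · rw [pl k hk.le, pl (k + 1) hk, unif_succ_sub]
      refine lt_of_le_of_lt ?_ hnδ
      gcongr
    · obtain ⟨l, rfl⟩ := Nat.exists_eq_add_of_le hk
      rw [pr, add_assoc, pr, unif_succ_sub]
      refine lt_of_le_of_lt ?_ hnδ
      gcongr
  have a1 := h1 n p p p0 pn fun i hi => ⟨le_rfl, hm (Nat.le_succ i),
    (hmesh i (by omega)).trans_le (min_le_left _ _)⟩
  have a2 := h2 (n + n) p p p0 p2n fun i hi => ⟨le_rfl, hm (Nat.le_succ i),
    (hmesh i hi).trans_le (min_le_right _ _)⟩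
  have a3 := sewing_sum (Ξ := fun s t => h s (x t - x s)) (mul_nonneg hH hX) hαν
    (young_delta hα hν hH hX hh hx) hm (Nat.le_add_right n n) (by rw [pn]; exact has)
    (by rw [p2n])
  rw [pn, p2n] at a3
  rw [← Finset.sum_range_add_sum_Ico _ (Nat.le_add_right n n)] at a2
  set S1 := ∑ i ∈ Finset.range n, h (p i) (x (p (i + 1)) - x (p i))
  set S2 := ∑ i ∈ Finset.Ico n (n + n), h (p i) (x (p (i + 1)) - x (p i))
  calc ‖J - I - h s (x t - x s)‖ = ‖(S2 - h s (x t - x s)) - ((S1 + S2) - J) + (S1 - I)‖ := by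
        congr 1; abel
    _ ≤ _ := (norm_add_le _ _).trans ((add_le_add (norm_sub_le _ _) le_rfl).trans (by linarith))

end Young


/-! ### Growth of paths with self-controlled increments -/

section Growth

variable {E : Type*} [NormedAddCommGroup E]

/-- `y` is bounded by `M` and `α`-Hölder with constant `M` on `[-r,b]`. -/
structure HolderBdd (α r b M : ℝ) (y : ℝ → E) : Prop where
  bdd : ∀ t, -r ≤ t → t ≤ b → ‖y t‖ ≤ M
  hol : HolOn α M (-r) b y

theorem HolOn.mono {α H H' a b a' b' : ℝ} {y : ℝ → E} (h : HolOn α H a b y) (hH : H ≤ H')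
    (ha : a ≤ a') (hb : b' ≤ b) : HolOn α H' a' b' y := fun s t h1 h2 h3 =>
  (h s t (ha.trans h1) h2 (h3.trans hb)).trans
    (mul_le_mul_of_nonneg_right hH (Real.rpow_nonneg (by linarith) _))

theorem HolderBdd.mono {α r b b' M M' : ℝ} {y : ℝ → E} (h : HolderBdd α r b M y) (hM : M ≤ M')
    (hb : b' ≤ b) : HolderBdd α r b' M' y :=
  ⟨fun t h1 h2 => (h.bdd t h1 (h2.trans hb)).trans hM, h.hol.mono hM le_rfl hb⟩

theorem HolderBdd.nonneg {α r b M : ℝ} {y : ℝ → E} (h : HolderBdd α r b M y) (hb : -r ≤ b) :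
    0 ≤ M := (norm_nonneg _).trans (h.bdd b hb le_rfl)

theorem HolOn.concat {α H H' a b c : ℝ} (hα : 0 < α) (hH : 0 ≤ H) (hH' : 0 ≤ H') {y : ℝ → E}
    (h : HolOn α H a b y) (h' : HolOn α H' b c y) : HolOn α (H + H') a c y := by
  intro s t hs hst ht
  have e0 : 0 ≤ (t - s) ^ α := Real.rpow_nonneg (by linarith) _
  rcases le_total t b with htb | htb
  · refine (h s t hs hst htb).trans ?_
    gcongr
    linarith
  rcases le_total b s with hbs | hbs
  · refine (h' s t hbs hst ht).trans ?_
    gcongr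
    linarith
  have e1 := h s b hs hbs le_rfl
  have e2 := h' b t le_rfl htb ht
  have e3 : (b - s) ^ α ≤ (t - s) ^ α := Real.rpow_le_rpow (by linarith) (by linarith) hα.le
  have e4 : (t - b) ^ α ≤ (t - s) ^ α := Real.rpow_le_rpow (by linarith) (by linarith) hα.le
  calc ‖y t - y s‖ = ‖(y t - y b) + (y b - y s)‖ := by congr 1; abel
    _ ≤ _ := norm_add_le _ _
    _ ≤ H' * (t - s) ^ α + H * (t - s) ^ α :=
        add_le_add (e2.trans (by gcongr)) (e1.trans (by gcongr))
    _ = _ := by ring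

theorem HolderBdd.extend {α r a b B H : ℝ} (hα : 0 < α) (hr : 0 ≤ r) (ha : 0 ≤ a)
    (hb : b ≤ a + 1) (hH : 0 ≤ H) {y : ℝ → E} (h : HolderBdd α r a B y) (h' : HolOn α H a b y) :
    HolderBdd α r b (B + H) y := by
  have hB := h.nonneg (by linarith)
  refine ⟨fun t h1 h2 => ?_, h.hol.concat hα hB hH h'⟩
  rcases le_total t a with hta | hta
  · linarith [h.bdd t h1 hta]
  · have e1 := h' a t le_rfl hta h2
    have e2 : (t - a) ^ α ≤ 1 := Real.rpow_le_one (by linarith) (by linarith) hα.le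
    have e3 := h.bdd a (by linarith) le_rfl
    calc ‖y t‖ = ‖y a + (y t - y a)‖ := by congr 1; abel
      _ ≤ ‖y a‖ + ‖y t - y a‖ := norm_add_le _ _
      _ ≤ B + H := by nlinarith

/-- The map H ↦ H/4 + 3c/4 contracts to its fixed point c, so an arbitrary finite starting constant
can be forgotten. It serves to turn a merely qualitative Hölder bound into a quantitative one. -/
theorem affine_iterate_le {P : ℝ → Prop} {c H₀ : ℝ} (hc : 0 ≤ c) (hH₀ : 0 ≤ H₀) (h0 : P H₀)
    (hP : ∀ H, 0 ≤ H → P H → P (H / 4 + 3 * c / 4))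
    (hcl : ∀ u : ℕ → ℝ, (∀ n, P (u n)) → Tendsto u atTop (𝓝 c) → P c) : P c := by
  set u : ℕ → ℝ := fun n => c + (H₀ - c) * (1 / 4) ^ n with hu
  have hu0 : ∀ n, 0 ≤ u n := fun n => by
    have h1 : (0 : ℝ) ≤ (1 / 4) ^ n := by positivity
    have h2 : ((1 : ℝ) / 4) ^ n ≤ 1 := pow_le_one₀ (by norm_num) (by norm_num)
    simp only [hu]; nlinarith
  refine hcl u (fun n => ?_) ?_
  · induction n with
    | zero => simpa [hu] using h0
    | succ n ih =>
      have := hP _ (hu0 n) ih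
      convert this using 1
      simp only [hu, pow_succ]; ring
  · have h1 : Tendsto (fun n : ℕ => ((1 : ℝ) / 4) ^ n) atTop (𝓝 0) :=
      tendsto_pow_atTop_nhds_zero_of_lt_one (by norm_num) (by norm_num)
    simpa [hu] using (h1.const_mul (H₀ - c)).const_add c

/-- If y has Hölder constant H on the short interval [a,b], the hypothesis returns the constant (B +
H)/4 + D. The fixed point of this map is (B + 4D)/3, and adding B gives 4(B + D)/3. The finite bound
`H₀` only starts the iteration. -/
theorem growth_step {α ν r a b T L D B H₀ : ℝ} (hα : 0 < α) (hαν : α < ν) (hr : 0 ≤ r)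
    (hL : 0 ≤ L) (hD : 0 ≤ D) {y : ℝ → E}
    (hyp : ∀ b M, 0 ≤ b → b ≤ T → 0 ≤ M → HolderBdd α r b M y →
      ∀ s t, 0 ≤ s → s ≤ t → t ≤ b → ‖y t - y s‖ ≤ (L * M + D) * (t - s) ^ ν)
    (hfin : HolderBdd α r T H₀ y) (ha : 0 ≤ a) (hab : a ≤ b) (hbT : b ≤ T) (hb1 : b ≤ a + 1)
    (hτ : L * (b - a) ^ (ν - α) ≤ 1 / 4) (h0 : HolderBdd α r a B y) :
    HolderBdd α r b (4 / 3 * (B + D)) y := by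
  have hB := h0.nonneg (by linarith)
  have key : HolOn α ((B + 4 * D) / 3) a b y := by
    refine affine_iterate_le (P := fun H => HolOn α H a b y) (H₀ := H₀) (by positivity)
      (hfin.nonneg (by linarith)) (hfin.hol.mono le_rfl (by linarith) hbT) ?_ ?_
    · intro H hH hy s t hs hst ht
      have h1 := hyp b (B + H) (by linarith) hbT (by positivity)
        (h0.extend hα hr ha hb1 hH hy) s t (by linarith) hst ht
      refine h1.trans ?_
      have e0 : 0 ≤ (t - s) ^ α := Real.rpow_nonneg (by linarith) _
      have e1 : (t - s) ^ ν = (t - s) ^ (ν - α) * (t - s) ^ α := by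
        rcases eq_or_lt_of_le hst with rfl | hlt
        · rw [sub_self, Real.zero_rpow (by linarith), Real.zero_rpow (by linarith),
            Real.zero_rpow hα.ne', zero_mul]
        · rw [← Real.rpow_add (by linarith)]; ring_nf
      have e2 : (t - s) ^ (ν - α) ≤ (b - a) ^ (ν - α) :=
        Real.rpow_le_rpow (by linarith) (by linarith) (by linarith)
      have e3 : (t - s) ^ (ν - α) ≤ 1 :=
        Real.rpow_le_one (by linarith) (by linarith) (by linarith)
      rw [e1, ← mul_assoc]
      refine mul_le_mul_of_nonneg_right ?_ e0
      have e4 : L * (t - s) ^ (ν - α) ≤ 1 / 4 := (mul_le_mul_of_nonneg_left e2 hL).trans hτ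
      have e5 : (B + H) * (L * (t - s) ^ (ν - α)) ≤ (B + H) * (1 / 4) := by gcongr
      have e6 : D * (t - s) ^ (ν - α) ≤ D * 1 := by gcongr
      nlinarith
    · intro u hu hlim s t hs hst ht
      exact ge_of_tendsto (hlim.mul_const _) (Eventually.of_forall fun n => hu n s t hs hst ht)
  exact (h0.extend hα hr ha hb1 (by positivity) key).mono (by linarith) le_rfl

/-- The growth factor over `[0,T]` of a path whose increments are controlled by itself with a
constant `L`; `κ` is the gap between the two Hölder exponents. -/
def growthConst (κ T L : ℝ) : ℝ := (3 : ℝ) ^ (1 + T * (1 + (4 * L) ^ (1 / κ)))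

theorem growthConst_ge_one {κ T L : ℝ} (hT : 0 ≤ T) (hL : 0 ≤ L) : 1 ≤ growthConst κ T L :=
  Real.one_le_rpow (by norm_num) (by positivity)

/-- If increments of `y` are controlled by the Hölder norm of `y` in the past, with a better
exponent, then the Hölder norm of `y` is controlled by its initial value. -/
theorem growth {α ν r T L D B H₀ : ℝ} (hα : 0 < α) (hαν : α < ν) (hr : 0 ≤ r) (hT : 0 ≤ T)
    (hL : 0 ≤ L) (hD : 0 ≤ D) {y : ℝ → E}
    (hyp : ∀ b M, 0 ≤ b → b ≤ T → 0 ≤ M → HolderBdd α r b M y →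
      ∀ s t, 0 ≤ s → s ≤ t → t ≤ b → ‖y t - y s‖ ≤ (L * M + D) * (t - s) ^ ν)
    (hfin : HolderBdd α r T H₀ y) (h0 : HolderBdd α r 0 B y) :
    HolderBdd α r T (growthConst (ν - α) T L * (B + D)) y := by
  have hB := h0.nonneg (by linarith)
  set κ := ν - α with hκ
  have hκ0 : 0 < κ := by linarith
  -- Step length 1/q, chosen so that L·(1/q)^κ ≤ 1/4; the number of steps is then at most 1 + T·q,
  -- the exponent in `growthConst`.
  set q := 1 + (4 * L) ^ (1 / κ) with hq
  have hq0 : 0 ≤ (4 * L) ^ (1 / κ) := by positivity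
  have hq1 : 1 ≤ q := by linarith
  set τ := 1 / q with hτ
  have hτ0 : 0 < τ := by positivity
  have hτ1 : τ ≤ 1 := by rw [hτ, div_le_one (by linarith)]; exact hq1
  have hLτ : L * τ ^ κ ≤ 1 / 4 := by
    have h1 : 4 * L ≤ q ^ κ := by
      calc 4 * L = ((4 * L) ^ (1 / κ)) ^ κ := by
            rw [← Real.rpow_mul (by positivity), one_div_mul_cancel hκ0.ne', Real.rpow_one]
        _ ≤ q ^ κ := Real.rpow_le_rpow hq0 (by linarith) hκ0.le
    have h2 : 0 < q ^ κ := Real.rpow_pos_of_pos (by linarith) _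
    rw [hτ, Real.div_rpow (by norm_num) (by linarith), Real.one_rpow, mul_one_div,
      div_le_iff₀ h2]
    linarith
  -- The bound of `growth_step` multiplies by 4/3 only; the factor 3 leaves room for the correction
  -- -D, which keeps the recursion closed.
  have hstep : ∀ k : ℕ, HolderBdd α r (min T (k * τ)) (3 ^ k * (B + D) - D) y := by
    intro k
    induction k with
    | zero =>
      simp only [Nat.cast_zero, zero_mul, pow_zero, one_mul, add_sub_cancel_right]
      rwa [min_eq_right hT]
    | succ k ih =>
      have h1 : min T ((k : ℝ) * τ) ≤ min T (((k + 1 : ℕ) : ℝ) * τ) := by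
        refine min_le_min le_rfl ?_
        push_cast; nlinarith
      have h2 : min T (((k + 1 : ℕ) : ℝ) * τ) ≤ min T ((k : ℝ) * τ) + τ := by
        rw [← min_add_add_right]
        refine le_min ((min_le_left _ _).trans (by linarith)) ((min_le_right _ _).trans ?_)
        push_cast; linarith
      have h3 := growth_step hα hαν hr hL hD hyp hfin (le_min hT (by positivity)) h1
        (min_le_left _ _) (by linarith) ?_ ih
      · refine h3.mono ?_ le_rfl
        have : (1 : ℝ) ≤ 3 ^ k := one_le_pow₀ (by norm_num)
        rw [pow_succ]
        nlinarith
      · refine le_trans ?_ hLτ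
        gcongr
        linarith
  obtain ⟨n, hn1, hn2⟩ : ∃ n : ℕ, T * q ≤ n ∧ (n : ℝ) ≤ 1 + T * q :=
    ⟨⌈T * q⌉₊, Nat.le_ceil _, by linarith [Nat.ceil_lt_add_one (by positivity : 0 ≤ T * q)]⟩
  have h4 := hstep n
  rw [min_eq_left (by rw [hτ, mul_one_div, le_div_iff₀ (by linarith)]; exact hn1)] at h4
  refine h4.mono ?_ le_rfl
  have h5 : (3 : ℝ) ^ n ≤ growthConst κ T L := by
    rw [← Real.rpow_natCast]
    exact Real.rpow_le_rpow_of_exponent_le (by norm_num) hn2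
  nlinarith

end Growth

/-! ### Solutions through their local increments -/

section Germ

variable {d m : ℕ} {r : ℝ}

theorem segment_apply (y : C(ℝ, Vec d)) (t : ℝ) (s : Icc (-r) 0) :
    segment r y t s = y (t + s) := rfl

theorem continuous_segment (y : C(ℝ, Vec d)) : Continuous (segment r y) :=
  ContinuousMap.continuous_of_continuous_uncurry _
    (by unfold Function.uncurry; simp only [segment_apply]; fun_prop)

theorem continuous_drift {F : Hist r d → Vec d} (hF : Continuous F) (y : C(ℝ, Vec d)) :
    Continuous fun u => F (segment r y u) := hF.comp (continuous_segment y)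

theorem segment_sub (y z : C(ℝ, Vec d)) (t : ℝ) :
    segment r (y - z) t = segment r y t - segment r z t := rfl

theorem norm_segment_le {y : C(ℝ, Vec d)} {M b t : ℝ} (hM : 0 ≤ M)
    (h : ∀ t, -r ≤ t → t ≤ b → ‖y t‖ ≤ M) (h0 : 0 ≤ t) (ht : t ≤ b) : ‖segment r y t‖ ≤ M := by
  rw [ContinuousMap.norm_le _ hM]
  intro s
  have := s.2.1
  have := s.2.2
  exact h _ (by linarith) (by linarith)

theorem norm_segment_sub_le {α M b s t : ℝ} {y : C(ℝ, Vec d)} (hM : 0 ≤ M)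
    (h : HolOn α M (-r) b y) (hs : 0 ≤ s) (hst : s ≤ t) (ht : t ≤ b) :
    ‖segment r y t - segment r y s‖ ≤ M * (t - s) ^ α := by
  rw [ContinuousMap.norm_le _ (mul_nonneg hM (Real.rpow_nonneg (by linarith) _))]
  intro v
  have := v.2.1
  have := v.2.2
  have e := h (s + v) (t + v) (by linarith) (by linarith) (by linarith)
  rwa [add_sub_add_right_eq_sub] at e

theorem HolderBdd.norm_segment_le {α b M t : ℝ} {y : C(ℝ, Vec d)} (hr : 0 ≤ r)
    (h : HolderBdd α r b M y) (h0 : 0 ≤ t) (ht : t ≤ b) : ‖segment r y t‖ ≤ M :=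
  YoungDelay.norm_segment_le (h.nonneg (by linarith)) h.bdd h0 ht

theorem HolderBdd.norm_segment_sub_le {α b M s t : ℝ} {y : C(ℝ, Vec d)} (hr : 0 ≤ r)
    (h : HolderBdd α r b M y) (hs : 0 ≤ s) (hst : s ≤ t) (ht : t ≤ b) :
    ‖segment r y t - segment r y s‖ ≤ M * (t - s) ^ α :=
  YoungDelay.norm_segment_sub_le (h.nonneg (by linarith)) h.hol hs hst ht

/-- The part of the increment of `y` which is not produced by the drift `F`. -/
def noiseIncr (F : Hist r d → Vec d) (y : C(ℝ, Vec d)) (s t : ℝ) : Vec d :=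
  y t - y s - ∫ u in s..t, F (segment r y u)

/-- On `[0,T]` the path `y` has the increments `g(y_s) (x_t - x_s)`, besides those of the drift,
up to order `θ`. -/
def IsGermSol (F : Hist r d → Vec d) (g : Hist r d → Vec m →L[ℝ] Vec d) (x : ℝ → Vec m)
    (T θ C : ℝ) (y : C(ℝ, Vec d)) : Prop :=
  ∀ s t, 0 ≤ s → s ≤ t → t ≤ T →
    ‖noiseIncr F y s t - g (segment r y s) (x t - x s)‖ ≤ C * (t - s) ^ θ

theorem IsGermSol.mono {F : Hist r d → Vec d} {g : Hist r d → Vec m →L[ℝ] Vec d} {x : ℝ → Vec m}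
    {T T' θ C : ℝ} {y : C(ℝ, Vec d)} (h : IsGermSol F g x T θ C y) (hT : T' ≤ T) :
    IsGermSol F g x T' θ C y := fun s t h1 h2 h3 => h s t h1 h2 (h3.trans hT)

theorem noiseIncr_eq {F : Hist r d → Vec d} (hF : Continuous F) (y : C(ℝ, Vec d)) (s t : ℝ) :
    noiseIncr F y s t = (y t - ∫ u in (0 : ℝ)..t, F (segment r y u)) -
      (y s - ∫ u in (0 : ℝ)..s, F (segment r y u)) := by
  have hc := continuous_drift hF y
  have := intervalIntegral.integral_add_adjacent_intervals (μ := volume) (a := (0 : ℝ)) (b := s)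
    (c := t) (f := fun u => F (segment r y u)) (hc.intervalIntegrable _ _)
    (hc.intervalIntegrable _ _)
  unfold noiseIncr
  rw [← this]; abel

/-- The exponent and constant in a germ solution are only qualitative: sewing replaces them by α + ν
and a constant linear in M and in Cg·X. All linear estimates below start here. -/
theorem IsGermSol.improve {F : Hist r d → Vec d} (hF : Continuous F)
    {g : Hist r d → Vec m →L[ℝ] Vec d} {Cg : ℝ≥0} (hg : LipschitzWith Cg g) {x : ℝ → Vec m}
    {α ν T b θ C M X : ℝ} (hα : 0 < α) (hν : 0 < ν) (hαν : 1 < α + ν) (hr : 0 ≤ r) (hX : 0 ≤ X)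
    (hx : HolOn ν X 0 T x) (hθ : 1 < θ) {y : C(ℝ, Vec d)} (h : IsGermSol F g x T θ C y)
    (hb : b ≤ T) (hM0 : 0 ≤ M) (hM : HolderBdd α r b M y) :
    IsGermSol F g x b (α + ν) (sewConst (α + ν) * (Cg * M * X)) y := by
  intro s t hs hst ht
  have hh : HolOn α (Cg * M) 0 b fun u => g (segment r y u) := by
    intro s t hs hst ht
    have := hg.norm_sub_le (segment r y t) (segment r y s)
    refine this.trans ?_
    rw [mul_assoc]
    gcongr
    exact hM.norm_segment_sub_le hr hs hst ht
  have := sewing_improve (Ξ := fun s t => g (segment r y s) (x t - x s)) (C' := C) (θ' := θ)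
    (G := fun t => y t - ∫ u in (0 : ℝ)..t, F (segment r y u)) (mul_nonneg (by positivity) hX) hαν hθ
    (young_delta hα hν (by positivity) hX hh (hx.mono le_rfl le_rfl hb)) (fun s t h1 h2 h3 => by
      have := h s t h1 h2 (h3.trans hb)
      rwa [noiseIncr_eq hF] at this) hs hst ht
  rwa [← noiseIncr_eq hF] at this

theorem rpow_add_le {α ν u T : ℝ} (hα : 0 < α) (hα1 : α ≤ 1) (hν : 0 < ν) (hu : 0 ≤ u)
    (hT : 1 ≤ T) (huT : u ≤ T) : u ^ (α + ν) ≤ T * u ^ ν := by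
  rcases eq_or_lt_of_le hu with rfl | h
  · rw [Real.zero_rpow (by linarith), Real.zero_rpow hν.ne', mul_zero]
  · rw [Real.rpow_add h]
    gcongr
    calc u ^ α ≤ T ^ α := Real.rpow_le_rpow hu huT hα.le
      _ ≤ T ^ (1 : ℝ) := Real.rpow_le_rpow_of_exponent_le hT hα1
      _ = T := Real.rpow_one T

theorem le_mul_rpow {ν u T : ℝ} (hν : 0 < ν) (hν1 : ν ≤ 1) (hu : 0 ≤ u)
    (hT : 1 ≤ T) (huT : u ≤ T) : u ≤ T * u ^ ν := by
  rcases eq_or_lt_of_le hν1 with rfl | h1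
  · rw [Real.rpow_one]; nlinarith
  · have := rpow_add_le (α := 1 - ν) (ν := ν) (by linarith) (by linarith) hν hu hT huT
    simpa using this

theorem _root_.LipschitzWith.norm_le_add {V W : Type*} [NormedAddCommGroup V] [NormedAddCommGroup W]
    {f : V → W} {C : ℝ≥0} (hf : LipschitzWith C f) {x : V} {M : ℝ} (hM : ‖x‖ ≤ M) :
    ‖f x‖ ≤ ‖f 0‖ + C * M := by
  have h := hf.norm_sub_le x 0
  rw [sub_zero] at h
  calc ‖f x‖ = ‖f 0 + (f x - f 0)‖ := by congr 1; abel
    _ ≤ ‖f 0‖ + ‖f x - f 0‖ := norm_add_le _ _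
    _ ≤ _ := by gcongr; exact h.trans (by gcongr)

/-! ### A priori and stability estimates for germ solutions. -/

section Estimates

variable {F : Hist r d → Vec d} {CF : ℝ≥0} {g : Hist r d → Vec m →L[ℝ] Vec d} {Cg : ℝ≥0}
  {x : ℝ → Vec m} {α ν T b θ C M X : ℝ} {y : C(ℝ, Vec d)}

theorem norm_drift_le (hF : LipschitzWith CF F) (hr : 0 ≤ r) (hM : HolderBdd α r b M y) {s t : ℝ}
    (hs : 0 ≤ s) (hst : s ≤ t) (ht : t ≤ b) :
    ‖∫ u in s..t, F (segment r y u)‖ ≤ (‖F 0‖ + CF * M) * (t - s) := by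
  have := intervalIntegral.norm_integral_le_of_norm_le_const (a := s) (b := t)
    (f := fun u => F (segment r y u)) (C := ‖F 0‖ + CF * M) fun u hu => by
      rw [uIoc_of_le hst] at hu
      exact hF.norm_le_add (hM.norm_segment_le hr (by linarith [hu.1]) (by linarith [hu.2]))
  rwa [abs_of_nonneg (by linarith)] at this

/-- The noise part is estimated apart from the drift: M appears only with the factor Cg·X, so for
small Cg·X the noise is a small perturbation of the dissipative drift. -/
theorem IsGermSol.norm_noiseIncr_le (h : IsGermSol F g x T θ C y) (hF : LipschitzWith CF F)
    (hg : LipschitzWith Cg g) (hα : 0 < α) (hα1 : α ≤ 1) (hν : 0 < ν) (hαν : 1 < α + ν)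
    (hr : 0 ≤ r) (hT : 1 ≤ T) (hX : 0 ≤ X) (hx : HolOn ν X 0 T x) (hθ : 1 < θ)
    (hb : b ≤ T) (hM0 : 0 ≤ M) (hM : HolderBdd α r b M y) {s t : ℝ}
    (hs : 0 ≤ s) (hst : s ≤ t) (ht : t ≤ b) :
    ‖noiseIncr F y s t‖ ≤
      ((1 + sewConst (α + ν) * T) * (Cg * X) * M + ‖g 0‖ * X) * (t - s) ^ ν := by
  have hK := (sewConst_pos hαν).le
  have e1 := h.improve hF.continuous hg hα hν hαν hr hX hx hθ hb hM0 hM s t hs hst ht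
  have e2 := rpow_add_le hα hα1 hν (sub_nonneg.mpr hst) hT (by linarith)
  have e3 := hg.norm_le_add (hM.norm_segment_le hr hs (hst.trans ht))
  have e4 := hx s t hs hst (by linarith)
  have e0 : 0 ≤ (t - s) ^ ν := Real.rpow_nonneg (by linarith) _
  have e5 : ‖g (segment r y s) (x t - x s)‖ ≤ (‖g 0‖ + Cg * M) * (X * (t - s) ^ ν) :=
    (ContinuousLinearMap.le_opNorm _ _).trans (by gcongr)
  have e6 : sewConst (α + ν) * (Cg * M * X) * (t - s) ^ (α + ν) ≤
      sewConst (α + ν) * (Cg * M * X) * (T * (t - s) ^ ν) := by gcongr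
  calc ‖noiseIncr F y s t‖ = ‖(noiseIncr F y s t - g (segment r y s) (x t - x s)) +
        g (segment r y s) (x t - x s)‖ := by congr 1; abel
    _ ≤ _ := norm_add_le _ _
    _ ≤ _ := add_le_add (e1.trans e6) e5
    _ = _ := by ring

theorem IsGermSol.norm_sub_le (h : IsGermSol F g x T θ C y) (hF : LipschitzWith CF F)
    (hg : LipschitzWith Cg g) (hα : 0 < α) (hα1 : α ≤ 1) (hν : 0 < ν) (hν1 : ν ≤ 1)
    (hαν : 1 < α + ν)
    (hr : 0 ≤ r) (hT : 1 ≤ T) (hX : 0 ≤ X) (hx : HolOn ν X 0 T x) (hθ : 1 < θ)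
    (hb : b ≤ T) (hM0 : 0 ≤ M) (hM : HolderBdd α r b M y) {s t : ℝ}
    (hs : 0 ≤ s) (hst : s ≤ t) (ht : t ≤ b) :
    ‖y t - y s‖ ≤ ((T * CF + (1 + sewConst (α + ν) * T) * (Cg * X)) * M +
      (T * ‖F 0‖ + ‖g 0‖ * X)) * (t - s) ^ ν := by
  have e1 := h.norm_noiseIncr_le hF hg hα hα1 hν hαν hr hT hX hx hθ hb hM0 hM hs hst ht
  have e2 := norm_drift_le hF hr hM hs hst ht
  have e3 := le_mul_rpow hν hν1 (sub_nonneg.mpr hst) hT (by linarith)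
  have e4 : (‖F 0‖ + CF * M) * (t - s) ≤ (‖F 0‖ + CF * M) * (T * (t - s) ^ ν) := by gcongr
  calc ‖y t - y s‖ = ‖noiseIncr F y s t + ∫ u in s..t, F (segment r y u)‖ := by
        unfold noiseIncr; congr 1; abel
    _ ≤ _ := norm_add_le _ _
    _ ≤ _ := add_le_add e1 (e2.trans e4)
    _ = _ := by ring

/-- A priori estimate. -/
theorem IsGermSol.apriori (h : IsGermSol F g x T θ C y) (hF : LipschitzWith CF F)
    (hg : LipschitzWith Cg g) (hα : 0 < α) (hα1 : α < ν) (hν1 : ν ≤ 1) (hαν : 1 < α + ν)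
    (hr : 0 ≤ r) (hT : 1 ≤ T) (hX : 0 ≤ X) (hx : HolOn ν X 0 T x) (hθ : 1 < θ) {H B : ℝ}
    (hfin : HolderBdd α r T H y) (h0 : HolderBdd α r 0 B y) :
    HolderBdd α r T (growthConst (ν - α) T (T * CF + (1 + sewConst (α + ν) * T) * (Cg * X)) *
      (B + (T * ‖F 0‖ + ‖g 0‖ * X))) y := by
  have hK := (sewConst_pos hαν).le
  refine growth hα hα1 hr (by linarith) (by positivity) (by positivity) ?_ hfin h0
  intro b M _ hb hM0 hM s t hs hst ht
  exact h.norm_sub_le hF hg hα (by linarith) (by linarith) hν1 hαν hr hT hX hx hθ hb hM0 hM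
    hs hst ht

/-- Mean value inequality for τ ↦ g(p τ) - g(q τ) along the segments from ξ' to ξ and from ζ' to ζ,
which stay in the ball of radius M. It makes g(y_t) - g(y'_t) Hölder in time with a constant linear
in y - y'. -/
theorem norm_second_difference_le {V W : Type*} [NormedAddCommGroup V] [NormedSpace ℝ V]
    [NormedAddCommGroup W] [NormedSpace ℝ W] {g : V → W} (hg : Differentiable ℝ g) {c M L : ℝ}
    (hc : ∀ ξ, ‖fderiv ℝ g ξ‖ ≤ c) (hL0 : 0 ≤ L)
    (hL : ∀ ξ η, ‖ξ‖ ≤ M → ‖η‖ ≤ M → ‖fderiv ℝ g ξ - fderiv ℝ g η‖ ≤ L * ‖ξ - η‖)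
    {ξ ξ' ζ ζ' : V} (h1 : ‖ξ‖ ≤ M) (h2 : ‖ξ'‖ ≤ M) (h3 : ‖ζ‖ ≤ M) (h4 : ‖ζ'‖ ≤ M) :
    ‖(g ξ - g ξ') - (g ζ - g ζ')‖ ≤
      c * ‖(ξ - ξ') - (ζ - ζ')‖ + L * (‖ξ - ζ‖ + ‖ξ' - ζ'‖) * ‖ζ - ζ'‖ := by
  set p : ℝ → V := fun τ => ξ' + τ • (ξ - ξ')
  set q : ℝ → V := fun τ => ζ' + τ • (ζ - ζ')
  have hp : ∀ τ, HasDerivAt p (ξ - ξ') τ := fun τ => by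
    have := ((hasDerivAt_id τ).smul_const (ξ - ξ')).const_add ξ'
    rwa [one_smul] at this
  have hq : ∀ τ, HasDerivAt q (ζ - ζ') τ := fun τ => by
    have := ((hasDerivAt_id τ).smul_const (ζ - ζ')).const_add ζ'
    rwa [one_smul] at this
  have hd : ∀ τ, HasDerivAt (fun τ => g (p τ) - g (q τ))
      (fderiv ℝ g (p τ) (ξ - ξ') - fderiv ℝ g (q τ) (ζ - ζ')) τ := fun τ =>
    ((hg (p τ)).hasFDerivAt.comp_hasDerivAt τ (hp τ)).sub
      ((hg (q τ)).hasFDerivAt.comp_hasDerivAt τ (hq τ))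
  have hball : ∀ τ ∈ Icc (0 : ℝ) 1, ∀ a b : V, ‖a‖ ≤ M → ‖b‖ ≤ M → ‖b + τ • (a - b)‖ ≤ M := by
    intro τ hτ a b ha hb
    have : b + τ • (a - b) = (1 - τ) • b + τ • a := by module
    rw [this]
    refine (norm_add_le _ _).trans ?_
    rw [norm_smul, norm_smul, Real.norm_of_nonneg hτ.1, Real.norm_of_nonneg (by linarith [hτ.2])]
    nlinarith [hτ.1, hτ.2]
  have key := norm_image_sub_le_of_norm_deriv_le_segment_01' (f := fun τ => g (p τ) - g (q τ))
    (C := c * ‖(ξ - ξ') - (ζ - ζ')‖ + L * (‖ξ - ζ‖ + ‖ξ' - ζ'‖) * ‖ζ - ζ'‖)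
    (fun τ _ => (hd τ).hasDerivWithinAt) (fun τ hτ => ?_)
  · simp only [p, q, one_smul, zero_smul, add_zero, add_sub_cancel] at key
    convert key using 2
    abel
  · have hτ' : τ ∈ Icc (0 : ℝ) 1 := ⟨hτ.1, hτ.2.le⟩
    have e : fderiv ℝ g (p τ) (ξ - ξ') - fderiv ℝ g (q τ) (ζ - ζ') =
        fderiv ℝ g (p τ) ((ξ - ξ') - (ζ - ζ')) +
          (fderiv ℝ g (p τ) - fderiv ℝ g (q τ)) (ζ - ζ') := by
      simp only [map_sub, sub_apply]; abel
    rw [e]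
    refine (norm_add_le _ _).trans (add_le_add ?_ ?_)
    · exact (ContinuousLinearMap.le_opNorm _ _).trans (by gcongr; exact hc _)
    · refine (ContinuousLinearMap.le_opNorm _ _).trans ?_
      gcongr
      refine (hL _ _ (hball τ hτ' _ _ h1 h2) (hball τ hτ' _ _ h3 h4)).trans ?_
      gcongr
      have : p τ - q τ = (1 - τ) • (ξ' - ζ') + τ • (ξ - ζ) := by
        simp only [p, q]; module
      rw [this]
      refine (norm_add_le _ _).trans ?_
      rw [norm_smul, norm_smul, Real.norm_of_nonneg hτ.1,
        Real.norm_of_nonneg (by linarith [hτ.2])]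
      nlinarith [hτ.1, hτ.2, norm_nonneg (ξ - ζ), norm_nonneg (ξ' - ζ')]

/-- Stability estimate: the difference of two solutions is controlled by the differences of the
initial segments and of the drivers. -/
theorem IsGermSol.stability (hF : LipschitzWith CF F) (hg : Differentiable ℝ g) {L : ℝ}
    (hgC : ∀ ξ, ‖fderiv ℝ g ξ‖ ≤ Cg) (hL0 : 0 ≤ L)
    (hL : ∀ ξ η, ‖ξ‖ ≤ M → ‖η‖ ≤ M → ‖fderiv ℝ g ξ - fderiv ℝ g η‖ ≤ L * ‖ξ - η‖)
    (hα : 0 < α) (hα1 : α < ν) (hν1 : ν ≤ 1) (hαν : 1 < α + ν)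
    (hr : 0 ≤ r) (hT : 1 ≤ T) (hX : 0 ≤ X) {Δ B : ℝ} (hΔ : 0 ≤ Δ)
    {x' : ℝ → Vec m} {y' : C(ℝ, Vec d)} {θ' C' : ℝ} (hx : HolOn ν X 0 T x)
    (hx' : HolOn ν X 0 T x') (hxx' : HolOn ν Δ 0 T fun t => x t - x' t)
    (hθ : 1 < θ) (hθ' : 1 < θ')
    (h : IsGermSol F g x T θ C y) (h' : IsGermSol F g x' T θ' C' y')
    (hM : HolderBdd α r T M y) (hM' : HolderBdd α r T M y')
    (h0 : HolderBdd α r 0 B (y - y' : C(ℝ, Vec d))) :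
    HolderBdd α r T (growthConst (ν - α) T
      (T * CF + Cg * X + sewConst (α + ν) * T * ((Cg + 2 * L * M) * X)) *
      (B + (‖g 0‖ + Cg * M + sewConst (α + ν) * T * (Cg * M)) * Δ)) (y - y' : C(ℝ, Vec d)) := by
  have hK := (sewConst_pos hαν).le
  have hν : 0 < ν := by linarith
  have hM0 := hM.nonneg (by linarith)
  have hgL : LipschitzWith Cg g := lipschitzWith_of_nnnorm_fderiv_le hg fun ξ => hgC ξ
  have hfin : HolderBdd α r T (M + M) (y - y' : C(ℝ, Vec d)) := by
    refine ⟨fun t h1 h2 => (_root_.norm_sub_le _ _).trans (add_le_add (hM.bdd t h1 h2) (hM'.bdd t h1 h2)),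
      fun s t h1 h2 h3 => ?_⟩
    have e : (y - y') t - (y - y') s = (y t - y s) - (y' t - y' s) := by
      simp only [ContinuousMap.sub_apply]; abel
    rw [e, add_mul]
    exact (_root_.norm_sub_le _ _).trans (add_le_add (hM.hol s t h1 h2 h3) (hM'.hol s t h1 h2 h3))
  refine growth hα hα1 hr (by linarith) (by positivity) (by positivity) ?_ hfin h0
  intro b N _ hb hN0 hN s t hs hst ht
  -- the germ of the difference
  set Ξ : ℝ → ℝ → Vec d := fun s t =>
    g (segment r y s) (x t - x s) - g (segment r y' s) (x' t - x' s) with hΞ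
  have hseg : ∀ u, segment r (y - y') u = segment r y u - segment r y' u := fun u => rfl
  have hδ : ∀ s u t, 0 ≤ s → s ≤ u → u ≤ t → t ≤ b → ‖Ξ s t - Ξ s u - Ξ u t‖ ≤
      ((Cg + 2 * L * M) * N * X + Cg * M * Δ) * (t - s) ^ (α + ν) := by
    intro s u t hs hsu hut ht
    have hG : HolOn α ((Cg + 2 * L * M) * N) 0 b
        fun u => g (segment r y u) - g (segment r y' u) := by
      intro s t hs hst ht
      have e1 := norm_second_difference_le hg hgC hL0 hL (hM.norm_segment_le hr (by linarith : 0 ≤ t) (by linarith))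
        (hM'.norm_segment_le hr (by linarith : 0 ≤ t) (by linarith))
        (hM.norm_segment_le hr (by linarith : 0 ≤ s) (by linarith))
        (hM'.norm_segment_le hr (by linarith : 0 ≤ s) (by linarith))
      have e2 := hN.norm_segment_sub_le hr hs hst ht
      have e3 := hM.norm_segment_sub_le hr hs hst (by linarith)
      have e4 := hM'.norm_segment_sub_le hr hs hst (by linarith)
      have e5 := hN.norm_segment_le hr hs (by linarith)
      rw [hseg, hseg] at e2
      rw [hseg] at e5
      have e0 : 0 ≤ (t - s) ^ α := Real.rpow_nonneg (by linarith) _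
      refine e1.trans ?_
      calc _ ≤ Cg * (N * (t - s) ^ α) + L * (M * (t - s) ^ α + M * (t - s) ^ α) * N := by gcongr
        _ = _ := by ring
    have hG' : HolOn α (Cg * M) 0 b fun u => g (segment r y' u) := by
      intro s t hs hst ht
      refine (hgL.norm_sub_le _ _).trans ?_
      rw [mul_assoc]
      gcongr
      exact hM'.norm_segment_sub_le hr hs hst (by linarith)
    have d1 := young_delta hα hν (by positivity) hX hG (hx.mono le_rfl le_rfl hb) s u t hs hsu hut ht
    have d2 := young_delta hα hν (by positivity) hΔ hG' (hxx'.mono le_rfl le_rfl hb) s u t hs hsu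
      hut ht
    -- Bilinear splitting g(y)dx - g(y')dx' = (g(y) - g(y'))dx + g(y')d(x - x'); the first term is
    -- linear in N, the second in Δ.
    have e : Ξ s t - Ξ s u - Ξ u t =
      ((g (segment r y s) - g (segment r y' s)) (x t - x s) -
        (g (segment r y s) - g (segment r y' s)) (x u - x s) -
        (g (segment r y u) - g (segment r y' u)) (x t - x u)) +
      (g (segment r y' s) (x t - x' t - (x s - x' s)) - g (segment r y' s) (x u - x' u - (x s - x' s))
        - g (segment r y' u) (x t - x' t - (x u - x' u))) := by
      simp only [hΞ, map_sub, sub_apply]; abel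
    rw [e]
    refine (norm_add_le _ _).trans ((add_le_add d1 d2).trans (le_of_eq ?_))
    ring
  set G : ℝ → Vec d := fun t => (y t - ∫ u in (0 : ℝ)..t, F (segment r y u)) -
      (y' t - ∫ u in (0 : ℝ)..t, F (segment r y' u)) with hGdef
  have hGincr : ∀ s t, G t - G s = noiseIncr F y s t - noiseIncr F y' s t := by
    intro s t
    rw [noiseIncr_eq hF.continuous, noiseIncr_eq hF.continuous]
    simp only [hGdef]; abel
  have hi := h.improve hF.continuous hgL hα hν hαν hr hX hx hθ hb hM0 (hM.mono le_rfl hb)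
  have hi' := h'.improve hF.continuous hgL hα hν hαν hr hX hx' hθ' hb hM0 (hM'.mono le_rfl hb)
  -- The two separate germ estimates provide only the qualitative `C'`; the resulting constant is
  -- that of `hδ`, which is small together with N and Δ.
  have e1 := sewing_improve (Ξ := Ξ) (G := G) (by positivity) hαν hαν hδ
    (C' := sewConst (α + ν) * (Cg * M * X) + sewConst (α + ν) * (Cg * M * X))
    (fun s t h1 h2 h3 => by
      have e : G t - G s - Ξ s t = (noiseIncr F y s t - g (segment r y s) (x t - x s)) -
          (noiseIncr F y' s t - g (segment r y' s) (x' t - x' s)) := by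
        rw [hGincr]; simp only [hΞ]; abel
      rw [e, add_mul]
      exact (_root_.norm_sub_le _ _).trans (add_le_add (hi s t h1 h2 h3) (hi' s t h1 h2 h3)))
    hs hst ht
  have e2 := rpow_add_le hα (by linarith) hν (sub_nonneg.mpr hst) hT (by linarith)
  have e3 := le_mul_rpow hν hν1 (sub_nonneg.mpr hst) hT (by linarith)
  have e0 : 0 ≤ (t - s) ^ ν := Real.rpow_nonneg (by linarith) _
  have e4 : ‖(∫ u in s..t, F (segment r y u)) - ∫ u in s..t, F (segment r y' u)‖ ≤
      CF * N * (t - s) := by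
    rw [← intervalIntegral.integral_sub
      ((continuous_drift hF.continuous y).intervalIntegrable _ _)
      ((continuous_drift hF.continuous y').intervalIntegrable _ _)]
    have := intervalIntegral.norm_integral_le_of_norm_le_const (a := s) (b := t)
      (f := fun u => F (segment r y u) - F (segment r y' u)) (C := CF * N) fun u hu => by
        rw [uIoc_of_le hst] at hu
        refine (hF.norm_sub_le _ _).trans ?_
        gcongr
        rw [← hseg]
        exact hN.norm_segment_le hr (by linarith [hu.1]) (by linarith [hu.2])
    rwa [abs_of_nonneg (by linarith)] at this
  have e5 : ‖Ξ s t‖ ≤ (Cg * N) * (X * (t - s) ^ ν) + (‖g 0‖ + Cg * M) * (Δ * (t - s) ^ ν) := by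
    have e : Ξ s t = (g (segment r y s) - g (segment r y' s)) (x t - x s) +
        g (segment r y' s) (x t - x' t - (x s - x' s)) := by
      simp only [hΞ, map_sub, sub_apply]; abel
    rw [e]
    refine (norm_add_le _ _).trans (add_le_add ?_ ?_)
    · refine (ContinuousLinearMap.le_opNorm _ _).trans ?_
      gcongr
      · refine (hgL.norm_sub_le _ _).trans ?_
        gcongr
        rw [← hseg]
        exact hN.norm_segment_le hr hs (hst.trans ht)
      · exact hx s t hs hst (by linarith)
    · refine (ContinuousLinearMap.le_opNorm _ _).trans ?_
      gcongr
      · exact hgL.norm_le_add (hM'.norm_segment_le hr hs (by linarith))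
      · exact hxx' s t hs hst (by linarith)
  have e6 : (y - y') t - (y - y') s = (G t - G s - Ξ s t) + Ξ s t +
      ((∫ u in s..t, F (segment r y u)) - ∫ u in s..t, F (segment r y' u)) := by
    rw [hGincr]
    simp only [noiseIncr, ContinuousMap.sub_apply]; abel
  rw [e6]
  calc _ ≤ sewConst (α + ν) * ((Cg + 2 * L * M) * N * X + Cg * M * Δ) * (T * (t - s) ^ ν) +
        ((Cg * N) * (X * (t - s) ^ ν) + (‖g 0‖ + Cg * M) * (Δ * (t - s) ^ ν)) +
        CF * N * (T * (t - s) ^ ν) := by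
        refine (norm_add_le _ _).trans (add_le_add ((norm_add_le _ _).trans (add_le_add ?_ e5)) ?_)
        · exact e1.trans (by gcongr)
        · exact e4.trans (by gcongr)
    _ = _ := by ring

end Estimates

end Germ


/-! ### Delay differential equations with a continuous right-hand side -/

section DelayODE

variable {d : ℕ} {r T : ℝ}

/-- The path with initial segment `η` and, on `[0,T]`, the value `η(0) + exp(κ t) z(t)`. -/
def glueExp (hr : 0 ≤ r) (hT : 0 ≤ T) (κ : ℝ) (η : Hist r d) (z : C(Icc 0 T, Vec d)) :
    C(ℝ, Vec d) :=
  ⟨fun t => η (projIcc (-r) 0 (by linarith) t) +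
    Real.exp (κ * (projIcc 0 T hT t : ℝ)) • z (projIcc 0 T hT t), by
    have h1 : Continuous (projIcc (-r) 0 (by linarith : -r ≤ 0)) := continuous_projIcc
    have h2 : Continuous (projIcc 0 T hT) := continuous_projIcc
    fun_prop⟩

theorem glueExp_of_nonneg (hr : 0 ≤ r) (hT : 0 ≤ T) (κ : ℝ) (η : Hist r d) (z : C(Icc 0 T, Vec d))
    {t : ℝ} (ht : t ∈ Icc 0 T) : glueExp hr hT κ η z t =
      η ⟨0, by constructor <;> linarith⟩ + Real.exp (κ * t) • z ⟨t, ht⟩ := by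
  simp only [glueExp, ContinuousMap.coe_mk]
  rw [projIcc_of_mem hT ht, projIcc_of_right_le _ ht.1]

theorem glueExp_of_nonpos (hr : 0 ≤ r) (hT : 0 ≤ T) (κ : ℝ) (η : Hist r d) (z : C(Icc 0 T, Vec d))
    {t : ℝ} (ht : t ∈ Icc (-r) 0) : glueExp hr hT κ η z t =
      η ⟨t, ht⟩ + z ⟨0, by constructor <;> linarith⟩ := by
  simp only [glueExp, ContinuousMap.coe_mk]
  rw [projIcc_of_mem _ ht, projIcc_of_le_left _ ht.2]
  simp

theorem norm_segment_glueExp_sub_le (hr : 0 ≤ r) (hT : 0 ≤ T) {κ : ℝ} (hκ : 0 ≤ κ) (η : Hist r d)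
    (z w : C(Icc 0 T, Vec d)) {u : ℝ} (hu : 0 ≤ u) :
    ‖segment r (glueExp hr hT κ η z) u - segment r (glueExp hr hT κ η w) u‖ ≤
      Real.exp (κ * u) * ‖z - w‖ := by
  rw [ContinuousMap.norm_le _ (by positivity)]
  intro s
  have hs := s.2.2
  simp only [ContinuousMap.sub_apply, segment_apply, glueExp, ContinuousMap.coe_mk,
    add_sub_add_left_eq_sub]
  rw [← smul_sub, norm_smul, Real.norm_of_nonneg (Real.exp_pos _).le]
  have h1 : ‖z (projIcc 0 T hT (u + s)) - w (projIcc 0 T hT (u + s))‖ ≤ ‖z - w‖ :=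
    (z - w).norm_coe_le_norm _
  have h2 : (projIcc 0 T hT (u + s) : ℝ) ≤ u := by
    rw [coe_projIcc]
    exact max_le hu ((min_le_right _ _).trans (by linarith))
  gcongr

/-- Picard iteration in the unknown z, where y(t) = η(0) + exp(κt)·z(t). With κ = L + 1 the
exponential weight makes the Picard map a contraction with factor L/(L+1) on all of [0,T] at once.
-/
theorem exists_delay_ode (hr : 0 ≤ r) (hT : 0 ≤ T) {W : ℝ → Hist r d → Vec d}
    (hW : Continuous (Function.uncurry W)) {L : ℝ≥0}
    (hL : ∀ u, 0 ≤ u → u ≤ T → ∀ ξ ζ, ‖W u ξ - W u ζ‖ ≤ L * ‖ξ - ζ‖) (η : Hist r d) :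
    ∃ y : C(ℝ, Vec d), segment r y 0 = η ∧ ∀ t, 0 ≤ t → t ≤ T →
      y t - y 0 = ∫ u in (0 : ℝ)..t, W u (segment r y u) := by
  set κ : ℝ := L + 1 with hκ
  have hκ0 : 0 < κ := by positivity
  have hcont : ∀ y : C(ℝ, Vec d), Continuous fun u => W u (segment r y u) := fun y =>
    hW.comp (continuous_id.prodMk (continuous_segment y))
  set Φ : C(Icc 0 T, Vec d) → C(Icc 0 T, Vec d) := fun z =>
    ⟨fun t => Real.exp (-κ * t) •
      ∫ u in (0 : ℝ)..t, W u (segment r (glueExp hr hT κ η z) u), by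
      have := intervalIntegral.continuous_primitive (μ := volume)
        (fun a b => (hcont (glueExp hr hT κ η z)).intervalIntegrable a b) 0
      fun_prop⟩ with hΦ
  have hc : ContractingWith (L / (L + 1)) Φ := by
    refine ⟨?_, LipschitzWith.of_dist_le_mul fun z w => ?_⟩
    · rw [div_lt_one (by positivity)]
      exact lt_add_one L
    · rw [dist_eq_norm, dist_eq_norm, ContinuousMap.norm_le _ (by positivity)]
      intro t
      have ht := t.2.1
      simp only [hΦ, ContinuousMap.sub_apply, ContinuousMap.coe_mk]
      rw [← smul_sub, norm_smul, Real.norm_of_nonneg (Real.exp_pos _).le,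
        ← intervalIntegral.integral_sub ((hcont _).intervalIntegrable _ _)
        ((hcont _).intervalIntegrable _ _)]
      have h1 : ‖∫ u in (0 : ℝ)..t, (W u (segment r (glueExp hr hT κ η z) u) -
          W u (segment r (glueExp hr hT κ η w) u))‖ ≤
          ∫ u in (0 : ℝ)..t, L * ‖z - w‖ * Real.exp (κ * u) := by
        refine intervalIntegral.norm_integral_le_of_norm_le ht
          (Eventually.of_forall fun u hu => ?_)
          (by apply Continuous.intervalIntegrable; fun_prop)
        refine (hL u hu.1.le (hu.2.trans t.2.2) _ _).trans ?_
        rw [mul_assoc, mul_comm ‖z - w‖]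
        gcongr
        exact norm_segment_glueExp_sub_le hr hT hκ0.le η z w hu.1.le
      rw [intervalIntegral.integral_const_mul, intervalIntegral.integral_comp_mul_left
        (fun u => Real.exp u) hκ0.ne', integral_exp, mul_zero, Real.exp_zero, smul_eq_mul] at h1
      have h2 : Real.exp (-κ * t) * Real.exp (κ * t) = 1 := by
        rw [← Real.exp_add]; simp
      have h3 : κ⁻¹ * (Real.exp (κ * t) - 1) ≤ κ⁻¹ * Real.exp (κ * t) := by
        gcongr; linarith
      calc _ ≤ Real.exp (-κ * t) * (L * ‖z - w‖ * (κ⁻¹ * Real.exp (κ * t))) := by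
            gcongr; exact h1.trans (by gcongr)
        _ = (Real.exp (-κ * t) * Real.exp (κ * t)) * (L / κ * ‖z - w‖) := by
            rw [div_eq_mul_inv]; ring
        _ = _ := by rw [h2, one_mul]; push_cast; rfl
  obtain ⟨z, hz⟩ : ∃ z, Φ z = z := ⟨_, hc.fixedPoint_isFixedPt⟩
  have hz' : ∀ t : Icc 0 T, Real.exp (κ * t) • z t =
      ∫ u in (0 : ℝ)..t, W u (segment r (glueExp hr hT κ η z) u) := by
    intro t
    conv_lhs => rw [← hz]
    simp only [hΦ, ContinuousMap.coe_mk]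
    rw [smul_smul, ← Real.exp_add]
    simp
  -- `glueExp` adds z(0) on [-r,0], so the initial segment is η only because the fixed point
  -- vanishes at 0.
  have hz0 : z ⟨0, by constructor <;> linarith⟩ = 0 := by
    have := hz' ⟨0, by constructor <;> linarith⟩
    simpa using this
  refine ⟨glueExp hr hT κ η z, ?_, fun t ht htT => ?_⟩
  · ext1 s
    rw [segment_apply, zero_add, glueExp_of_nonpos hr hT κ η z s.2, hz0, add_zero]
  · rw [glueExp_of_nonneg hr hT κ η z ⟨ht, htT⟩, glueExp_of_nonneg hr hT κ η z ⟨le_rfl, hT⟩, hz0,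
      smul_zero]
    refine (add_sub_add_left_eq_sub _ _ _).trans ?_
    rw [sub_zero]
    exact hz' ⟨t, ht, htT⟩

end DelayODE

/-! ### Solutions driven by a smooth path -/

theorem HolOn.of_lipschitz {E : Type*} [NormedAddCommGroup E] {α a b C : ℝ} (hα : 0 < α)
    (hα1 : α ≤ 1) {y : ℝ → E} (hC : 0 ≤ C)
    (h : ∀ s t, a ≤ s → s ≤ t → t ≤ b → ‖y t - y s‖ ≤ C * (t - s)) :
    HolOn α (C * max 1 (b - a)) a b y := by
  intro s t hs hst ht
  refine (h s t hs hst ht).trans ?_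
  have := le_mul_rpow hα hα1 (sub_nonneg.mpr hst) (le_max_left 1 (b - a))
    (le_max_of_le_right (by linarith))
  rw [mul_assoc]
  gcongr

theorem exists_norm_le_of_continuous {E : Type*} [NormedAddCommGroup E] {f : ℝ → E}
    (hf : Continuous f) (a b : ℝ) : ∃ C, 0 ≤ C ∧ ∀ t, a ≤ t → t ≤ b → ‖f t‖ ≤ C := by
  obtain ⟨C, hC⟩ := (isCompact_Icc (a := a) (b := b)).exists_bound_of_continuousOn hf.continuousOn
  exact ⟨max C 0, le_max_right _ _, fun t h1 h2 => (hC t ⟨h1, h2⟩).trans (le_max_left _ _)⟩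

section Solutions

variable {d m : ℕ} {r : ℝ}

/-- `η` is bounded by `B` and `α`-Hölder with constant `B`. -/
def HistBdd (α B : ℝ) (η : Hist r d) : Prop :=
  ‖η‖ ≤ B ∧ ∀ s t : Icc (-r) 0, s ≤ t → ‖η t - η s‖ ≤ B * ((t : ℝ) - s) ^ α

theorem HolderBdd.histBdd {α b t M : ℝ} {y : C(ℝ, Vec d)} (hr : 0 ≤ r) (h : HolderBdd α r b M y)
    (h0 : 0 ≤ t) (ht : t ≤ b) : HistBdd α M (segment r y t) := by
  refine ⟨h.norm_segment_le hr h0 ht, fun s u hsu => ?_⟩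
  have h1 := s.2.1
  have h2 := u.2.2
  have h3 : (s : ℝ) ≤ u := hsu
  have := h.hol (t + s) (t + u) (by linarith) (by linarith) (by linarith)
  rwa [add_sub_add_left_eq_sub] at this

theorem HistBdd.holderBdd {α B : ℝ} {y : C(ℝ, Vec d)} (h : HistBdd α B (segment r y 0)) :
    HolderBdd α r 0 B y := by
  refine ⟨fun t h1 h2 => ?_, fun s t h1 h2 h3 => ?_⟩
  · have := ((segment r y 0).norm_coe_le_norm ⟨t, h1, h2⟩).trans h.1
    rwa [segment_apply, zero_add] at this
  · have := h.2 ⟨s, h1, by linarith⟩ ⟨t, by linarith, h3⟩ h2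
    rwa [segment_apply, segment_apply, zero_add, zero_add] at this

/-- The conditions on the exponents: `α` for the solution, `ν` for the driver. -/
structure IsExponents (α ν : ℝ) : Prop where
  pos : 0 < α
  lt : α < ν
  le_one : ν ≤ 1
  one_lt : 1 < α + ν

/-- The conditions on the drift and the diffusion coefficient. -/
structure IsCoeff (F : Hist r d → Vec d) (g : Hist r d → Vec m →L[ℝ] Vec d) (CF Cg : ℝ≥0) :
    Prop where
  lipF : LipschitzWith CF F
  diff : Differentiable ℝ g
  bound : ∀ ξ, ‖fderiv ℝ g ξ‖ ≤ Cg
  locLip : ∀ M : ℝ, 0 < M → ∃ L : ℝ, ∀ ξ η : Hist r d, ‖ξ‖ ≤ M → ‖η‖ ≤ M →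
    ‖fderiv ℝ g ξ - fderiv ℝ g η‖ ≤ L * ‖ξ - η‖

theorem IsCoeff.lip {F : Hist r d → Vec d} {g : Hist r d → Vec m →L[ℝ] Vec d} {CF Cg : ℝ≥0}
    (h : IsCoeff F g CF Cg) : LipschitzWith Cg g :=
  lipschitzWith_of_nnnorm_fderiv_le h.diff fun ξ => h.bound ξ

/-- `y` is an `α`-Hölder solution on `[0,T]`. -/
def IsYoungSol (α : ℝ) (F : Hist r d → Vec d) (g : Hist r d → Vec m →L[ℝ] Vec d) (x : ℝ → Vec m)
    (T : ℝ) (y : C(ℝ, Vec d)) : Prop :=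
  (∃ θ C, 1 < θ ∧ IsGermSol F g x T θ C y) ∧ ∃ H, HolderBdd α r T H y

variable {F : Hist r d → Vec d} {g : Hist r d → Vec m →L[ℝ] Vec d} {CF Cg : ℝ≥0} {α ν : ℝ}

theorem IsYoungSol.mono {x : ℝ → Vec m} {T T' : ℝ} {y : C(ℝ, Vec d)}
    (h : IsYoungSol α F g x T y) (hT : T' ≤ T) : IsYoungSol α F g x T' y := by
  obtain ⟨⟨θ, C, hθ, h1⟩, H, h2⟩ := h
  exact ⟨⟨θ, C, hθ, h1.mono hT⟩, H, h2.mono le_rfl hT⟩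

/-- For a C¹ driver this is the ordinary delay equation with right-hand side F(ξ) + g(ξ)p'(t).
Freezing g(y_u) at u = s costs a term of order (u - s)^α under the integral, so the germ error has
order 1 + α. -/
theorem exists_smooth_sol (hc : IsCoeff F g CF Cg) (he : IsExponents α ν) (hr : 0 ≤ r) {T : ℝ}
    (hT : 0 ≤ T) {p : ℝ → Vec m} (hp : ContDiff ℝ 1 p) {η : Hist r d} {B : ℝ} (hη : HistBdd α B η) :
    ∃ y : C(ℝ, Vec d), segment r y 0 = η ∧ IsYoungSol α F g p T y := by
  have hp' : Continuous (deriv p) := hp.continuous_deriv le_rfl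
  obtain ⟨P, hP0, hP⟩ := exists_norm_le_of_continuous hp' 0 T
  have hgc := hc.lip.continuous
  have hFc := hc.lipF.continuous
  obtain ⟨y, hy0, hy⟩ := exists_delay_ode (W := fun u ξ => F ξ + g ξ (deriv p u)) hr hT
    (by unfold Function.uncurry; fun_prop) (L := CF + Cg * P.toNNReal) (fun u hu huT ξ ζ => by
      have e : F ξ + g ξ (deriv p u) - (F ζ + g ζ (deriv p u)) =
        (F ξ - F ζ) + (g ξ - g ζ) (deriv p u) := by simp only [sub_apply]; abel
      rw [e, NNReal.coe_add, NNReal.coe_mul, Real.coe_toNNReal P hP0, add_mul]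
      refine (norm_add_le _ _).trans (add_le_add (hc.lipF.norm_sub_le _ _)
        ((ContinuousLinearMap.le_opNorm _ _).trans ?_))
      have h1 := hc.lip.norm_sub_le ξ ζ
      have h2 := hP u hu huT
      calc _ ≤ (Cg * ‖ξ - ζ‖) * P := by gcongr
        _ = _ := by ring) η
  have hcontg : Continuous fun u => g (segment r y u) (deriv p u) :=
    (hgc.comp (continuous_segment y)).clm_apply hp'
  have hcontF := continuous_drift hFc y
  have hincr : ∀ s t, 0 ≤ s → s ≤ t → t ≤ T → y t - y s =
      ∫ u in s..t, (F (segment r y u) + g (segment r y u) (deriv p u)) := by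
    intro s t hs hst ht
    have e1 := hy t (hs.trans hst) ht
    have e2 := hy s hs (hst.trans ht)
    have e3 := intervalIntegral.integral_add_adjacent_intervals (μ := volume)
      (f := fun u => F (segment r y u) + g (segment r y u) (deriv p u))
      ((hcontF.add hcontg).intervalIntegrable 0 s) ((hcontF.add hcontg).intervalIntegrable s t)
    rw [← e1, ← e2] at e3
    rw [← sub_sub_sub_cancel_right _ _ (y 0), ← e3, add_sub_cancel_left]
  obtain ⟨M, hM0, hM⟩ := exists_norm_le_of_continuous (hcontF.add hcontg) 0 T
  obtain ⟨N, hN0, hN⟩ := exists_norm_le_of_continuous y.continuous (-r) T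
  have hlip : ∀ s t, 0 ≤ s → s ≤ t → t ≤ T → ‖y t - y s‖ ≤ M * (t - s) := by
    intro s t hs hst ht
    rw [hincr s t hs hst ht]
    have := intervalIntegral.norm_integral_le_of_norm_le_const (a := s) (b := t)
      (f := fun u => F (segment r y u) + g (segment r y u) (deriv p u)) (C := M) fun u hu => by
        rw [uIoc_of_le hst] at hu
        exact hM u (by linarith [hu.1]) (by linarith [hu.2])
    rwa [abs_of_nonneg (by linarith)] at this
  have h0 : HolderBdd α r 0 B y := HistBdd.holderBdd (hy0 ▸ hη)
  have hB := h0.nonneg (by linarith)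
  have hhol := h0.hol.concat he.pos hB (by positivity)
    (HolOn.of_lipschitz he.pos (he.lt.le.trans he.le_one) hM0 hlip)
  set H := max N (B + M * max 1 (T - 0)) with hH
  have hHB : HolderBdd α r T H y :=
    ⟨fun t h1 h2 => (hN t h1 h2).trans (le_max_left _ _), hhol.mono (le_max_right _ _) le_rfl le_rfl⟩
  have hH0 : 0 ≤ H := hN0.trans (le_max_left _ _)
  refine ⟨y, hy0, ⟨1 + α, Cg * H * P, by linarith [he.pos], ?_⟩, H, hHB⟩
  intro s t hs hst ht
  have e1 : noiseIncr F y s t = ∫ u in s..t, g (segment r y u) (deriv p u) := by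
    unfold noiseIncr
    rw [hincr s t hs hst ht, intervalIntegral.integral_add (hcontF.intervalIntegrable _ _)
      (hcontg.intervalIntegrable _ _), add_sub_cancel_left]
  have e2 : g (segment r y s) (p t - p s) = ∫ u in s..t, g (segment r y s) (deriv p u) := by
    rw [ContinuousLinearMap.intervalIntegral_comp_comm _ (hp'.intervalIntegrable _ _),
      intervalIntegral.integral_deriv_eq_sub (fun u _ => (hp.differentiable one_ne_zero) u)
        (hp'.intervalIntegrable _ _)]
  have hcs : Continuous fun u => g (segment r y s) (deriv p u) :=
    (g (segment r y s)).continuous.comp hp'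
  rw [e1, e2, ← intervalIntegral.integral_sub (hcontg.intervalIntegrable _ _)
    (hcs.intervalIntegrable _ _)]
  have := intervalIntegral.norm_integral_le_of_norm_le_const (a := s) (b := t)
    (f := fun u => g (segment r y u) (deriv p u) - g (segment r y s) (deriv p u))
    (C := Cg * (H * (t - s) ^ α) * P) fun u hu => by
      rw [uIoc_of_le hst] at hu
      have hu1 : s ≤ u := hu.1.le
      rw [← sub_apply]
      refine (ContinuousLinearMap.le_opNorm _ _).trans ?_
      gcongr
      · refine (hc.lip.norm_sub_le _ _).trans ?_
        gcongr
        refine (hHB.norm_segment_sub_le hr hs hu1 (hu.2.trans ht)).trans ?_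
        gcongr
        · exact he.pos.le
        · exact hu.2
      · exact hP u (by linarith) (by linarith [hu.2])
  rw [abs_of_nonneg (by linarith)] at this
  refine this.trans (le_of_eq ?_)
  rcases eq_or_lt_of_le hst with rfl | hlt
  · rw [sub_self, Real.zero_rpow he.pos.ne', Real.zero_rpow (by linarith [he.pos])]; ring
  · rw [Real.rpow_add (by linarith), Real.rpow_one]; ring

theorem IsYoungSol.apriori_const (hc : IsCoeff F g CF Cg) (he : IsExponents α ν) (hr : 0 ≤ r)
    {T X : ℝ} (hT : 1 ≤ T) (hX : 0 ≤ X) : ∃ K, 0 ≤ K ∧ ∀ (x : ℝ → Vec m) (y : C(ℝ, Vec d)) (B : ℝ),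
      HolOn ν X 0 T x → IsYoungSol α F g x T y → HistBdd α B (segment r y 0) →
        HolderBdd α r T (K * (B + 1)) y := by
  have hs := (sewConst_pos he.one_lt).le
  have hg1 : 0 ≤ growthConst (ν - α) T (T * CF + (1 + sewConst (α + ν) * T) * (Cg * X)) :=
    zero_le_one.trans (growthConst_ge_one (by linarith) (by positivity))
  refine ⟨growthConst (ν - α) T (T * CF + (1 + sewConst (α + ν) * T) * (Cg * X)) *
    (1 + (T * ‖F 0‖ + ‖g 0‖ * X)), by positivity, fun x y B hx hy hB => ?_⟩
  obtain ⟨⟨θ, C, hθ, h1⟩, H, h2⟩ := hy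
  have h0 := hB.holderBdd
  have hB0 := h0.nonneg (by linarith)
  refine (h1.apriori hc.lipF hc.lip he.pos he.lt he.le_one he.one_lt hr hT hX hx hθ h2 h0).mono
    ?_ le_rfl
  rw [mul_assoc]
  refine mul_le_mul_of_nonneg_left ?_ hg1
  have : 0 ≤ T * ‖F 0‖ + ‖g 0‖ * X := by positivity
  nlinarith

/-- The a priori bound confines both solutions to a ball of radius M determined by `B₀`, T and X; Dg
is Lipschitz there, and K becomes uniform over all such solutions and drivers. -/
theorem IsYoungSol.stability_const (hc : IsCoeff F g CF Cg) (he : IsExponents α ν) (hr : 0 ≤ r)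
    {T X B₀ : ℝ} (hT : 1 ≤ T) (hX : 0 ≤ X) : ∃ K, 0 ≤ K ∧
      ∀ (x x' : ℝ → Vec m) (y y' : C(ℝ, Vec d)) (B Δ : ℝ), 0 ≤ Δ →
      HolOn ν X 0 T x → HolOn ν X 0 T x' → HolOn ν Δ 0 T (fun t => x t - x' t) →
      IsYoungSol α F g x T y → IsYoungSol α F g x' T y' → HistBdd α B₀ (segment r y 0) →
      HistBdd α B₀ (segment r y' 0) → HistBdd α B (segment r (y - y') 0) →
        HolderBdd α r T (K * (B + Δ)) (y - y' : C(ℝ, Vec d)) := by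
  obtain ⟨K₁, hK₁, hap⟩ := IsYoungSol.apriori_const hc he hr hT hX
  set M := max (K₁ * (B₀ + 1)) 1 with hMdef
  have hM1 : 1 ≤ M := le_max_right _ _
  obtain ⟨L₀, hL₀⟩ := hc.locLip M (by linarith)
  have hs := (sewConst_pos he.one_lt).le
  set L := max L₀ 0 with hLdef
  have hL0 : 0 ≤ L := le_max_right _ _
  have hL : ∀ ξ η : Hist r d, ‖ξ‖ ≤ M → ‖η‖ ≤ M →
      ‖fderiv ℝ g ξ - fderiv ℝ g η‖ ≤ L * ‖ξ - η‖ := fun ξ η h1 h2 =>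
    (hL₀ ξ η h1 h2).trans (by gcongr; exact le_max_left _ _)
  set G := growthConst (ν - α) T
      (T * CF + Cg * X + sewConst (α + ν) * T * ((Cg + 2 * L * M) * X)) with hG
  have hG1 : 1 ≤ G := growthConst_ge_one (by linarith) (by positivity)
  refine ⟨G * (1 + (‖g 0‖ + Cg * M + sewConst (α + ν) * T * (Cg * M))), by positivity,
    fun x x' y y' B Δ hΔ hx hx' hxx' hy hy' hB hB' hBB => ?_⟩
  have hM := (hap x y B₀ hx hy hB).mono (le_max_left _ 1) le_rfl
  have hM' := (hap x' y' B₀ hx' hy' hB').mono (le_max_left _ 1) le_rfl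
  obtain ⟨⟨θ, C, hθ, h1⟩, -⟩ := hy
  obtain ⟨⟨θ', C', hθ', h1'⟩, -⟩ := hy'
  have h0 := hBB.holderBdd
  have hB0 := h0.nonneg (by linarith)
  refine (IsGermSol.stability hc.lipF hc.diff hc.bound hL0 hL he.pos he.lt he.le_one he.one_lt hr hT
    hX hΔ hx hx' hxx' hθ hθ' h1 h1' hM hM' h0).mono ?_ le_rfl
  rw [mul_assoc G]
  refine mul_le_mul_of_nonneg_left ?_ (zero_le_one.trans hG1)
  have : 0 ≤ ‖g 0‖ + Cg * M + sewConst (α + ν) * T * (Cg * M) := by positivity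
  nlinarith

end Solutions


/-! ### Existence and uniqueness of solutions of the Young equation -/

section Existence

variable {d m : ℕ} {r : ℝ} {F : Hist r d → Vec d} {g : Hist r d → Vec m →L[ℝ] Vec d}
  {CF Cg : ℝ≥0} {α ν : ℝ}

/-- On every interval `[0,T]`, `x` is a limit of smooth paths in the `ν`-Hölder seminorm. -/
def IsDriver (ν : ℝ) (x : ℝ → Vec m) : Prop :=
  ∀ T ε : ℝ, 0 < ε → ∃ p : ℝ → Vec m, ContDiff ℝ 1 p ∧ HolOn ν ε 0 T fun t => x t - p t

theorem exists_holOn_of_contDiff (hν : 0 < ν) (hν1 : ν ≤ 1) {E : Type*} [NormedAddCommGroup E]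
    [NormedSpace ℝ E] {p : ℝ → E} (hp : ContDiff ℝ 1 p)
    (a b : ℝ) : ∃ X, 0 ≤ X ∧ HolOn ν X a b p := by
  obtain ⟨P, hP0, hP⟩ := exists_norm_le_of_continuous (hp.continuous_deriv le_rfl) a b
  refine ⟨P * max 1 (b - a), by positivity, HolOn.of_lipschitz hν hν1 hP0 fun s t hs hst ht => ?_⟩
  exact norm_image_sub_le_of_norm_deriv_le_segment'
    (fun u _ => ((hp.differentiable one_ne_zero) u).hasDerivAt.hasDerivWithinAt)
    (fun u hu => hP u (by linarith [hu.1]) (by linarith [hu.2])) t ⟨hst, le_rfl⟩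

theorem HolOn.add {E : Type*} [NormedAddCommGroup E] {α H H' a b : ℝ} {x y : ℝ → E}
    (hx : HolOn α H a b x) (hy : HolOn α H' a b y) :
    HolOn α (H + H') a b fun t => x t + y t := by
  intro s t hs hst ht
  rw [add_mul, add_sub_add_comm]
  exact (norm_add_le _ _).trans (add_le_add (hx s t hs hst ht) (hy s t hs hst ht))

theorem HolOn.neg {E : Type*} [NormedAddCommGroup E] {α H a b : ℝ} {x : ℝ → E}
    (hx : HolOn α H a b x) : HolOn α H a b fun t => - x t := by
  intro s t hs hst ht
  rw [neg_sub_neg, norm_sub_rev]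
  exact hx s t hs hst ht

theorem IsDriver.exists_holOn {x : ℝ → Vec m} (hx : IsDriver ν x) (hν : 0 < ν) (hν1 : ν ≤ 1)
    (T : ℝ) : ∃ X, 0 ≤ X ∧ HolOn ν X 0 T x := by
  obtain ⟨p, hp, h⟩ := hx T 1 one_pos
  obtain ⟨X, hX0, hX⟩ := exists_holOn_of_contDiff hν hν1 hp 0 T
  exact ⟨1 + X, by positivity, by simpa using h.add hX⟩

theorem histBdd_zero (α : ℝ) : HistBdd α 0 (0 : Hist r d) := by
  refine ⟨by simp, fun s t _ => by simp⟩

/-- Stability with equal drivers and equal initial segments. -/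
theorem IsYoungSol.eqOn (hc : IsCoeff F g CF Cg) (he : IsExponents α ν) (hr : 0 ≤ r)
    {x : ℝ → Vec m} {T X B : ℝ} (hT : 1 ≤ T) (hX : 0 ≤ X) (hx : HolOn ν X 0 T x)
    {y z : C(ℝ, Vec d)} (hy : IsYoungSol α F g x T y) (hz : IsYoungSol α F g x T z)
    (h0 : segment r y 0 = segment r z 0) (hB : HistBdd α B (segment r y 0)) :
    EqOn y z (Icc (-r) T) := by
  obtain ⟨K, hK0, hK⟩ := IsYoungSol.stability_const hc he hr (B₀ := B) hT hX
  have h := hK x x y z 0 0 le_rfl hx hx (fun s t _ _ _ => by simp) hy hz hB (h0 ▸ hB) (by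
    rw [segment_sub, h0, sub_self]; exact histBdd_zero α)
  intro t ht
  have := h.bdd t ht.1 ht.2
  rw [add_zero, mul_zero] at this
  exact sub_eq_zero.mp (norm_le_zero_iff.mp this)

theorem norm_segment_sub_segment_le {y z : C(ℝ, Vec d)} {T δ t : ℝ} (hδ : 0 ≤ δ)
    (h : ∀ t, -r ≤ t → t ≤ T → ‖y t - z t‖ ≤ δ) (h0 : 0 ≤ t) (ht : t ≤ T) :
    ‖segment r y t - segment r z t‖ ≤ δ :=
  norm_segment_le (y := y - z) (b := T) hδ h h0 ht

/-- Uniform limits of solutions are solutions. -/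
theorem IsYoungSol.of_tendsto (hc : IsCoeff F g CF Cg) (he : IsExponents α ν) (hr : 0 ≤ r)
    {T X M : ℝ} (hT : 0 ≤ T) (hX : 0 ≤ X) {x : ℝ → Vec m} {p : ℕ → ℝ → Vec m}
    {y : ℕ → C(ℝ, Vec d)} {z : C(ℝ, Vec d)} (hp : ∀ n, HolOn ν X 0 T (p n))
    (hy : ∀ n, IsYoungSol α F g (p n) T (y n)) (hM : ∀ n, HolderBdd α r T M (y n))
    (hpx : ∀ s t, 0 ≤ s → s ≤ t → t ≤ T → Tendsto (fun n => p n t - p n s) atTop (𝓝 (x t - x s)))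
    {δ : ℕ → ℝ} (hδ0 : ∀ n, 0 ≤ δ n) (hδ : Tendsto δ atTop (𝓝 0))
    (hyz : ∀ n t, -r ≤ t → t ≤ T → ‖y n t - z t‖ ≤ δ n) :
    IsYoungSol α F g x T z ∧ HolderBdd α r T M z := by
  have hM0 := (hM 0).nonneg (by linarith)
  have hlim : ∀ t, -r ≤ t → t ≤ T → Tendsto (fun n => y n t) atTop (𝓝 (z t)) := fun t h1 h2 => by
    rw [tendsto_iff_norm_sub_tendsto_zero]
    exact squeeze_zero (fun n => norm_nonneg _) (fun n => hyz n t h1 h2) hδ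
  have hMz : HolderBdd α r T M z := by
    refine ⟨fun t h1 h2 => ?_, fun s t h1 h2 h3 => ?_⟩
    · exact le_of_tendsto (hlim t h1 h2).norm (Eventually.of_forall fun n => (hM n).bdd t h1 h2)
    · exact le_of_tendsto ((hlim t (h1.trans h2) h3).sub (hlim s h1 (h2.trans h3))).norm
        (Eventually.of_forall fun n => (hM n).hol s t h1 h2 h3)
  refine ⟨⟨⟨α + ν, sewConst (α + ν) * (Cg * M * X), he.one_lt, fun s t hs hst ht => ?_⟩, M, hMz⟩,
    hMz⟩
  -- The improved germ estimate has constants independent of n, so it is a closed condition under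
  -- pointwise convergence.
  have hn : ∀ n, ‖noiseIncr F (y n) s t - g (segment r (y n) s) (p n t - p n s)‖ ≤
      sewConst (α + ν) * (Cg * M * X) * (t - s) ^ (α + ν) := by
    intro n
    obtain ⟨⟨θ, C, hθ, h1⟩, -⟩ := hy n
    exact h1.improve hc.lipF.continuous hc.lip he.pos (he.pos.trans he.lt) he.one_lt hr hX (hp n)
      hθ le_rfl hM0 (hM n) s t hs hst ht
  have hseg : ∀ u, 0 ≤ u → u ≤ T →
      Tendsto (fun n => segment r (y n) u) atTop (𝓝 (segment r z u)) := fun u h1 h2 => by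
    rw [tendsto_iff_norm_sub_tendsto_zero]
    exact squeeze_zero (fun n => norm_nonneg _)
      (fun n => norm_segment_sub_segment_le (hδ0 n) (hyz n) h1 h2) hδ
  have hint : Tendsto (fun n => ∫ u in s..t, F (segment r (y n) u)) atTop
      (𝓝 (∫ u in s..t, F (segment r z u))) := by
    rw [tendsto_iff_norm_sub_tendsto_zero]
    refine squeeze_zero (fun n => norm_nonneg _) (g := fun n => CF * δ n * (t - s)) (fun n => ?_) ?_
    · rw [← intervalIntegral.integral_sub
        ((continuous_drift hc.lipF.continuous _).intervalIntegrable _ _)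
        ((continuous_drift hc.lipF.continuous _).intervalIntegrable _ _)]
      have := intervalIntegral.norm_integral_le_of_norm_le_const (a := s) (b := t)
        (f := fun u => F (segment r (y n) u) - F (segment r z u)) (C := CF * δ n) fun u hu => by
          rw [uIoc_of_le hst] at hu
          refine (hc.lipF.norm_sub_le _ _).trans ?_
          gcongr
          exact norm_segment_sub_segment_le (hδ0 n) (hyz n) (by linarith [hu.1])
            (by linarith [hu.2])
      rwa [abs_of_nonneg (by linarith)] at this
    · simpa using (hδ.const_mul (CF : ℝ)).mul_const (t - s)
  have hg : Tendsto (fun n => g (segment r (y n) s) (p n t - p n s)) atTop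
      (𝓝 (g (segment r z s) (x t - x s))) := by
    have h1 : Tendsto (fun n => g (segment r (y n) s)) atTop (𝓝 (g (segment r z s))) :=
      (hc.lip.continuous.tendsto _).comp (hseg s hs (hst.trans ht))
    have h2 : Continuous fun q : (Vec m →L[ℝ] Vec d) × Vec m => q.1 q.2 :=
      isBoundedBilinearMap_apply.continuous
    exact (h2.tendsto _).comp (h1.prodMk_nhds (hpx s t hs hst ht))
  exact le_of_tendsto ((((hlim t (by linarith) ht).sub (hlim s (by linarith)
    (hst.trans ht))).sub hint).sub hg).norm (Eventually.of_forall hn)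

/-- C¹ approximations of the driver in the ν-Hölder seminorm have solutions which form a Cauchy
sequence in supremum norm, by stability. The limit keeps the uniform germ estimate. -/
theorem exists_youngSol (hc : IsCoeff F g CF Cg) (he : IsExponents α ν) (hr : 0 ≤ r)
    {x : ℝ → Vec m} (hx : IsDriver ν x) {T : ℝ} (hT : 1 ≤ T) {η : Hist r d} {B : ℝ}
    (hη : HistBdd α B η) : ∃ y : C(ℝ, Vec d), segment r y 0 = η ∧ IsYoungSol α F g x T y := by
  have hν := he.pos.trans he.lt
  have hT0 : 0 ≤ T := by linarith
  obtain ⟨X₀, hX₀, hxX⟩ := hx.exists_holOn hν he.le_one T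
  -- A common Hölder constant for all approximating drivers, whose distance to x is at most 1.
  set X := X₀ + 1 with hXdef
  have hX : 0 ≤ X := by linarith
  set ε : ℕ → ℝ := fun n => 1 / ((n : ℝ) + 1) with hε
  have hε0 : ∀ n, 0 < ε n := fun n => by positivity
  have hε1 : ∀ n, ε n ≤ 1 := fun n => by
    rw [hε]; simp only; rw [div_le_one (by positivity)]; linarith [(Nat.cast_nonneg n : (0 : ℝ) ≤ n)]
  have hεlim : Tendsto ε atTop (𝓝 0) := tendsto_one_div_add_atTop_nhds_zero_nat
  have hεanti : ∀ {n k : ℕ}, n ≤ k → ε k ≤ ε n := fun {n k} h => by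
    have : (n : ℝ) ≤ k := by exact_mod_cast h
    simp only [hε]; gcongr
  choose p hp hxp using fun n => hx T (ε n) (hε0 n)
  have hpX : ∀ n, HolOn ν X 0 T (p n) := fun n => by
    have := hxX.add ((hxp n).mono (hε1 n) le_rfl le_rfl).neg
    simpa using this
  choose y hy0 hy using fun n => exists_smooth_sol hc he hr hT0 (hp n) hη
  obtain ⟨K₁, hK₁0, hK₁⟩ := IsYoungSol.apriori_const hc he hr hT hX
  obtain ⟨K, hK0, hK⟩ := IsYoungSol.stability_const hc he hr (B₀ := B) hT hX
  have hdiff : ∀ n k, ∀ t, -r ≤ t → t ≤ T → ‖y n t - y k t‖ ≤ K * (ε n + ε k) := by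
    intro n k
    have := hK (p n) (p k) (y n) (y k) 0 (ε n + ε k) (by linarith [hε0 n, hε0 k]) (hpX n) (hpX k)
      (by
        have := ((hxp n).neg.add (hxp k)).mono le_rfl le_rfl le_rfl
        simpa using this) (hy n) (hy k) (by rw [hy0]; exact hη) (by rw [hy0]; exact hη)
      (by rw [segment_sub, hy0, hy0, sub_self]; exact histBdd_zero α)
    rw [zero_add] at this
    exact this.bdd
  have hrT : -r ≤ T := by linarith
  set w : ℕ → C(Icc (-r) T, Vec d) := fun n => (y n).restrict (Icc (-r) T) with hw
  have hcau : CauchySeq w := by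
    refine cauchySeq_of_le_tendsto_0 (fun n => K * (ε n + ε n)) (fun n k N hn hk => ?_)
      (by simpa using (hεlim.add hεlim).const_mul K)
    rw [dist_eq_norm, ContinuousMap.norm_le _ (mul_nonneg hK0 (by linarith [hε0 N]))]
    intro t
    refine (hdiff n k t t.2.1 t.2.2).trans ?_
    have := hεanti hn
    have := hεanti hk
    gcongr
  obtain ⟨w₀, hw₀⟩ := cauchySeq_tendsto_of_complete hcau
  have hδ : Tendsto (fun n => ‖w n - w₀‖) atTop (𝓝 0) := tendsto_iff_norm_sub_tendsto_zero.mp hw₀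
  set z : C(ℝ, Vec d) := ContinuousMap.IccExtend hrT w₀ with hz
  have hzt : ∀ t (ht : t ∈ Icc (-r) T), z t = w₀ ⟨t, ht⟩ := fun t ht => by
    simp [hz, IccExtend_of_mem hrT w₀ ht]
  have hyz : ∀ n t, -r ≤ t → t ≤ T → ‖y n t - z t‖ ≤ ‖w n - w₀‖ := fun n t h1 h2 => by
    rw [hzt t ⟨h1, h2⟩]
    exact (w n - w₀).norm_coe_le_norm ⟨t, h1, h2⟩
  refine ⟨z, ?_, (IsYoungSol.of_tendsto (M := K₁ * (B + 1)) hc he hr hT0 hX hpX hy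
    (fun n => hK₁ _ _ _ (hpX n) (hy n) (by rw [hy0]; exact hη)) (fun s t hs hst ht => ?_)
    (fun n => norm_nonneg _) hδ hyz).1⟩
  · ext1 s
    have h1 := s.2.1
    have h2 := s.2.2
    have hs : Tendsto (fun n => y n (0 + s)) atTop (𝓝 (z (0 + s))) := by
      rw [tendsto_iff_norm_sub_tendsto_zero]
      exact squeeze_zero (fun n => norm_nonneg _)
        (fun n => hyz n _ (by linarith) (by linarith)) hδ
    have : ∀ n, y n (0 + s) = η s := fun n => by rw [← hy0 n]; rfl
    simp only [this] at hs
    exact tendsto_nhds_unique hs tendsto_const_nhds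
  · rw [tendsto_iff_norm_sub_tendsto_zero]
    refine squeeze_zero (fun n => norm_nonneg _) (g := fun n => ε n * (t - s) ^ ν) (fun n => ?_) ?_
    · have := hxp n s t hs hst ht
      rw [norm_sub_rev] at this
      beta_reduce at this
      refine le_trans (le_of_eq ?_) this
      congr 1; abel
    · simpa using hεlim.mul_const ((t - s) ^ ν)

/-- There is a unique global solution. -/
theorem exists_global_youngSol (hc : IsCoeff F g CF Cg) (he : IsExponents α ν) (hr : 0 ≤ r)
    {x : ℝ → Vec m} (hx : IsDriver ν x) {η : Hist r d} {B : ℝ} (hη : HistBdd α B η) :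
    ∃ y : C(ℝ, Vec d), segment r y 0 = η ∧ ∀ T, IsYoungSol α F g x T y := by
  have hT : ∀ n : ℕ, (1 : ℝ) ≤ n + 1 := fun n => by
    linarith [(Nat.cast_nonneg n : (0 : ℝ) ≤ n)]
  choose Y hY0 hY using fun n : ℕ => exists_youngSol hc he hr hx (hT n) hη
  have huniq : ∀ n k : ℕ, n ≤ k → EqOn (Y n) (Y k) (Icc (-r) (n + 1)) := by
    intro n k hnk
    obtain ⟨X, hX0, hX⟩ := hx.exists_holOn (he.pos.trans he.lt) he.le_one (n + 1)
    have hnk' : (n : ℝ) ≤ k := by exact_mod_cast hnk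
    exact IsYoungSol.eqOn hc he hr (hT n) hX0 hX (hY n) ((hY k).mono (by linarith))
      (by rw [hY0, hY0]) (by rw [hY0]; exact hη)
  -- At time t use any of the solutions living beyond t; uniqueness makes the choice irrelevant.
  -- Left of -r the path is frozen to stay continuous.
  set Z : ℝ → Vec d := fun t => Y ⌈max t 0⌉₊ (max t (-r)) with hZ
  have hZY : ∀ (n : ℕ) (t : ℝ), t ≤ n + 1 → Z t = Y n (max t (-r)) := by
    intro n t ht
    have h1 : t ≤ ⌈max t 0⌉₊ := (le_max_left _ _).trans (Nat.le_ceil _)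
    have hmem : ∀ k : ℕ, t ≤ k + 1 → max t (-r) ∈ Icc (-r) ((k : ℝ) + 1) := fun k hk =>
      ⟨le_max_right _ _, max_le hk (by linarith [hT k])⟩
    rcases le_total ⌈max t 0⌉₊ n with h | h
    · exact huniq _ _ h (hmem _ (by linarith))
    · exact (huniq _ _ h (hmem _ ht)).symm
  have hZc : Continuous Z := by
    rw [continuous_iff_continuousAt]
    intro t
    have h1 : t < (⌈max t 0⌉₊ : ℝ) + 1 := by
      linarith [(le_max_left t 0).trans (Nat.le_ceil (max t 0))]
    have h2 : Z =ᶠ[𝓝 t] fun s => Y ⌈max t 0⌉₊ (max s (-r)) := by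
      filter_upwards [Iio_mem_nhds h1] with s hs using hZY _ s (le_of_lt hs)
    refine ContinuousAt.congr ?_ h2.symm
    fun_prop
  have hseg : ∀ (n : ℕ) (t : ℝ), 0 ≤ t → t ≤ n + 1 →
      segment r ⟨Z, hZc⟩ t = segment r (Y n) t := by
    intro n t h0 ht
    ext1 s
    have h1 := s.2.1
    have h2 := s.2.2
    rw [segment_apply, segment_apply, ContinuousMap.coe_mk, hZY n _ (by linarith),
      max_eq_left (by linarith)]
  refine ⟨⟨Z, hZc⟩, ?_, fun T => ?_⟩
  · rw [hseg 0 0 le_rfl (by norm_num), hY0]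
  · obtain ⟨n, hn⟩ := exists_nat_ge T
    obtain ⟨⟨θ, C, hθ, h1⟩, H, h2⟩ := hY n
    have hval : ∀ t : ℝ, -r ≤ t → t ≤ n + 1 → Z t = Y n t := fun t h h' => by
      rw [hZY n t h', max_eq_left h]
    refine ⟨⟨θ, C, hθ, fun s t hs hst ht => ?_⟩, H, fun t h h' => ?_, fun s t h h' h'' => ?_⟩
    · have := h1 s t hs hst (by linarith)
      unfold noiseIncr at this ⊢
      rw [hseg n s hs (by linarith), ContinuousMap.coe_mk, hval s (by linarith) (by linarith),
        hval t (by linarith) (by linarith)]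
      have e : ∫ u in s..t, F (segment r ⟨Z, hZc⟩ u) = ∫ u in s..t, F (segment r (Y n) u) := by
        refine intervalIntegral.integral_congr fun u hu => ?_
        rw [uIcc_of_le hst] at hu
        rw [hseg n u (by linarith [hu.1]) (by linarith [hu.2])]
      rwa [e]
    · rw [ContinuousMap.coe_mk, hval t h (by linarith)]
      exact h2.bdd t h (by linarith)
    · rw [ContinuousMap.coe_mk, hval t (by linarith) (by linarith), hval s h (by linarith)]
      exact h2.hol s t h h' (by linarith)

end Existence


/-! ### The little Hölder spaces -/

theorem holderWith_iff_norm {E : Type*} [NormedAddCommGroup E] {C α : ℝ≥0} {a b : ℝ}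
    {f : Icc a b → E} : HolderWith C α f ↔
      ∀ s t : Icc a b, s ≤ t → ‖f t - f s‖ ≤ C * ((t : ℝ) - s) ^ (α : ℝ) := by
  constructor
  · intro h s t hst
    have := h.dist_le t s
    have hst' : (s : ℝ) ≤ t := hst
    rwa [dist_eq_norm, Subtype.dist_eq, Real.dist_eq, abs_of_nonneg (by linarith)] at this
  · intro h
    have key : ∀ s t : Icc a b, s ≤ t → edist (f s) (f t) ≤ C * edist s t ^ (α : ℝ) := by
      intro s t hst
      have hst' : (s : ℝ) ≤ t := hst
      have h1 := h s t hst
      rw [edist_comm, edist_comm s t, edist_dist, edist_dist, dist_eq_norm, Subtype.dist_eq,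
        Real.dist_eq, abs_of_nonneg (by linarith), ENNReal.ofReal_rpow_of_nonneg (sub_nonneg.mpr hst') (NNReal.coe_nonneg α),
        ← ENNReal.ofReal_coe_nnreal, ← ENNReal.ofReal_mul (NNReal.coe_nonneg C)]
      exact ENNReal.ofReal_le_ofReal h1
    intro s t
    rcases le_total s t with hst | hst
    · exact key s t hst
    · rw [edist_comm, edist_comm s t]; exact key t s hst

namespace LittleHolder

variable {α : ℝ≥0} {a b : ℝ} {d : ℕ}

/-- The element of the Hölder space with a given path. -/
def mk (p : C(Icc a b, Vec d)) (hp : p ∈ littleHolder α a b d) : LittleHolder α a b d := ⟨p, hp⟩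

theorem path_mem (η : LittleHolder α a b d) : η.path ∈ littleHolder α a b d := η.2

theorem norm_path_le (η : LittleHolder α a b d) : ‖η.path‖ ≤ ‖η‖ := by
  rw [norm_def]; simp

theorem norm_apply_le (η : LittleHolder α a b d) (t : Icc a b) : ‖η.path t‖ ≤ ‖η‖ :=
  (η.path.norm_coe_le_norm t).trans η.norm_path_le

theorem norm_increment_le (η : LittleHolder α a b d) {s t : Icc a b} (hst : s ≤ t) :
    ‖η.path t - η.path s‖ ≤ ‖η‖ * ((t : ℝ) - s) ^ (α : ℝ) := by
  have hst' : (s : ℝ) ≤ t := hst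
  refine (holderWith_iff_norm.mp η.memHolder.holderWith s t hst).trans ?_
  have : 0 ≤ ((t : ℝ) - s) ^ (α : ℝ) := Real.rpow_nonneg (by linarith) _
  gcongr
  rw [norm_def]; simp

theorem norm_le_add {η : LittleHolder α a b d} {δ ε : ℝ} (hε : 0 ≤ ε)
    (h1 : ‖η.path‖ ≤ δ) (h2 : ∀ s t : Icc a b, s ≤ t →
      ‖η.path t - η.path s‖ ≤ ε * ((t : ℝ) - s) ^ (α : ℝ)) : ‖η‖ ≤ δ + ε := by
  rw [norm_def]
  refine add_le_add h1 ?_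
  have : HolderWith ε.toNNReal α (η.path : Icc a b → Vec d) :=
    holderWith_iff_norm.mpr (by rwa [Real.coe_toNNReal ε hε])
  have h := this.nnholderNorm_le
  calc (nnHolderNorm α (η.path : Icc a b → Vec d) : ℝ) ≤ (ε.toNNReal : ℝ) := by exact_mod_cast h
    _ = ε := Real.coe_toNNReal ε hε

theorem path_sub (η ζ : LittleHolder α a b d) : (η - ζ).path = η.path - ζ.path := rfl

theorem path_injective : Function.Injective (path : LittleHolder α a b d → C(Icc a b, Vec d)) :=
  Subtype.val_injective

end LittleHolder

/-- On `[a,b]` the increments of `y` are `o(|t - s|^α)`, uniformly. -/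
def IsLittle {E : Type*} [NormedAddCommGroup E] (α a b : ℝ) (y : ℝ → E) : Prop :=
  ∀ ε > 0, ∃ δ > 0, ∀ s t, a ≤ s → s ≤ t → t ≤ b → t - s ≤ δ → ‖y t - y s‖ ≤ ε * (t - s) ^ α

/-! ### Uniform little-o Hölder increments. -/

section IsLittle

variable {E : Type*} [NormedAddCommGroup E] {α γ a b c H : ℝ} {y z : ℝ → E}

theorem rpow_eq_mul_rpow_sub {u : ℝ} (hα : 0 < α) (hγ : α < γ) (hu : 0 ≤ u) :
    u ^ γ = u ^ (γ - α) * u ^ α := by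
  rcases eq_or_lt_of_le hu with rfl | h
  · rw [Real.zero_rpow (by linarith), Real.zero_rpow hα.ne', mul_zero]
  · rw [← Real.rpow_add h]; ring_nf

theorem exists_rpow_le {κ C ε : ℝ} (hκ : 0 < κ) (hε : 0 < ε) :
    ∃ δ > 0, ∀ u, 0 ≤ u → u ≤ δ → C * u ^ κ ≤ ε := by
  have hc : Tendsto (fun δ : ℝ => max C 0 * δ ^ κ) (𝓝[>] 0) (𝓝 0) := by
    have : ContinuousAt (fun δ : ℝ => max C 0 * δ ^ κ) 0 :=
      (Real.continuousAt_rpow_const _ _ (Or.inr hκ.le)).const_mul _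
    have h0 := this.tendsto
    rw [Real.zero_rpow hκ.ne', mul_zero] at h0
    exact h0.mono_left nhdsWithin_le_nhds
  obtain ⟨δ, h1, h2⟩ := ((hc.eventually (gt_mem_nhds hε)).and self_mem_nhdsWithin).exists
  refine ⟨δ, h2, fun u hu hu' => ?_⟩
  have e1 : u ^ κ ≤ δ ^ κ := Real.rpow_le_rpow hu hu' hκ.le
  have e2 : 0 ≤ u ^ κ := Real.rpow_nonneg hu _
  calc C * u ^ κ ≤ max C 0 * u ^ κ := by gcongr; exact le_max_left _ _
    _ ≤ max C 0 * δ ^ κ := by gcongr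
    _ ≤ ε := h1.le

theorem HolOn.isLittle (hα : 0 < α) (hγ : α < γ) (h : HolOn γ H a b y) : IsLittle α a b y := by
  intro ε hε
  obtain ⟨δ, hδ, hδ'⟩ := exists_rpow_le (C := H) (sub_pos.mpr hγ) hε
  refine ⟨δ, hδ, fun s t hs hst ht hts => (h s t hs hst ht).trans ?_⟩
  rw [rpow_eq_mul_rpow_sub hα hγ (by linarith), ← mul_assoc]
  gcongr
  exact hδ' _ (by linarith) hts

theorem IsLittle.concat (hα : 0 < α) (h : IsLittle α a b y) (h' : IsLittle α b c y) :
    IsLittle α a c y := by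
  intro ε hε
  obtain ⟨δ₁, hδ₁, h1⟩ := h (ε / 2) (by linarith)
  obtain ⟨δ₂, hδ₂, h2⟩ := h' (ε / 2) (by linarith)
  refine ⟨min δ₁ δ₂, lt_min hδ₁ hδ₂, fun s t hs hst ht hts => ?_⟩
  have k1 := hts.trans (min_le_left _ _)
  have k2 := hts.trans (min_le_right _ _)
  have e0 : 0 ≤ (t - s) ^ α := Real.rpow_nonneg (by linarith) _
  rcases le_total t b with htb | htb
  · exact (h1 s t hs hst htb k1).trans (by gcongr; linarith)
  rcases le_total b s with hbs | hbs
  · exact (h2 s t hbs hst ht k2).trans (by gcongr; linarith)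
  have e1 := h1 s b hs hbs le_rfl (by linarith)
  have e2 := h2 b t le_rfl htb ht (by linarith)
  have e3 : (b - s) ^ α ≤ (t - s) ^ α := Real.rpow_le_rpow (by linarith) (by linarith) hα.le
  have e4 : (t - b) ^ α ≤ (t - s) ^ α := Real.rpow_le_rpow (by linarith) (by linarith) hα.le
  calc ‖y t - y s‖ = ‖(y t - y b) + (y b - y s)‖ := by congr 1; abel
    _ ≤ _ := norm_add_le _ _
    _ ≤ ε / 2 * (t - s) ^ α + ε / 2 * (t - s) ^ α :=
        add_le_add (e2.trans (by gcongr)) (e1.trans (by gcongr))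
    _ = _ := by ring

theorem IsLittle.mono {a' b' : ℝ} (h : IsLittle α a b y) (ha : a ≤ a') (hb : b' ≤ b) :
    IsLittle α a' b' y := by
  intro ε hε
  obtain ⟨δ, hδ, h1⟩ := h ε hε
  exact ⟨δ, hδ, fun s t hs hst ht => h1 s t (ha.trans hs) hst (ht.trans hb)⟩

end IsLittle

/-! ### Approximation by smooth paths. -/

section Mollify

variable {d : ℕ}

/-- A bounded uniformly little Hölder path is approximated by smooth paths. -/
theorem exists_smooth_approx {α : ℝ} {q : ℝ → Vec d} (hq : Continuous q)
    (hu : UniformContinuous q)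
    (hl : ∀ ε > 0, ∃ δ > 0, ∀ s t, s ≤ t → t - s ≤ δ → ‖q t - q s‖ ≤ ε * (t - s) ^ α)
    (hα : 0 < α) {ε : ℝ} (hε : 0 < ε) :
    ∃ p : ℝ → Vec d, ContDiff ℝ ((⊤ : ℕ∞) : WithTop ℕ∞) p ∧ (∀ s, ‖q s - p s‖ ≤ ε) ∧
      ∀ s t, s ≤ t → ‖(q t - p t) - (q s - p s)‖ ≤ ε * (t - s) ^ α := by
  obtain ⟨δ, hδ, hδ'⟩ := hl (ε / 2) (by linarith)
  -- For t - s ≥ δ the supremum error alone suffices: 2ε' ≤ ε·δ^α ≤ ε·(t-s)^α.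
  set ε' := min ε (ε / 2 * δ ^ α) with hε'
  have hε'0 : 0 < ε' := lt_min hε (by positivity)
  obtain ⟨ρ, hρ, hρ'⟩ := Metric.uniformContinuous_iff.mp hu ε' hε'0
  let φ : ContDiffBump (0 : ℝ) := ⟨ρ / 2, ρ, by linarith, by linarith⟩
  set p : ℝ → Vec d := convolution (φ.normed volume) q (ContinuousLinearMap.lsmul ℝ ℝ) volume
    with hp
  have hdist : ∀ s, ‖p s - q s‖ ≤ ε' := by
    intro s
    rw [← dist_eq_norm]
    refine φ.dist_normed_convolution_le hq.aestronglyMeasurable fun u hu => (hρ' ?_).le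
    exact hu
  have hex : ∀ f : ℝ → Vec d, Continuous f →
      ConvolutionExists (φ.normed volume) f (ContinuousLinearMap.lsmul ℝ ℝ) volume := fun f hf =>
    (φ.hasCompactSupport_normed).convolutionExists_left _ φ.continuous_normed hf.locallyIntegrable
  refine ⟨p, (φ.hasCompactSupport_normed).contDiff_convolution_left _ φ.contDiff_normed
    hq.locallyIntegrable, fun s => ?_, fun s t hst => ?_⟩
  · rw [norm_sub_rev]; exact (hdist s).trans (min_le_left _ _)
  have e0 : 0 ≤ (t - s) ^ α := Real.rpow_nonneg (by linarith) _
  rcases le_total (t - s) δ with h | h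
  -- For t - s ≤ δ, the increment of the mollified path is the mollification of the increment `G`,
  -- whose values all have norm at most (ε/2)(t-s)^α.
  · set G : ℝ → Vec d := fun u => q (u + (t - s)) - q u with hG
    have hGc : Continuous G := by fun_prop
    have hGb : ∀ u, ‖G u‖ ≤ ε / 2 * (t - s) ^ α := fun u => by
      have := hδ' u (u + (t - s)) (by linarith) (by linarith)
      rwa [add_sub_cancel_left] at this
    have hconv : convolution (φ.normed volume) G (ContinuousLinearMap.lsmul ℝ ℝ) volume s =
        p t - p s := by
      rw [hp, convolution_def, convolution_def, convolution_def, ← integral_sub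
        (hex q hq t) (hex q hq s)]
      congr 1
      ext1 u
      simp only [hG, ContinuousLinearMap.lsmul_apply]
      rw [← smul_sub]
      congr 3
      ring
    have h1 : dist (convolution (φ.normed volume) G (ContinuousLinearMap.lsmul ℝ ℝ) volume s) (G s)
        ≤ ε * (t - s) ^ α := by
      refine φ.dist_normed_convolution_le hGc.aestronglyMeasurable fun u _ => ?_
      rw [dist_eq_norm]
      refine (norm_sub_le _ _).trans ((add_le_add (hGb u) (hGb s)).trans (le_of_eq (by ring)))
    rw [hconv, dist_eq_norm, norm_sub_rev] at h1
    refine le_trans (le_of_eq ?_) h1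
    simp only [hG, add_sub_cancel]
    congr 1; abel
  · have h1 : δ ^ α ≤ (t - s) ^ α := Real.rpow_le_rpow hδ.le h hα.le
    have h2 := hdist s
    have h3 := hdist t
    rw [norm_sub_rev] at h2 h3
    calc _ ≤ ‖q t - p t‖ + ‖q s - p s‖ := norm_sub_le _ _
      _ ≤ ε / 2 * δ ^ α + ε / 2 * δ ^ α :=
          add_le_add (h3.trans (min_le_right _ _)) (h2.trans (min_le_right _ _))
      _ = ε * δ ^ α := by ring
      _ ≤ _ := by gcongr

/-- Extend η by its boundary values; the projection onto [a,b] is 1-Lipschitz, so the little-o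
condition survives on the line, where mollification applies. -/
theorem mem_littleHolder {α : ℝ≥0} {a b H : ℝ} (hα : 0 < α) (hab : a ≤ b) (hH : 0 ≤ H)
    {η : C(Icc a b, Vec d)}
    (hh : ∀ s t : Icc a b, s ≤ t → ‖η t - η s‖ ≤ H * ((t : ℝ) - s) ^ (α : ℝ))
    (hl : ∀ ε > 0, ∃ δ > 0, ∀ s t : Icc a b, s ≤ t → (t : ℝ) - s ≤ δ →
      ‖η t - η s‖ ≤ ε * ((t : ℝ) - s) ^ (α : ℝ)) :
    η ∈ littleHolder α a b d := by
  have hα' : (0 : ℝ) < α := hα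
  refine ⟨⟨H.toNNReal, holderWith_iff_norm.mpr (by rwa [Real.coe_toNNReal H hH])⟩,
    fun ε hε => ?_⟩
  have hproj : ∀ s t : ℝ, s ≤ t → (projIcc a b hab t : ℝ) - projIcc a b hab s ≤ t - s := by
    intro s t hst
    have h1 := (LipschitzWith.projIcc hab).dist_le_mul t s
    rw [Subtype.dist_eq, Real.dist_eq, Real.dist_eq, abs_of_nonneg (sub_nonneg.mpr hst)] at h1
    have := le_abs_self ((projIcc a b hab t : ℝ) - projIcc a b hab s)
    simp only [NNReal.coe_one, one_mul] at h1
    linarith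
  obtain ⟨p, hp, h1, h2⟩ := exists_smooth_approx (q := fun t => η (projIcc a b hab t)) (α := α)
    (by have := continuous_projIcc (h := hab); fun_prop)
    ((CompactSpace.uniformContinuous_of_continuous η.continuous).comp
      (LipschitzWith.projIcc hab).uniformContinuous)
    (fun ε hε => by
      obtain ⟨δ, hδ, h⟩ := hl ε hε
      refine ⟨δ, hδ, fun s t hst hts => ?_⟩
      have h3 := hproj s t hst
      have h4 : projIcc a b hab s ≤ projIcc a b hab t := monotone_projIcc hab hst
      have h5 : (projIcc a b hab s : ℝ) ≤ projIcc a b hab t := h4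
      refine (h _ _ h4 (by linarith)).trans ?_
      gcongr) hα' (ε := ε) hε
  refine ⟨p, hp, fun s => ?_, holderWith_iff_norm.mpr fun s t hst => ?_⟩
  · have := h1 s
    rwa [projIcc_of_mem hab s.2] at this
  · have := h2 s t hst
    rwa [projIcc_of_mem hab s.2, projIcc_of_mem hab t.2] at this

/-- Smooth paths are Lipschitz on [a,b], hence little Hölder since α < 1, and the remainder has a
small seminorm. -/
theorem littleHolder_isLittle {α : ℝ≥0} {a b : ℝ} (hα : 0 < α) (hα1 : α < 1)
    {η : C(Icc a b, Vec d)} (hη : η ∈ littleHolder α a b d) {ε : ℝ} (hε : 0 < ε) :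
    ∃ δ > 0, ∀ s t : Icc a b, s ≤ t → (t : ℝ) - s ≤ δ →
      ‖η t - η s‖ ≤ ε * ((t : ℝ) - s) ^ (α : ℝ) := by
  have hα' : (0 : ℝ) < α := hα
  have hα1' : (α : ℝ) < 1 := by exact_mod_cast hα1
  obtain ⟨p, hp, -, h⟩ := hη.2 (ε / 2).toNNReal (by simpa using hε)
  obtain ⟨X, -, hX⟩ := exists_holOn_of_contDiff (ν := 1) one_pos le_rfl
    (hp.of_le (by exact_mod_cast le_top)) a b
  obtain ⟨δ, hδ, h'⟩ := hX.isLittle hα' hα1' (ε / 2) (by linarith)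
  refine ⟨δ, hδ, fun s t hst hts => ?_⟩
  have e1 := holderWith_iff_norm.mp h s t hst
  have e2 := h' s t s.2.1 hst t.2.2 hts
  rw [Real.coe_toNNReal _ (by linarith)] at e1
  calc ‖η t - η s‖ = ‖((η t - p t) - (η s - p s)) + (p t - p s)‖ := by congr 1; abel
    _ ≤ _ := (norm_add_le _ _).trans (add_le_add e1 e2)
    _ = _ := by ring

end Mollify

/-! ### Compactness and separability in the little Hölder norm. -/

namespace LittleHolder

variable {α : ℝ≥0} {a b : ℝ} {d : ℕ}

/-- Interpolation: on paths which are bounded in a better Hölder norm, convergence in the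
supremum norm implies convergence in the Hölder norm. -/
theorem exists_norm_sub_lt {γ C ε : ℝ} (hα : 0 < α) (hγ : α < γ) (hε : 0 < ε) :
    ∃ δ > 0, ∀ η ζ : LittleHolder α a b d,
      (∀ s t : Icc a b, s ≤ t → ‖η.path t - η.path s‖ ≤ C * ((t : ℝ) - s) ^ γ) →
      (∀ s t : Icc a b, s ≤ t → ‖ζ.path t - ζ.path s‖ ≤ C * ((t : ℝ) - s) ^ γ) →
      ‖η.path - ζ.path‖ ≤ δ → ‖η - ζ‖ < ε := by
  have hα' : (0 : ℝ) < α := hα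
  obtain ⟨h, hh, hh'⟩ := exists_rpow_le (C := C + C) (sub_pos.mpr hγ) (by linarith : 0 < ε / 4)
  set δ := min (ε / 4) (ε / 8 * h ^ (α : ℝ)) with hδ
  refine ⟨δ, lt_min (by linarith) (by positivity), fun η ζ hη hζ hd => ?_⟩
  have : ‖η - ζ‖ ≤ ε / 4 + ε / 4 := by
    refine norm_le_add (by linarith) (hd.trans (min_le_left _ _)) fun s t hst => ?_
    have hst' : (s : ℝ) ≤ t := hst
    have e0 : 0 ≤ ((t : ℝ) - s) ^ (α : ℝ) := Real.rpow_nonneg (by linarith) _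
    rw [path_sub, ContinuousMap.sub_apply, ContinuousMap.sub_apply]
    rcases le_total ((t : ℝ) - s) h with hts | hts
    · have e : η.path t - ζ.path t - (η.path s - ζ.path s) =
          (η.path t - η.path s) - (ζ.path t - ζ.path s) := by abel
      rw [e]
      refine (norm_sub_le _ _).trans ((add_le_add (hη s t hst) (hζ s t hst)).trans ?_)
      rw [← add_mul, rpow_eq_mul_rpow_sub hα' hγ (by linarith), ← mul_assoc]
      gcongr
      exact hh' _ (by linarith) hts
    · have e1 := ((η.path - ζ.path).norm_coe_le_norm t).trans (hd.trans (min_le_right _ _))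
      have e2 := ((η.path - ζ.path).norm_coe_le_norm s).trans (hd.trans (min_le_right _ _))
      have e3 : h ^ (α : ℝ) ≤ ((t : ℝ) - s) ^ (α : ℝ) := Real.rpow_le_rpow hh.le hts hα'.le
      calc _ ≤ ε / 8 * h ^ (α : ℝ) + ε / 8 * h ^ (α : ℝ) :=
            (norm_sub_le _ _).trans (add_le_add e1 e2)
        _ = ε / 4 * h ^ (α : ℝ) := by ring
        _ ≤ _ := by gcongr
  linarith

/-- The set of paths which are bounded by `C` and `γ`-Hölder with constant `C`. -/
def holderBall (α : ℝ≥0) (a b : ℝ) (d : ℕ) (γ C : ℝ) : Set (LittleHolder α a b d) :=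
  {η | (∀ t, ‖η.path t‖ ≤ C) ∧
    ∀ s t : Icc a b, s ≤ t → ‖η.path t - η.path s‖ ≤ C * ((t : ℝ) - s) ^ γ}

/-- Arzelà–Ascoli gives compactness in supremum norm; the interpolation in `exists_norm_sub_lt`
upgrades convergence to the α-Hölder norm, and the limit is little Hölder because γ > α. This is the
source of compactness of the attractor. -/
theorem isCompact_holderBall {γ C : ℝ} (hα : 0 < α) (hγ : α < γ) (hab : a ≤ b) (hC : 0 ≤ C) :
    IsCompact (holderBall α a b d γ C) := by
  have hα' : (0 : ℝ) < α := hα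
  set S : Set C(Icc a b, Vec d) := {p | (∀ t, ‖p t‖ ≤ C) ∧
    ∀ s t : Icc a b, s ≤ t → ‖p t - p s‖ ≤ C * ((t : ℝ) - s) ^ γ} with hS
  have habs : ∀ f : Icc a b → Vec d, (∀ s t : Icc a b, s ≤ t →
      ‖f t - f s‖ ≤ C * ((t : ℝ) - s) ^ γ) → ∀ s t, dist (f s) (f t) ≤ C * dist s t ^ γ := by
    intro f hf s t
    rcases le_total s t with h | h
    · have h' : (s : ℝ) ≤ t := h
      rw [dist_comm, dist_eq_norm, dist_comm s t, Subtype.dist_eq, Real.dist_eq,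
        abs_of_nonneg (by linarith)]
      exact hf s t h
    · have h' : (t : ℝ) ≤ s := h
      rw [dist_eq_norm, Subtype.dist_eq, Real.dist_eq, abs_of_nonneg (by linarith)]
      exact hf t s h
  have hsmall : ∀ ε > 0, ∃ δ > 0, ∀ s t : Icc a b, dist s t < δ → C * dist s t ^ γ < ε := by
    intro ε hε
    obtain ⟨δ, hδ, h⟩ := exists_rpow_le (C := C) (hα'.trans hγ) (by linarith : 0 < ε / 2)
    exact ⟨δ, hδ, fun s t hst => by linarith [h _ dist_nonneg hst.le]⟩
  have hScomp : IsCompact S := by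
    refine ArzelaAscoli.isCompact_of_equicontinuous S ?_ ?_
    · have himg : ContinuousMap.toFun '' S = {f : Icc a b → Vec d | (∀ t, ‖f t‖ ≤ C) ∧
          ∀ s t : Icc a b, s ≤ t → ‖f t - f s‖ ≤ C * ((t : ℝ) - s) ^ γ} := by
        ext f
        constructor
        · rintro ⟨p, hp, rfl⟩; exact hp
        · intro hf
          have hc : Continuous f := by
            rw [Metric.continuous_iff]
            intro t ε hε
            obtain ⟨δ, hδ, h⟩ := hsmall ε hε
            exact ⟨δ, hδ, fun s hs => (habs f hf.2 s t).trans_lt (h s t hs)⟩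
          exact ⟨⟨f, hc⟩, hf, rfl⟩
      rw [himg]
      refine IsCompact.of_isClosed_subset
        (isCompact_univ_pi fun _ => isCompact_closedBall (0 : Vec d) C) ?_ ?_
      · simp only [ofPred_and, ofPred_forall]
        refine (isClosed_iInter fun t => isClosed_le (by fun_prop) continuous_const).inter
          (isClosed_iInter fun s => isClosed_iInter fun t => isClosed_iInter fun _ =>
            isClosed_le (by fun_prop) continuous_const)
      · intro f hf t _
        simpa using hf.1 t
    · refine UniformEquicontinuous.equicontinuous ?_
      rw [Metric.uniformEquicontinuous_iff]
      intro ε hε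
      obtain ⟨δ, hδ, h⟩ := hsmall ε hε
      exact ⟨δ, hδ, fun s t hst p => (habs _ p.2.2 s t).trans_lt (h s t hst)⟩
  refine IsSeqCompact.isCompact fun u hu => ?_
  obtain ⟨p, hp, φ, hφ, hlim⟩ := hScomp.isSeqCompact (x := fun n => (u n).path) hu
  have hmem : p ∈ littleHolder α a b d := by
    have hext : HolOn γ C a b (fun t => p (projIcc a b hab t)) := by
      intro s t hs hst ht
      beta_reduce
      rw [projIcc_of_mem hab ⟨hs, hst.trans ht⟩, projIcc_of_mem hab ⟨hs.trans hst, ht⟩]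
      exact hp.2 _ _ hst
    have hlit := hext.isLittle hα' hγ
    refine mem_littleHolder (H := C * (b - a) ^ (γ - α)) hα hab
      (mul_nonneg hC (Real.rpow_nonneg (by linarith) _)) (fun s t hst => ?_) fun ε hε => ?_
    · have hst' : (s : ℝ) ≤ t := hst
      refine (hp.2 s t hst).trans ?_
      rw [rpow_eq_mul_rpow_sub hα' hγ (by linarith), ← mul_assoc]
      have := t.2.2
      have := s.2.1
      gcongr
    · obtain ⟨δ, hδ, h⟩ := hlit ε hε
      refine ⟨δ, hδ, fun s t hst hts => ?_⟩
      have := h s t s.2.1 hst t.2.2 hts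
      beta_reduce at this
      rwa [projIcc_of_mem hab s.2, projIcc_of_mem hab t.2] at this
  refine ⟨mk p hmem, hp, φ, hφ, ?_⟩
  rw [Metric.tendsto_atTop]
  intro ε hε
  obtain ⟨δ, hδ, h⟩ := exists_norm_sub_lt (a := a) (b := b) (d := d) (C := C) hα hγ hε
  obtain ⟨N, hN⟩ := Metric.tendsto_atTop.mp hlim δ hδ
  refine ⟨N, fun n hn => ?_⟩
  rw [dist_eq_norm]
  refine h _ _ (hu (φ n)).2 hp.2 ?_
  have := (hN n hn).le
  rwa [dist_eq_norm] at this

/-- Balls of Lipschitz paths are compact, hence separable, and their countable union is dense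
because it contains the smooth paths. -/
theorem separableSpace (hα : 0 < α) (hα1 : α < 1) (hab : a ≤ b) :
    TopologicalSpace.SeparableSpace (LittleHolder α a b d) := by
  have hα1' : (α : ℝ) < 1 := by exact_mod_cast hα1
  have hsep : TopologicalSpace.IsSeparable (⋃ n : ℕ, holderBall α a b d 1 n) := TopologicalSpace.isSeparable_iUnion.mpr fun n =>
    (isCompact_holderBall hα hα1' hab (Nat.cast_nonneg n)).isSeparable
  rw [← TopologicalSpace.isSeparable_univ_iff]
  refine hsep.closure.mono fun η _ => Metric.mem_closure_iff.mpr fun ε hε => ?_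
  have hε4 : (0 : ℝ≥0) < (ε / 4).toNNReal := by simpa using hε
  obtain ⟨p, hp, h1, h2⟩ := η.path_mem.2 _ hε4
  have hp1 : ContDiff ℝ 1 p := hp.of_le (by exact_mod_cast le_top)
  obtain ⟨X, hX0, hX⟩ := exists_holOn_of_contDiff (ν := 1) one_pos le_rfl hp1 a b
  obtain ⟨X', hX'0, hX'⟩ := exists_norm_le_of_continuous hp1.continuous a b
  have hXlit := hX.isLittle (show (0 : ℝ) < α from hα) hα1'
  set q : C(Icc a b, Vec d) := ⟨fun s => p s, by have := hp1.continuous; fun_prop⟩ with hq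
  have hqmem : q ∈ littleHolder α a b d := by
    refine ⟨?_, fun ε hε => ⟨p, hp, fun s => by simp [hq], fun s t => by simp [hq]⟩⟩
    obtain ⟨Y, hY0, hY⟩ := exists_holOn_of_contDiff (ν := α) hα hα1'.le hp1 a b
    exact ⟨Y.toNNReal, holderWith_iff_norm.mpr fun s t hst => by
      rw [Real.coe_toNNReal Y hY0]; exact hY s t s.2.1 hst t.2.2⟩
  obtain ⟨n, hn⟩ := exists_nat_ge (max X X')
  refine ⟨mk q hqmem, mem_iUnion.mpr ⟨n, fun t => ?_, fun s t hst => ?_⟩, ?_⟩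
  · exact (hX' t t.2.1 t.2.2).trans ((le_max_right _ _).trans hn)
  · have hst' : (s : ℝ) ≤ t := hst
    refine (hX s t s.2.1 hst t.2.2).trans ?_
    have : 0 ≤ ((t : ℝ) - s) ^ (1 : ℝ) := Real.rpow_nonneg (by linarith) _
    gcongr
    exact (le_max_left _ _).trans hn
  · rw [dist_eq_norm]
    have : ‖η - mk q hqmem‖ ≤ ε / 4 + ε / 4 := by
      refine norm_le_add (by linarith) ?_ fun s t hst => ?_
      · rw [ContinuousMap.norm_le _ (by linarith)]
        intro s
        have := h1 s
        rw [Real.coe_toNNReal _ (by linarith)] at this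
        exact this
      · have := holderWith_iff_norm.mp h2 s t hst
        rw [Real.coe_toNNReal _ (by linarith)] at this
        exact this
    linarith

end LittleHolder


/-! ### Solutions of the delay equation -/

section Equation

variable {d m : ℕ} {r : ℝ}

/-- The drift `ξ ↦ A ξ(0) + f(ξ)`. -/
def drift (hr : 0 ≤ r) (A : Matrix (Fin d) (Fin d) ℝ) (f : Hist r d → Vec d) :
    Hist r d → Vec d :=
  fun ξ => Matrix.toEuclideanCLM (𝕜 := ℝ) A (ξ ⟨0, by constructor <;> linarith⟩) + f ξ

theorem drift_segment (hr : 0 ≤ r) (A : Matrix (Fin d) (Fin d) ℝ) (f : Hist r d → Vec d)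
    (y : C(ℝ, Vec d)) (u : ℝ) : drift hr A f (segment r y u) =
      Matrix.toEuclideanCLM (𝕜 := ℝ) A (y u) + f (segment r y u) := by
  unfold drift
  rw [segment_apply, add_zero]

theorem lipschitzWith_drift (hr : 0 ≤ r) (A : Matrix (Fin d) (Fin d) ℝ) {f : Hist r d → Vec d}
    {Cf : ℝ≥0} (hf : LipschitzWith Cf f) :
    LipschitzWith (‖Matrix.toEuclideanCLM (𝕜 := ℝ) A‖₊ + Cf) (drift hr A f) := by
  refine LipschitzWith.add ?_ hf
  refine LipschitzWith.of_dist_le_mul fun ξ ζ => ?_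
  rw [dist_eq_norm, dist_eq_norm, ← map_sub]
  refine (ContinuousLinearMap.le_opNorm _ _).trans ?_
  rw [coe_nnnorm]
  gcongr
  exact (ξ - ζ).norm_coe_le_norm _

variable {β₀ : ℝ≥0} {ν : ℝ} {A : Matrix (Fin d) (Fin d) ℝ} {f : Hist r d → Vec d}
  {g : Hist r d → Vec m →L[ℝ] Vec d} {CF Cg : ℝ≥0} {x : ℝ → Vec m} {η : Hist r d}
  {y : C(ℝ, Vec d)}

theorem holderBdd_of_memHolder {T : ℝ} (h : MemHolder β₀ ((Icc (-r) T).domRestrict y)) :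
    ∃ H, HolderBdd β₀ r T H y := by
  obtain ⟨C, hC⟩ := h
  obtain ⟨M, hM0, hM⟩ := exists_norm_le_of_continuous y.continuous (-r) T
  have hC' : HolOn β₀ C (-r) T y := fun s t hs hst ht =>
    holderWith_iff_norm.mp hC ⟨s, hs, hst.trans ht⟩ ⟨t, hs.trans hst, ht⟩ hst
  exact ⟨max M C, fun t h1 h2 => (hM t h1 h2).trans (le_max_left _ _),
    hC'.mono (le_max_right _ _) le_rfl le_rfl⟩

theorem HolderBdd.holOn_comp_segment {α b M : ℝ} (hg : LipschitzWith Cg g) (hr : 0 ≤ r)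
    (hM : HolderBdd α r b M y) : HolOn α (Cg * M) 0 b fun u => g (segment r y u) := by
  intro s t hs hst ht
  refine (hg.norm_sub_le _ _).trans ?_
  rw [mul_assoc]
  gcongr
  exact hM.norm_segment_sub_le hr hs hst ht

/-- Subtract the equation at s from the equation at t. With `isSolution_of_youngSol` this identifies
the Riemann–Stieltjes formulation with the germ formulation, so uniqueness transfers to the class in
the theorem. -/
theorem IsSolution.isYoungSol (hr : 0 ≤ r) (hc : IsCoeff (drift hr A f) g CF Cg)
    (he : IsExponents β₀ ν) (hx : IsDriver ν x) (h : IsSolution r β₀ A f g x η y) (T : ℝ) :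
    IsYoungSol β₀ (drift hr A f) g x T y := by
  obtain ⟨H, hH⟩ := holderBdd_of_memHolder (h.holder (max T 0))
  obtain ⟨X, hX0, hX⟩ := hx.exists_holOn (he.pos.trans he.lt) he.le_one (max T 0)
  have hH0 := hH.nonneg (by have := le_max_right T 0; linarith)
  refine ⟨⟨β₀ + ν, sewConst (β₀ + ν) * (Cg * H * X), he.one_lt, fun s t hs hst ht => ?_⟩, H,
    hH.mono le_rfl (le_max_left _ _)⟩
  have htT : t ≤ max T 0 := ht.trans (le_max_left _ _)
  have e := HasYoungIntegral.increment he.pos (he.pos.trans he.lt) he.one_lt (by positivity) hX0 hs hst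
    ((hH.holOn_comp_segment hc.lip hr).mono le_rfl le_rfl htT) (hX.mono le_rfl le_rfl htT)
    (h.equation s hs) (h.equation t (hs.trans hst))
  rw [noiseIncr_eq hc.lipF.continuous]
  simp only [drift_segment]
  convert e using 2
  abel

theorem isSolution_of_youngSol (hr : 0 ≤ r) (hc : IsCoeff (drift hr A f) g CF Cg)
    (he : IsExponents β₀ ν) (hx : IsDriver ν x) (h0 : segment r y 0 = η)
    (h : ∀ T, IsYoungSol β₀ (drift hr A f) g x T y) : IsSolution r β₀ A f g x η y := by
  refine ⟨h0, fun T => ?_, fun t ht => ?_⟩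
  · obtain ⟨-, H, hH⟩ := h (max T 0)
    have hH0 := hH.nonneg (by have := le_max_right T 0; linarith)
    exact ⟨H.toNNReal, holderWith_iff_norm.mpr fun s t hst => by
      rw [Real.coe_toNNReal H hH0]
      exact hH.hol s t s.2.1 hst (t.2.2.trans (le_max_left _ _))⟩
  · obtain ⟨⟨θ, C, hθ, h1⟩, H, hH⟩ := h t
    obtain ⟨X, hX0, hX⟩ := hx.exists_holOn (he.pos.trans he.lt) he.le_one t
    have hH0 := hH.nonneg (by linarith)
    have := hasYoungIntegral_of_germ (C := C) he.pos (he.pos.trans he.lt) hθ he.one_lt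
      (by positivity) hX0 (hH.holOn_comp_segment hc.lip hr) hX
      (G := fun t => y t - ∫ u in (0 : ℝ)..t, drift hr A f (segment r y u)) (fun s t hs hst ht => by
        have := h1 s t hs hst ht
        rwa [noiseIncr_eq hc.lipF.continuous] at this)
    simp only [drift_segment, intervalIntegral.integral_same, sub_zero] at this
    convert this using 1
    abel

end Equation

/-! ### The noise space -/

namespace NoisePath

variable {ν : ℝ≥0} {m : ℕ}

theorem path_zero (ω : NoisePath ν m) : ω.path 0 = 0 := ω.2.1

theorem holOn (ω : NoisePath ν m) (a b : ℝ) : HolOn ν ‖restr a b ω‖ a b ω.path :=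
  fun s t hs hst ht => (restr a b ω).norm_increment_le (s := ⟨s, hs, hst.trans ht⟩)
    (t := ⟨t, hs.trans hst, ht⟩) hst

theorem holOn_sub (ω ω' : NoisePath ν m) (a b : ℝ) :
    HolOn ν ‖restr a b ω - restr a b ω'‖ a b fun t => ω.path t - ω'.path t :=
  fun s t hs hst ht => (restr a b ω - restr a b ω').norm_increment_le (s := ⟨s, hs, hst.trans ht⟩)
    (t := ⟨t, hs.trans hst, ht⟩) hst

theorem isDriver (ω : NoisePath ν m) : IsDriver ν ω.path := by
  intro T ε hε
  obtain ⟨p, hp, -, h⟩ := (ω.2.2 0 T).2 ε.toNNReal (by simpa using hε)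
  refine ⟨p, hp.of_le (by exact_mod_cast le_top), fun s t hs hst ht => ?_⟩
  have := holderWith_iff_norm.mp h ⟨s, hs, hst.trans ht⟩ ⟨t, hs.trans hst, ht⟩ hst
  rw [Real.coe_toNNReal ε hε.le] at this
  exact this

theorem continuous_restr (n : ℕ) : Continuous (restr (ν := ν) (m := m) (-(n : ℝ)) n) :=
  continuous_iInf_dom continuous_induced_dom

theorem shift_path_apply (t s : ℝ) (ω : NoisePath ν m) :
    (shift t ω).path s = ω.path (t + s) - ω.path t := rfl

@[ext] theorem ext {ω ω' : NoisePath ν m} (h : ∀ t, ω.path t = ω'.path t) : ω = ω' :=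
  Subtype.ext (ContinuousMap.ext h)

theorem shift_zero (ω : NoisePath ν m) : shift 0 ω = ω := by
  ext1 t
  rw [shift_path_apply, zero_add, path_zero, sub_zero]

theorem shift_shift (s t : ℝ) (ω : NoisePath ν m) : shift s (shift t ω) = shift (s + t) ω := by
  ext1 u
  simp only [shift_path_apply]
  rw [sub_sub_sub_cancel_right, add_comm s t, ← add_assoc]

theorem continuous_eval (t : ℝ) : Continuous fun ω : NoisePath ν m => ω.path t := by
  obtain ⟨n, hn⟩ := exists_nat_ge |t|
  have ht : t ∈ Icc (-(n : ℝ)) n := abs_le.mp hn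
  have h1 : Continuous fun η : LittleHolder ν (-(n : ℝ)) n m => η.path ⟨t, ht⟩ := by
    refine LipschitzWith.continuous (K := 1) (LipschitzWith.of_dist_le_mul fun η ζ => ?_)
    rw [dist_eq_norm, dist_eq_norm, NNReal.coe_one, one_mul]
    exact (η - ζ).norm_apply_le ⟨t, ht⟩
  exact h1.comp (continuous_restr n)

end NoisePath

/-! ### The solution flow -/

section Flow

variable {d m : ℕ} {r : ℝ} {ν β₀ : ℝ≥0} {F : Hist r d → Vec d}
  {g : Hist r d → Vec m →L[ℝ] Vec d} {CF Cg : ℝ≥0}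

theorem LittleHolder.histBdd (η : LittleHolder β₀ (-r) 0 d) : HistBdd β₀ ‖η‖ η.path :=
  ⟨η.norm_path_le, fun _ _ hst => η.norm_increment_le hst⟩

/-- Solutions are `ν`-Hölder on `[0,T]`. -/
theorem IsYoungSol.holOn_const {α ν : ℝ} (hc : IsCoeff F g CF Cg) (he : IsExponents α ν)
    (hr : 0 ≤ r) {T X : ℝ} (hT : 1 ≤ T) (hX : 0 ≤ X) :
    ∃ K, 0 ≤ K ∧ ∀ (x : ℝ → Vec m) (y : C(ℝ, Vec d)) (B : ℝ),
      HolOn ν X 0 T x → IsYoungSol α F g x T y → HistBdd α B (segment r y 0) →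
        HolOn ν (K * (B + 1)) 0 T y := by
  have hν := he.pos.trans he.lt
  have hs := (sewConst_pos he.one_lt).le
  obtain ⟨K, hK0, hK⟩ := IsYoungSol.apriori_const hc he hr hT hX
  refine ⟨(T * CF + (1 + sewConst (α + ν) * T) * (Cg * X)) * K + (T * ‖F 0‖ + ‖g 0‖ * X),
    by positivity, fun x y B hx hy hB s t hs0 hst ht => ?_⟩
  have hM := hK x y B hx hy hB
  obtain ⟨⟨θ, C, hθ, h1⟩, -⟩ := hy
  have hB0 := hB.holderBdd.nonneg (by linarith)
  refine (h1.norm_sub_le hc.lipF hc.lip he.pos (he.lt.le.trans he.le_one) hν he.le_one he.one_lt hr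
    hT hX hx hθ le_rfl (hM.nonneg (by linarith)) hM hs0 hst ht).trans ?_
  have : 0 ≤ (t - s) ^ ν := Real.rpow_nonneg (by linarith) _
  refine mul_le_mul_of_nonneg_right ?_ this
  have : 0 ≤ T * ‖F 0‖ + ‖g 0‖ * X := by positivity
  nlinarith

/-- The initial segment is little Hölder by assumption, and on positive times the solution has the
exponent ν > α; hence the flow stays in the closure of the smooth paths. -/
theorem IsYoungSol.isLittle {α ν : ℝ} (hc : IsCoeff F g CF Cg) (he : IsExponents α ν)
    (hr : 0 ≤ r) {x : ℝ → Vec m} {y : C(ℝ, Vec d)} (hx : IsDriver ν x)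
    (hy : ∀ T, IsYoungSol α F g x T y) {B : ℝ} (hB : HistBdd α B (segment r y 0))
    (h0 : IsLittle α (-r) 0 y) (T : ℝ) : IsLittle α (-r) T y := by
  have hT : 1 ≤ max T 1 := le_max_right _ _
  obtain ⟨X, hX0, hX⟩ := hx.exists_holOn (he.pos.trans he.lt) he.le_one (max T 1)
  obtain ⟨K, hK0, hK⟩ := IsYoungSol.holOn_const hc he hr hT hX0
  exact (h0.concat he.pos ((hK x y B hX (hy _) hB).isLittle he.pos he.lt)).mono le_rfl
    (le_max_left _ _)

theorem LittleHolder.isLittle_of_segment (hβ0 : 0 < β₀) (hβ1 : β₀ < 1)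
    {η : LittleHolder β₀ (-r) 0 d} {y : C(ℝ, Vec d)} (h : segment r y 0 = η.path) :
    IsLittle β₀ (-r) 0 y := by
  intro ε hε
  obtain ⟨δ, hδ, h1⟩ := littleHolder_isLittle hβ0 hβ1 η.path_mem hε
  refine ⟨δ, hδ, fun s t hs hst ht hts => ?_⟩
  have := h1 ⟨s, hs, hst.trans ht⟩ ⟨t, hs.trans hst, ht⟩ hst hts
  rwa [← h, segment_apply, segment_apply, zero_add, zero_add] at this

theorem segment_mem_littleHolder (hr : 0 ≤ r) (hβ0 : 0 < β₀) {y : C(ℝ, Vec d)} {t H : ℝ}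
    (ht : 0 ≤ t) (hH : HolderBdd β₀ r t H y) (h : IsLittle β₀ (-r) t y) :
    segment r y t ∈ littleHolder β₀ (-r) 0 d := by
  refine mem_littleHolder hβ0 (by linarith) (hH.nonneg (by linarith))
    (hH.histBdd hr ht le_rfl).2 fun ε hε => ?_
  obtain ⟨δ, hδ, h1⟩ := h ε hε
  refine ⟨δ, hδ, fun s u hsu hsu' => ?_⟩
  have e1 := s.2.1
  have e2 := u.2.2
  have e3 : (s : ℝ) ≤ u := hsu
  have := h1 (t + s) (t + u) (by linarith) (by linarith) (by linarith) (by linarith)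
  rwa [add_sub_add_left_eq_sub] at this

variable (hc : IsCoeff F g CF Cg) (he : IsExponents β₀ ν) (hr : 0 ≤ r)

/-- The solution of the Young equation. -/
def solPath (ω : NoisePath ν m) (η : LittleHolder β₀ (-r) 0 d) : C(ℝ, Vec d) :=
  Classical.choose (exists_global_youngSol hc he hr ω.isDriver η.histBdd)

theorem solPath_zero (ω : NoisePath ν m) (η : LittleHolder β₀ (-r) 0 d) :
    segment r (solPath hc he hr ω η) 0 = η.path :=
  (Classical.choose_spec (exists_global_youngSol hc he hr ω.isDriver η.histBdd)).1

theorem solPath_sol (ω : NoisePath ν m) (η : LittleHolder β₀ (-r) 0 d) (T : ℝ) :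
    IsYoungSol β₀ F g ω.path T (solPath hc he hr ω η) :=
  (Classical.choose_spec (exists_global_youngSol hc he hr ω.isDriver η.histBdd)).2 T

theorem solPath_histBdd (ω : NoisePath ν m) (η : LittleHolder β₀ (-r) 0 d) :
    HistBdd β₀ ‖η‖ (segment r (solPath hc he hr ω η) 0) := by
  rw [solPath_zero]; exact η.histBdd

theorem IsExponents.nnreal_pos (he : IsExponents β₀ ν) : 0 < β₀ := he.pos

theorem IsExponents.nnreal_lt_one (he : IsExponents β₀ ν) : β₀ < 1 := by exact_mod_cast he.lt.trans_le he.le_one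

theorem solPath_isLittle (ω : NoisePath ν m) (η : LittleHolder β₀ (-r) 0 d) (T : ℝ) :
    IsLittle β₀ (-r) T (solPath hc he hr ω η) :=
  IsYoungSol.isLittle hc he hr ω.isDriver (solPath_sol hc he hr ω η)
    (solPath_histBdd hc he hr ω η) (LittleHolder.isLittle_of_segment he.nnreal_pos
      he.nnreal_lt_one (solPath_zero hc he hr ω η)) T

/-- The solution flow. -/
def flow (t : ℝ≥0) (ω : NoisePath ν m) (η : LittleHolder β₀ (-r) 0 d) :
    LittleHolder β₀ (-r) 0 d :=
  LittleHolder.mk (segment r (solPath hc he hr ω η) t)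
    (segment_mem_littleHolder hr he.nnreal_pos t.2
      (Classical.choose_spec (solPath_sol hc he hr ω η t).2) (solPath_isLittle hc he hr ω η t))

theorem flow_path (t : ℝ≥0) (ω : NoisePath ν m) (η : LittleHolder β₀ (-r) 0 d) :
    (flow hc he hr t ω η).path = segment r (solPath hc he hr ω η) t := rfl

theorem solPath_unique (ω : NoisePath ν m) (η : LittleHolder β₀ (-r) 0 d) {z : C(ℝ, Vec d)}
    (h0 : segment r z 0 = η.path) (hz : ∀ T, IsYoungSol β₀ F g ω.path T z) :
    EqOn z (solPath hc he hr ω η) (Ici (-r)) := by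
  intro t ht
  exact IsYoungSol.eqOn hc he hr (le_max_right t 1) (norm_nonneg _) (ω.holOn 0 (max t 1)) (hz _)
    (solPath_sol hc he hr ω η _) (by rw [h0, solPath_zero]) (B := ‖η‖)
    (by rw [h0]; exact η.histBdd) ⟨ht, le_max_left _ _⟩

theorem flow_zero (ω : NoisePath ν m) (η : LittleHolder β₀ (-r) 0 d) :
    flow hc he hr 0 ω η = η := by
  apply LittleHolder.path_injective
  rw [flow_path, NNReal.coe_zero, solPath_zero]

theorem norm_le_of_holderBdd {η : LittleHolder β₀ (-r) 0 d} {M : ℝ} (h : HistBdd β₀ M η.path) :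
    ‖η‖ ≤ M + M :=
  LittleHolder.norm_le_add ((norm_nonneg _).trans h.1) h.1 h.2

/-- The stability estimate read in the norm of the phase space: local Lipschitz dependence on the
initial segment and on the noise at once. -/
theorem flow_lipschitz {T X B₀ : ℝ} (hT : 1 ≤ T) (hX : 0 ≤ X) :
    ∃ K, 0 ≤ K ∧ ∀ (ω ω' : NoisePath ν m) (η η' : LittleHolder β₀ (-r) 0 d) (Δ : ℝ), 0 ≤ Δ →
      HolOn ν X 0 T ω.path → HolOn ν X 0 T ω'.path →
      HolOn ν Δ 0 T (fun t => ω.path t - ω'.path t) → ‖η‖ ≤ B₀ → ‖η'‖ ≤ B₀ →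
      ∀ t : ℝ≥0, t ≤ T →
        ‖flow hc he hr t ω η - flow hc he hr t ω' η'‖ ≤ K * (‖η - η'‖ + Δ) := by
  obtain ⟨K, hK0, hK⟩ := IsYoungSol.stability_const hc he hr (B₀ := B₀) hT hX
  refine ⟨2 * K, by positivity, fun ω ω' η η' Δ hΔ hω hω' hωω' hη hη' t ht => ?_⟩
  have hmono : ∀ ζ : LittleHolder β₀ (-r) 0 d, ‖ζ‖ ≤ B₀ → HistBdd β₀ B₀ ζ.path := fun ζ hζ =>
    ⟨ζ.histBdd.1.trans hζ, fun s u hsu => (ζ.histBdd.2 s u hsu).trans (by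
      have : (s : ℝ) ≤ u := hsu
      have : 0 ≤ ((u : ℝ) - s) ^ (β₀ : ℝ) := Real.rpow_nonneg (by linarith) _
      gcongr)⟩
  have h := hK ω.path ω'.path (solPath hc he hr ω η) (solPath hc he hr ω' η') ‖η - η'‖ Δ hΔ hω hω'
    hωω' (solPath_sol hc he hr ω η T) (solPath_sol hc he hr ω' η' T)
    (by rw [solPath_zero]; exact hmono η hη) (by rw [solPath_zero]; exact hmono η' hη')
    (by rw [segment_sub, solPath_zero, solPath_zero]; exact (LittleHolder.path_sub η η' ▸ (η - η').histBdd))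
  have hp : (flow hc he hr t ω η - flow hc he hr t ω' η').path =
      segment r (solPath hc he hr ω η - solPath hc he hr ω' η') t := by
    rw [LittleHolder.path_sub, flow_path, flow_path, segment_sub]
  have h1 : HistBdd β₀ (K * (‖η - η'‖ + Δ))
      (flow hc he hr t ω η - flow hc he hr t ω' η').path := by
    rw [hp]
    exact h.histBdd hr (NNReal.coe_nonneg t) ht
  have h2 := norm_le_of_holderBdd h1
  linarith

/-- Translation is continuous on little Hölder paths: over short distances both segments have
uniformly small Hölder quotients, over distances larger than h the supremum norm of the difference
decides. -/
theorem continuous_flow_time (ω : NoisePath ν m) (η : LittleHolder β₀ (-r) 0 d) :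
    Continuous fun t : ℝ≥0 => flow hc he hr t ω η := by
  rw [Metric.continuous_iff]
  intro t₀ ε hε
  set y := solPath hc he hr ω η with hy
  set T : ℝ := t₀ + 1 with hT
  obtain ⟨-, M, hM⟩ := solPath_sol hc he hr ω η T
  have hM0 : 0 ≤ M := hM.nonneg (by have := t₀.2; rw [hT]; linarith [NNReal.coe_nonneg t₀])
  obtain ⟨h, hh, hlit⟩ := solPath_isLittle hc he hr ω η T (ε / 8) (by linarith)
  have hα := he.pos
  have hhα : 0 < h ^ (β₀ : ℝ) := by positivity
  obtain ⟨δ, hδ, hδ'⟩ := exists_rpow_le (C := M) hα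
    (lt_min (by linarith) (by positivity) : 0 < min (ε / 4) (ε / 8 * h ^ (β₀ : ℝ)))
  have key : ∀ s t : ℝ≥0, s ≤ t → (t : ℝ) ≤ T → (t : ℝ) - s ≤ δ →
      ‖flow hc he hr t ω η - flow hc he hr s ω η‖ ≤ ε / 4 + ε / 4 := by
    intro s t hst htT hts
    have hst' : (s : ℝ) ≤ t := hst
    have hs0 : (0 : ℝ) ≤ s := s.2
    have hd := hδ' _ (by linarith) hts
    have hseg := hM.norm_segment_sub_le hr s.2 hst' htT
    refine LittleHolder.norm_le_add (by linarith)
      (hseg.trans (hd.trans (min_le_left _ _))) fun u v huv => ?_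
    have huv' : (u : ℝ) ≤ v := huv
    have hu := u.2.1
    have hv := v.2.2
    have e0 : 0 ≤ ((v : ℝ) - u) ^ (β₀ : ℝ) := Real.rpow_nonneg (by linarith) _
    have hpath : ∀ w, (flow hc he hr t ω η - flow hc he hr s ω η).path w = y (t + w) - y (s + w) :=
      fun w => rfl
    rcases le_total ((v : ℝ) - u) h with hle | hle
    · rw [hpath, hpath]
      have e1 := hlit (t + u) (t + v) (by linarith) (by linarith) (by linarith) (by linarith)
      have e2 := hlit (s + u) (s + v) (by linarith) (by linarith) (by linarith) (by linarith)
      rw [add_sub_add_left_eq_sub] at e1 e2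
      have e : y (t + v) - y (s + v) - (y (t + u) - y (s + u)) =
        (y (t + v) - y (t + u)) - (y (s + v) - y (s + u)) := by abel
      rw [e]
      refine (norm_sub_le _ _).trans ((add_le_add e1 e2).trans (le_of_eq (by ring)))
    · have e1 := (((flow hc he hr t ω η - flow hc he hr s ω η).path).norm_coe_le_norm v).trans
        (hseg.trans (hd.trans (min_le_right _ _)))
      have e2 := (((flow hc he hr t ω η - flow hc he hr s ω η).path).norm_coe_le_norm u).trans
        (hseg.trans (hd.trans (min_le_right _ _)))
      have e3 : h ^ (β₀ : ℝ) ≤ ((v : ℝ) - u) ^ (β₀ : ℝ) := Real.rpow_le_rpow hh.le hle hα.le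
      calc _ ≤ ε / 8 * h ^ (β₀ : ℝ) + ε / 8 * h ^ (β₀ : ℝ) :=
            (norm_sub_le _ _).trans (add_le_add e1 e2)
        _ = ε / 4 * h ^ (β₀ : ℝ) := by ring
        _ ≤ _ := by gcongr
  refine ⟨min δ 1, lt_min hδ one_pos, fun t ht => ?_⟩
  rw [NNReal.dist_eq] at ht
  have h1 := (abs_lt.mp (ht.trans_le (min_le_left _ _)))
  have h2 := (abs_lt.mp (ht.trans_le (min_le_right _ _)))
  rw [dist_eq_norm]
  rcases le_total t₀ t with htt | htt
  · have := key t₀ t htt (by linarith) (by linarith)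
    linarith
  · have := key t t₀ htt (by linarith) (by linarith)
    rw [norm_sub_rev]
    linarith

theorem continuous_flow (ω : NoisePath ν m) :
    Continuous fun p : ℝ≥0 × LittleHolder β₀ (-r) 0 d => flow hc he hr p.1 ω p.2 := by
  rw [continuous_iff_continuousAt]
  rintro ⟨t₀, η₀⟩
  obtain ⟨K, hK0, hK⟩ := flow_lipschitz hc he hr (T := t₀ + 1) (B₀ := ‖η₀‖ + 1)
    (X := ‖NoisePath.restr 0 (t₀ + 1) ω‖) (by simp) (norm_nonneg _)
  have hω := ω.holOn 0 (t₀ + 1)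
  have h1 : Tendsto (fun p : ℝ≥0 × LittleHolder β₀ (-r) 0 d =>
      K * (‖p.2 - η₀‖ + 0) + ‖flow hc he hr p.1 ω η₀ - flow hc he hr t₀ ω η₀‖) (𝓝 (t₀, η₀))
      (𝓝 (K * (‖η₀ - η₀‖ + 0) + ‖flow hc he hr t₀ ω η₀ - flow hc he hr t₀ ω η₀‖)) := by
    have := continuous_flow_time hc he hr ω η₀
    refine Continuous.tendsto (f := fun p : ℝ≥0 × LittleHolder β₀ (-r) 0 d =>
      K * (‖p.2 - η₀‖ + 0) + ‖flow hc he hr p.1 ω η₀ - flow hc he hr t₀ ω η₀‖) ?_ (t₀, η₀)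
    fun_prop
  simp only [sub_self, norm_zero, add_zero, mul_zero] at h1
  rw [ContinuousAt, tendsto_iff_norm_sub_tendsto_zero]
  refine squeeze_zero' (Eventually.of_forall fun p => norm_nonneg _) ?_ h1
  have hn : ∀ᶠ p : ℝ≥0 × LittleHolder β₀ (-r) 0 d in 𝓝 (t₀, η₀), p.1 < t₀ + 1 ∧ ‖p.2‖ < ‖η₀‖ + 1 := by
    refine ((isOpen_lt continuous_fst continuous_const).inter
      (isOpen_lt continuous_snd.norm continuous_const)).mem_nhds ⟨?_, ?_⟩
    · change t₀ < t₀ + 1; exact lt_add_one t₀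
    · change ‖η₀‖ < ‖η₀‖ + 1; exact lt_add_one _
  filter_upwards [hn] with p hp
  have hp1 : (p.1 : ℝ) ≤ t₀ + 1 := by exact_mod_cast hp.1.le
  have := hK ω ω p.2 η₀ 0 le_rfl hω hω (fun s t _ _ _ => by simp) hp.2.le (by linarith) p.1 hp1
  calc _ = ‖(flow hc he hr p.1 ω p.2 - flow hc he hr p.1 ω η₀) +
        (flow hc he hr p.1 ω η₀ - flow hc he hr t₀ ω η₀)‖ := by congr 1; abel
    _ ≤ _ := (norm_add_le _ _).trans (by simpa using this)

theorem continuous_flow_noise (t : ℝ≥0) (η : LittleHolder β₀ (-r) 0 d) :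
    Continuous fun ω : NoisePath ν m => flow hc he hr t ω η := by
  rw [continuous_iff_continuousAt]
  intro ω₀
  obtain ⟨n, hn⟩ := exists_nat_ge (max (t : ℝ) 1)
  have hn1 : (1 : ℝ) ≤ n := (le_max_right _ _).trans hn
  have hnt : (t : ℝ) ≤ n := (le_max_left _ _).trans hn
  set R := NoisePath.restr (ν := ν) (m := m) (-(n : ℝ)) n with hR
  obtain ⟨K, hK0, hK⟩ := flow_lipschitz hc he hr (T := n) (B₀ := ‖η‖)
    (X := ‖R ω₀‖ + 1) hn1 (by positivity)
  have hc1 : Continuous R := NoisePath.continuous_restr n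
  have h1 : Tendsto (fun ω => K * (‖η - η‖ + ‖R ω - R ω₀‖)) (𝓝 ω₀)
      (𝓝 (K * (‖η - η‖ + ‖R ω₀ - R ω₀‖))) := by
    refine Continuous.tendsto (f := fun ω => K * (‖η - η‖ + ‖R ω - R ω₀‖)) ?_ ω₀
    fun_prop
  rw [sub_self, norm_zero, sub_self, norm_zero, add_zero, mul_zero] at h1
  rw [ContinuousAt, tendsto_iff_norm_sub_tendsto_zero]
  refine squeeze_zero' (Eventually.of_forall fun p => norm_nonneg _) ?_ h1
  have hnb : ∀ᶠ ω in 𝓝 ω₀, ‖R ω‖ < ‖R ω₀‖ + 1 :=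
    (isOpen_lt hc1.norm continuous_const).mem_nhds (show ‖R ω₀‖ < ‖R ω₀‖ + 1 from lt_add_one _)
  filter_upwards [hnb] with ω hω
  have hn0 : -(n : ℝ) ≤ 0 := by linarith
  have := hK ω ω₀ η η ‖R ω - R ω₀‖ (norm_nonneg _) ((ω.holOn _ _).mono hω.le hn0 le_rfl)
    ((ω₀.holOn _ _).mono (by linarith) hn0 le_rfl) ((ω.holOn_sub ω₀ _ _).mono le_rfl hn0 le_rfl)
    le_rfl le_rfl t hnt
  rwa [sub_self, norm_zero] at this

/-- The translated solution solves the equation for the shifted noise, since a germ sees only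
increments of the driver; conclude by uniqueness. -/
theorem flow_cocycle (s t : ℝ≥0) (ω : NoisePath ν m) (η : LittleHolder β₀ (-r) 0 d) :
    flow hc he hr (t + s) ω η = flow hc he hr t (NoisePath.shift s ω) (flow hc he hr s ω η) := by
  set y := solPath hc he hr ω η with hy
  set z : C(ℝ, Vec d) := ⟨fun u => y (s + u), by fun_prop⟩ with hz
  have hseg : ∀ u, segment r z u = segment r y (s + u) := fun u => by
    ext1 v
    simp only [segment_apply, hz, ContinuousMap.coe_mk, add_assoc]
  have hs0 : (0 : ℝ) ≤ s := s.2
  have hzsol : ∀ T, IsYoungSol β₀ F g (NoisePath.shift s ω).path T z := by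
    intro T
    obtain ⟨⟨θ, C, hθ, h1⟩, H, hH⟩ := solPath_sol hc he hr ω η (s + T)
    refine ⟨⟨θ, C, hθ, fun a b ha hab hb => ?_⟩, H, fun u h h' => ?_, fun a b h h' h'' => ?_⟩
    · have := h1 (s + a) (s + b) (by linarith) (by linarith) (by linarith)
      rw [add_sub_add_left_eq_sub] at this
      refine le_trans (le_of_eq ?_) this
      rw [hseg, NoisePath.shift_path_apply, NoisePath.shift_path_apply, sub_sub_sub_cancel_right]
      unfold noiseIncr
      have e : ∫ u in a..b, F (segment r z u) =
          ∫ u in (s + a : ℝ)..(s + b), F (segment r y u) := by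
        simp only [hseg]
        exact intervalIntegral.integral_comp_add_left (fun u => F (segment r y u)) _
      rw [e]; rfl
    · exact hH.bdd _ (by linarith) (by linarith)
    · have := hH.hol (s + a) (s + b) (by linarith) (by linarith) (by linarith)
      rwa [add_sub_add_left_eq_sub] at this
  have hz0 : segment r z 0 = (flow hc he hr s ω η).path := by rw [hseg, add_zero]; rfl
  have huniq := solPath_unique hc he hr (NoisePath.shift s ω) _ hz0 hzsol
  apply LittleHolder.path_injective
  rw [flow_path, flow_path]
  ext1 v
  have hv := v.2.1
  have ht0 : (0 : ℝ) ≤ t := t.2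
  have := huniq (show (t : ℝ) + v ∈ Ici (-r) by simp only [mem_Ici]; linarith)
  rw [segment_apply, segment_apply, ← this]
  simp only [hz, ContinuousMap.coe_mk]
  congr 1
  push_cast; ring

/-- A Carathéodory function: continuous in (t,η) for each ω, continuous in ω for each (t,η).
Separability of the phase space yields joint measurability. -/
theorem measurable_flow : Measurable fun p : ℝ≥0 × NoisePath ν m × LittleHolder β₀ (-r) 0 d =>
    flow hc he hr p.1 p.2.1 p.2.2 := by
  have : TopologicalSpace.SeparableSpace (LittleHolder β₀ (-r) 0 d) :=
    LittleHolder.separableSpace he.nnreal_pos he.nnreal_lt_one (by linarith)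
  have : SecondCountableTopology (LittleHolder β₀ (-r) 0 d) :=
    UniformSpace.secondCountable_of_separable _
  have h := measurable_uncurry_of_continuous_of_measurable
    (u := fun (p : ℝ≥0 × LittleHolder β₀ (-r) 0 d) (ω : NoisePath ν m) =>
      flow hc he hr p.1 ω p.2) (fun ω => continuous_flow hc he hr ω)
    (fun p => (continuous_flow_noise hc he hr p.1 p.2).measurable)
  exact h.comp (by fun_prop : Measurable fun p : ℝ≥0 × NoisePath ν m × LittleHolder β₀ (-r) 0 d =>
    ((p.1, p.2.2), p.2.1))

theorem isContinuousRDS_flow : IsContinuousRDS (S := LittleHolder β₀ (-r) 0 d)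
    (NoisePath.shift (ν := ν) (m := m)) (flow hc he hr) where
  measurable := measurable_flow hc he hr
  continuous := continuous_flow hc he hr
  map_zero := flow_zero hc he hr
  cocycle := flow_cocycle hc he hr

theorem isSolutionFlow_flow {A : Matrix (Fin d) (Fin d) ℝ} {f : Hist r d → Vec d}
    (hc : IsCoeff (drift hr A f) g CF Cg) (he : IsExponents β₀ ν) :
    IsSolutionFlow (ν := ν) r β₀ A f g (flow hc he hr) := fun ω η =>
  ⟨solPath hc he hr ω η, isSolution_of_youngSol hr hc he ω.isDriver (solPath_zero hc he hr ω η)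
    (solPath_sol hc he hr ω η), fun _ hz => solPath_unique hc he hr ω η hz.initial
    (hz.isYoungSol hr hc he ω.isDriver), fun _ => rfl⟩

end Flow


/-! ### Dissipativity -/

/-! ### Variation of constants. -/

section Duhamel

variable {E : Type*} [NormedAddCommGroup E] [NormedSpace ℝ E]

theorem integral_exp_mul_exp_le {lam μ : ℝ} (h : μ < lam) (t : ℝ) :
    ∫ s in (0 : ℝ)..t, Real.exp (-lam * (t - s)) * Real.exp (-μ * s) ≤
      Real.exp (-μ * t) / (lam - μ) := by
  have h0 : lam - μ ≠ 0 := by linarith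
  have hd : ∀ s : ℝ, HasDerivAt (fun s => Real.exp (-lam * (t - s) - μ * s) / (lam - μ))
      (Real.exp (-lam * (t - s)) * Real.exp (-μ * s)) s := by
    intro s
    have h1 : HasDerivAt (fun s : ℝ => -lam * (t - s) - μ * s) (lam - μ) s := by
      have := (((hasDerivAt_id s).const_sub t).const_mul (-lam)).sub ((hasDerivAt_id s).const_mul μ)
      exact this.congr_deriv (by ring)
    refine (h1.exp.div_const (lam - μ)).congr_deriv ?_
    rw [← Real.exp_add]
    rw [mul_div_assoc, div_self h0, mul_one]
    congr 1
    ring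
  rw [intervalIntegral.integral_eq_sub_of_hasDerivAt (fun s _ => hd s)
    (Continuous.intervalIntegrable (by fun_prop) _ _)]
  have e : -lam * (t - t) - μ * t = -μ * t := by ring
  rw [e]
  have : 0 ≤ Real.exp (-lam * (t - 0) - μ * 0) / (lam - μ) :=
    div_nonneg (Real.exp_pos _).le (by linarith)
  linarith

variable [CompleteSpace E]

/-- Integrate the derivative of s ↦ exp((t-s)a) v(s). -/
theorem duhamel (a : E →L[ℝ] E) {v φ : ℝ → E} (hφ : Continuous φ)
    (hv : ∀ t, HasDerivAt v (φ t) t) (t : ℝ) :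
    v t = NormedSpace.exp (t • a) (v 0) +
      ∫ s in (0 : ℝ)..t, NormedSpace.exp ((t - s) • a) (φ s - a (v s)) := by
  have hvc : Continuous v := continuous_iff_continuousAt.mpr fun t => (hv t).continuousAt
  have he : ∀ s : ℝ, HasDerivAt (fun s : ℝ => NormedSpace.exp ((t - s) • a))
      (-(NormedSpace.exp ((t - s) • a) * a)) s := by
    intro s
    have h := (hasDerivAt_exp_smul_const (𝕂 := ℝ) a (t - s)).scomp s ((hasDerivAt_id s).const_sub t)
    exact h.congr_deriv (by rw [neg_one_smul])
  have hec : Continuous fun s : ℝ => NormedSpace.exp ((t - s) • a) :=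
    continuous_iff_continuousAt.mpr fun s => (he s).continuousAt
  have hd : ∀ s : ℝ, HasDerivAt (fun s => NormedSpace.exp ((t - s) • a) (v s))
      (NormedSpace.exp ((t - s) • a) (φ s - a (v s))) s := by
    intro s
    refine ((he s).clm_apply (hv s)).congr_deriv ?_
    simp only [map_sub, neg_apply, mul_apply_eq_comp]
    abel
  rw [intervalIntegral.integral_eq_sub_of_hasDerivAt (fun s _ => hd s)
    (Continuous.intervalIntegrable (by fun_prop) _ _)]
  simp

theorem norm_le_of_hasDerivAt {a : E →L[ℝ] E} {v φ : ℝ → E} (hφ : Continuous φ)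
    (hv : ∀ t, HasDerivAt v (φ t) t) {c lam μ b₀ b₁ t : ℝ} (hlam : 0 < lam) (hμ : μ < lam)
    (hexp : ∀ t : ℝ, 0 ≤ t → ‖NormedSpace.exp (t • a)‖ ≤ c * Real.exp (-lam * t)) (hc : 0 ≤ c)
    (hb₀ : 0 ≤ b₀) (hb₁ : 0 ≤ b₁) (ht : 0 ≤ t)
    (hb : ∀ s, 0 ≤ s → s ≤ t → ‖φ s - a (v s)‖ ≤ b₀ + b₁ * Real.exp (-μ * s)) :
    ‖v t‖ ≤ c * Real.exp (-lam * t) * ‖v 0‖ + c * b₀ / lam +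
      c * b₁ / (lam - μ) * Real.exp (-μ * t) := by
  have h1 : ‖∫ s in (0 : ℝ)..t, NormedSpace.exp ((t - s) • a) (φ s - a (v s))‖ ≤
      ∫ s in (0 : ℝ)..t, (c * b₀ * (Real.exp (-lam * (t - s)) * Real.exp (-0 * s)) +
        c * b₁ * (Real.exp (-lam * (t - s)) * Real.exp (-μ * s))) := by
    refine intervalIntegral.norm_integral_le_of_norm_le ht (ae_of_all _ fun s hs => ?_)
      (Continuous.intervalIntegrable (by fun_prop) _ _)
    refine (ContinuousLinearMap.le_opNorm _ _).trans ?_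
    refine (mul_le_mul (hexp _ (by linarith [hs.2])) (hb s hs.1.le hs.2) (norm_nonneg _)
      (by positivity)).trans (le_of_eq ?_)
    rw [neg_zero, zero_mul, Real.exp_zero]
    ring
  rw [intervalIntegral.integral_add (Continuous.intervalIntegrable (by fun_prop) _ _)
    (Continuous.intervalIntegrable (by fun_prop) _ _), intervalIntegral.integral_const_mul,
    intervalIntegral.integral_const_mul] at h1
  have h2 := integral_exp_mul_exp_le hlam t
  have h3 := integral_exp_mul_exp_le hμ t
  rw [neg_zero, zero_mul, Real.exp_zero, sub_zero] at h2
  rw [duhamel a hφ hv t]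
  refine (norm_add_le _ _).trans ?_
  have h4 : ‖NormedSpace.exp (t • a) (v 0)‖ ≤ c * Real.exp (-lam * t) * ‖v 0‖ :=
    (ContinuousLinearMap.le_opNorm _ _).trans (by gcongr; exact hexp t ht)
  have h5 := mul_le_mul_of_nonneg_left h2 (mul_nonneg hc hb₀)
  have h6 := mul_le_mul_of_nonneg_left h3 (mul_nonneg hc hb₁)
  have e1 : c * b₀ * (1 / lam) = c * b₀ / lam := by ring
  have e2 : c * b₁ * (Real.exp (-μ * t) / (lam - μ)) = c * b₁ / (lam - μ) * Real.exp (-μ * t) := by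
    ring
  rw [neg_zero] at h1
  linarith

end Duhamel

/-! ### Exponential decay up to the noise. -/

section Dissipative

variable {d m : ℕ} {r : ℝ}

/-- Stability of the delay equation under perturbations which are small in supremum norm. -/
theorem norm_le_of_dissipative (hr : 0 ≤ r) {A : Matrix (Fin d) (Fin d) ℝ} {f : Hist r d → Vec d}
    {Cf : ℝ≥0} (hf : LipschitzWith Cf f) {c lam μ : ℝ} (hc : 0 ≤ c) (hμ0 : 0 ≤ μ) (hμ : μ < lam)
    (hexp : ∀ t : ℝ, 0 ≤ t →
      ‖NormedSpace.exp (t • Matrix.toEuclideanCLM (𝕜 := ℝ) A)‖ ≤ c * Real.exp (-lam * t))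
    (hκ : c * Cf * Real.exp (μ * r) < lam - μ) {y : C(ℝ, Vec d)} {T B N : ℝ} (hT : 0 ≤ T)
    (hB : ∀ t, -r ≤ t → t ≤ 0 → ‖y t‖ ≤ B)
    (hN : ∀ t, 0 ≤ t → t ≤ T → ‖noiseIncr (drift hr A f) y 0 t‖ ≤ N) {t : ℝ} (ht : -r ≤ t)
    (htT : t ≤ T) :
    ‖y t‖ ≤ (1 + c / (1 - c * Cf * Real.exp (μ * r) / (lam - μ))) * B * Real.exp (-μ * t) +
      (c * ((‖Matrix.toEuclideanCLM (𝕜 := ℝ) A‖ + Cf) * N + ‖f 0‖) / (lam - c * Cf) + N) := by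
  set a := Matrix.toEuclideanCLM (𝕜 := ℝ) A with ha
  set κ := c * Cf * Real.exp (μ * r) / (lam - μ) with hκdef
  have hlμ : 0 < lam - μ := by linarith
  have hlam : 0 < lam := by linarith
  have hκ1 : κ < 1 := by rw [hκdef, div_lt_one hlμ]; exact hκ
  have hκ0 : 0 ≤ κ := by positivity
  have hexp1 : 1 ≤ Real.exp (μ * r) := Real.one_le_exp (by positivity)
  have hCf : 0 ≤ c * Cf := by positivity
  have hcf : c * Cf < lam := by nlinarith
  have hB0 : 0 ≤ B := (norm_nonneg _).trans (hB 0 (by linarith) le_rfl)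
  have hN0 : 0 ≤ N := (norm_nonneg _).trans (hN 0 le_rfl hT)
  set P := (‖a‖ + Cf) * N + ‖f 0‖ with hP
  -- The stationary level: Q solves c(P + Cf·Q)/lam = Q, so the constant part of the forcing
  -- reproduces Q exactly in the Duhamel estimate.
  set Q := c * P / (lam - c * Cf) with hQ
  have hQ0 : 0 ≤ Q := div_nonneg (by positivity) (by linarith)
  have hF := lipschitzWith_drift hr A hf
  set φ : ℝ → Vec d := fun u => drift hr A f (segment r y u) with hφdef
  have hφ : Continuous φ := continuous_drift hF.continuous y
  -- y stripped of its noise. Unlike y, it is differentiable, so variation of constants applies.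
  set v : ℝ → Vec d := fun t => y 0 + ∫ u in (0 : ℝ)..t, φ u with hvdef
  have hv : ∀ t, HasDerivAt v (φ t) t := fun t =>
    (intervalIntegral.integral_hasDerivAt_right (hφ.intervalIntegrable _ _)
      (hφ.stronglyMeasurableAtFilter _ _) hφ.continuousAt).const_add _
  have hvc : Continuous v := continuous_iff_continuousAt.mpr fun t => (hv t).continuousAt
  have hv0 : v 0 = y 0 := by simp [hvdef]
  have hyv : ∀ t, y t - v t = noiseIncr (drift hr A f) y 0 t := fun t => by
    simp only [hvdef, noiseIncr, hφdef]; abel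
  -- Take the maximum of the weighted excess of ‖v‖ over Q. The Duhamel estimate at the maximum
  -- point gives V₀ ≤ c·B + κ·V with κ < 1; the delay costs only the factor exp(μr) contained in κ.
  obtain ⟨ts, hts, hmax⟩ := isCompact_Icc.exists_isMaxOn (nonempty_Icc.mpr hT)
    (f := fun t => Real.exp (μ * t) * (‖v t‖ - Q)) (by fun_prop)
  set V₀ := Real.exp (μ * ts) * (‖v ts‖ - Q) with hV₀
  set V := max V₀ B with hVdef
  have hV0 : 0 ≤ V := hB0.trans (le_max_right _ _)
  have hcancel : ∀ t : ℝ, Real.exp (-μ * t) * Real.exp (μ * t) = 1 := fun t => by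
    rw [← Real.exp_add]; simp
  have hvb : ∀ s, 0 ≤ s → s ≤ T → ‖v s‖ ≤ Q + V * Real.exp (-μ * s) := by
    intro s hs hsT
    have h1 : Real.exp (μ * s) * (‖v s‖ - Q) ≤ V := (hmax ⟨hs, hsT⟩).trans (le_max_left _ _)
    have h2 := mul_le_mul_of_nonneg_left h1 (Real.exp_pos (-μ * s)).le
    rw [← mul_assoc, hcancel] at h2
    linarith
  have hyb : ∀ s, -r ≤ s → s ≤ T → ‖y s‖ ≤ N + Q + V * Real.exp (-μ * s) := by
    intro s hs hsT
    rcases le_total s 0 with h | h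
    · have h1 : 1 ≤ Real.exp (-μ * s) := Real.one_le_exp (by nlinarith)
      have h2 := hB s hs h
      have h3 : B ≤ V := le_max_right _ _
      nlinarith
    · have h1 := hN s h hsT
      rw [← hyv] at h1
      have h2 := hvb s h hsT
      have h3 := norm_sub_norm_le (y s) (v s)
      linarith
  have hseg : ∀ s, 0 ≤ s → s ≤ T → ‖segment r y s‖ ≤
      N + Q + V * Real.exp (μ * r) * Real.exp (-μ * s) := by
    intro s hs hsT
    refine (ContinuousMap.norm_le _ (by positivity)).mpr fun u => ?_
    rw [segment_apply]
    have hu1 := u.2.1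
    have hu2 := u.2.2
    refine (hyb _ (by linarith) (by linarith)).trans ?_
    rw [mul_assoc, ← Real.exp_add]
    gcongr
    nlinarith
  have hdiff : ∀ s, 0 ≤ s → s ≤ T → ‖φ s - a (v s)‖ ≤
      (P + Cf * Q) + Cf * V * Real.exp (μ * r) * Real.exp (-μ * s) := by
    intro s hs hsT
    have e : φ s - a (v s) = a (y s - v s) + f (segment r y s) := by
      simp only [hφdef, drift_segment, map_sub]; abel
    rw [e, hyv]
    have h1 := (a.le_opNorm (noiseIncr (drift hr A f) y 0 s)).trans
      (mul_le_mul_of_nonneg_left (hN s hs hsT) (norm_nonneg _))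
    have h2 := hf.norm_le_add (hseg s hs hsT)
    refine (norm_add_le _ _).trans ((add_le_add h1 h2).trans (le_of_eq ?_))
    rw [hP]; ring
  have hfin : V₀ ≤ c * B + κ * V := by
    have h1 := norm_le_of_hasDerivAt hφ hv hlam hμ hexp hc (by positivity) (by positivity) hts.1
      fun s hs hst => hdiff s hs (hst.trans hts.2)
    have e1 : c * (P + Cf * Q) / lam = Q := by
      have : lam - c * Cf ≠ 0 := by linarith
      rw [hQ]
      field_simp
      ring
    have e2 : c * (Cf * V * Real.exp (μ * r)) / (lam - μ) = κ * V := by rw [hκdef]; ring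
    rw [e1, e2, hv0] at h1
    have h2 : Real.exp (-lam * ts) ≤ Real.exp (-μ * ts) :=
      Real.exp_le_exp.mpr (by nlinarith [hts.1])
    have h3 : c * Real.exp (-lam * ts) * ‖y 0‖ ≤ c * Real.exp (-μ * ts) * B := by
      gcongr
      exact hB 0 (by linarith) le_rfl
    have h4 : ‖v ts‖ - Q ≤ (c * B + κ * V) * Real.exp (-μ * ts) := by linarith
    have h5 := mul_le_mul_of_nonneg_left h4 (Real.exp_pos (μ * ts)).le
    have e3 : Real.exp (μ * ts) * ((c * B + κ * V) * Real.exp (-μ * ts)) = c * B + κ * V := by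
      rw [mul_comm, mul_assoc, hcancel, mul_one]
    linarith
  have hV : V ≤ (1 + c / (1 - κ)) * B := by
    have h1 : 0 < 1 - κ := by linarith
    have h2 : 0 ≤ c / (1 - κ) := by positivity
    rcases le_total V₀ B with h | h
    · rw [hVdef, max_eq_right h]; nlinarith
    · have e : V = V₀ := max_eq_left h
      rw [e] at hfin ⊢
      have h3 : V₀ ≤ c / (1 - κ) * B := by
        rw [div_mul_eq_mul_div, le_div_iff₀ h1]
        linarith
      linarith
  have h1 := hyb t ht htT
  have h2 := mul_le_mul_of_nonneg_right hV (Real.exp_pos (-μ * t)).le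
  linarith

theorem HistBdd.mono {α B B' : ℝ} {η : Hist r d} (h : HistBdd α B η) (hB : B ≤ B') :
    HistBdd α B' η :=
  ⟨h.1.trans hB, fun s t hst => (h.2 s t hst).trans (mul_le_mul_of_nonneg_right hB
    (Real.rpow_nonneg (sub_nonneg.mpr (show (s : ℝ) ≤ t from hst)) _))⟩

/-- Decay is known for the supremum norm only; on the last window the Hölder seminorm is recovered
from the increments, which are noise plus an integral of the drift. -/
theorem histBdd_of_noiseIncr (hr : 0 ≤ r) {α ν : ℝ} (he : IsExponents α ν) {F : Hist r d → Vec d}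
    {y : C(ℝ, Vec d)} {T S D N : ℝ} (hT : r ≤ T) (hD0 : 0 ≤ D) (hN0 : 0 ≤ N)
    (hS : ∀ t, T - r ≤ t → t ≤ T → ‖y t‖ ≤ S)
    (hD : ∀ u, T - r ≤ u → u ≤ T → ‖F (segment r y u)‖ ≤ D)
    (hN : ∀ s t, 0 ≤ s → s ≤ t → t ≤ T → ‖noiseIncr F y s t‖ ≤ N * (t - s) ^ ν) :
    HistBdd α (S + (N + D) * (1 + r)) (segment r y T) := by
  have hS0 : 0 ≤ S := (norm_nonneg _).trans (hS T (by linarith) le_rfl)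
  have hν := he.pos.trans he.lt
  refine ⟨(ContinuousMap.norm_le _ (by positivity)).mpr fun s => ?_, fun s t hst => ?_⟩
  · rw [segment_apply]
    have h1 := hS (T + s) (by linarith [s.2.1]) (by linarith [s.2.2])
    have h2 : 0 ≤ (N + D) * (1 + r) := by positivity
    linarith
  have hst' : (s : ℝ) ≤ t := hst
  have hs := s.2.1
  have ht := t.2.2
  rw [segment_apply, segment_apply]
  have h1 : ‖∫ u in (T + s : ℝ)..(T + t), F (segment r y u)‖ ≤ D * (t - s) := by
    have h := intervalIntegral.norm_integral_le_of_norm_le_const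
      (a := T + s) (b := T + t) (f := fun u => F (segment r y u)) (C := D) fun u hu => by
        rw [uIoc_of_le (by linarith)] at hu
        exact hD u (by linarith [hu.1]) (by linarith [hu.2])
    rwa [add_sub_add_left_eq_sub, abs_of_nonneg (by linarith)] at h
  have h2 := hN (T + s) (T + t) (by linarith) (by linarith) (by linarith)
  rw [add_sub_add_left_eq_sub] at h2
  have e : y (T + t) - y (T + s) = noiseIncr F y (T + s) (T + t) +
      ∫ u in (T + s : ℝ)..(T + t), F (segment r y u) := by
    unfold noiseIncr; abel
  rw [e]
  obtain ⟨u, hu⟩ : ∃ u, u = (t : ℝ) - s := ⟨_, rfl⟩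
  rw [← hu] at h1 h2 ⊢
  have hu0 : 0 ≤ u := by linarith
  have hur : u ≤ 1 + r := by linarith
  have h3 : u ≤ (1 + r) * u ^ α :=
    le_mul_rpow he.pos (he.lt.le.trans he.le_one) hu0 (by linarith) hur
  have h4 : u ^ ν ≤ (1 + r) * u ^ α := by
    rcases hu0.eq_or_lt with h | h
    · rw [← h, Real.zero_rpow hν.ne', Real.zero_rpow he.pos.ne', mul_zero]
    · have e4 : u ^ ν = u ^ (ν - α) * u ^ α := by rw [← Real.rpow_add h]; ring_nf
      rw [e4]
      refine mul_le_mul_of_nonneg_right ?_ (by positivity)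
      calc u ^ (ν - α) ≤ (1 + r) ^ (ν - α) :=
            Real.rpow_le_rpow hu0 hur (by linarith [he.lt])
        _ ≤ (1 + r) ^ (1 : ℝ) := Real.rpow_le_rpow_of_exponent_le (by linarith)
            (by linarith [he.pos, he.le_one])
        _ = 1 + r := Real.rpow_one _
  have h5 := mul_le_mul_of_nonneg_left h4 hN0
  have h6 := mul_le_mul_of_nonneg_left h3 hD0
  have h7 : 0 ≤ S * u ^ α := by positivity
  calc ‖noiseIncr F y (T + s) (T + t) + ∫ u in (T + s : ℝ)..(T + t), F (segment r y u)‖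
      ≤ N * u ^ ν + D * u := (norm_add_le _ _).trans (add_le_add h2 h1)
    _ ≤ S * u ^ α + (N * ((1 + r) * u ^ α) + D * ((1 + r) * u ^ α)) := by linarith
    _ = (S + (N + D) * (1 + r)) * u ^ α := by ring

theorem exists_exp_decay (hr : 0 ≤ r) {A : Matrix (Fin d) (Fin d) ℝ} {f : Hist r d → Vec d}
    {Cf : ℝ≥0} (hf : LipschitzWith Cf f) {c lam : ℝ} (hc : 0 ≤ c) (hlam : 0 < lam)
    (hexp : ∀ t : ℝ, 0 ≤ t →
      ‖NormedSpace.exp (t • Matrix.toEuclideanCLM (𝕜 := ℝ) A)‖ ≤ c * Real.exp (-lam * t))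
    (hκ : c * Cf < lam) {α ν : ℝ} (he : IsExponents α ν) :
    ∃ C μ, 0 ≤ C ∧ 0 < μ ∧ ∀ (y : C(ℝ, Vec d)) (T B N : ℝ), 1 ≤ T → 2 * r ≤ T → 0 ≤ N →
      (∀ t, -r ≤ t → t ≤ 0 → ‖y t‖ ≤ B) →
      (∀ s t, 0 ≤ s → s ≤ t → t ≤ T → ‖noiseIncr (drift hr A f) y s t‖ ≤ N * (t - s) ^ ν) →
        HistBdd α (C * (Real.exp (-μ * T) * B + T * N + ‖f 0‖)) (segment r y T) := by
  -- The strict inequality c·Cf < lam persists for small μ > 0, by continuity at μ = 0; this μ is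
  -- the decay rate.
  obtain ⟨μ, hμκ, hμl, hμ0⟩ : ∃ μ, c * Cf * Real.exp (μ * r) < lam - μ ∧ μ < lam ∧ 0 < μ := by
    have h1 : ∀ᶠ μ in 𝓝 (0 : ℝ), c * Cf * Real.exp (μ * r) < lam - μ :=
      ContinuousAt.eventually_lt (by fun_prop) (by fun_prop) (by simpa using hκ)
    have h2 : ∀ᶠ μ in 𝓝[>] (0 : ℝ), 0 < μ := self_mem_nhdsWithin
    exact ((h1.filter_mono nhdsWithin_le_nhds).and
      (((eventually_lt_nhds hlam).filter_mono nhdsWithin_le_nhds).and h2)).exists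
  set a := Matrix.toEuclideanCLM (𝕜 := ℝ) A with ha
  obtain ⟨CF, hF⟩ : ∃ CF : ℝ≥0, LipschitzWith CF (drift hr A f) := ⟨_, lipschitzWith_drift hr A hf⟩
  set C₁ := 1 + c / (1 - c * Cf * Real.exp (μ * r) / (lam - μ)) with hC₁
  have hC₁0 : 0 ≤ C₁ := by
    have : c * Cf * Real.exp (μ * r) / (lam - μ) < 1 := by
      rw [div_lt_one (by linarith)]; exact hμκ
    have : 0 ≤ c / (1 - c * Cf * Real.exp (μ * r) / (lam - μ)) := div_nonneg hc (by linarith)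
    linarith
  set C₂ := c / (lam - c * Cf) * (‖a‖ + Cf + 1) + 1 with hC₂
  have hC₂0 : 1 ≤ C₂ := by
    have : 0 ≤ c / (lam - c * Cf) * (‖a‖ + Cf + 1) :=
      mul_nonneg (div_nonneg hc (by linarith)) (by positivity)
    linarith
  set U₁ := C₁ * Real.exp (μ * (2 * r)) + C₂ with hU₁
  have hU₁0 : 1 ≤ U₁ := by
    have : 0 ≤ C₁ * Real.exp (μ * (2 * r)) := by positivity
    linarith
  refine ⟨(2 + (CF : ℝ) * U₁ + U₁) * (1 + r), μ, by positivity, hμ0,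
    fun y T B N hT hrT hN0 hB hN => ?_⟩
  have hB0 : 0 ≤ B := (norm_nonneg _).trans (hB 0 (by linarith) le_rfl)
  set R := Real.exp (-μ * T) * B + T * N + ‖f 0‖ with hR
  have hν := he.pos.trans he.lt
  have hN' : ∀ t, 0 ≤ t → t ≤ T → ‖noiseIncr (drift hr A f) y 0 t‖ ≤ T * N := by
    intro t h0 htT
    refine (hN 0 t le_rfl h0 htT).trans ?_
    rw [mul_comm, sub_zero]
    refine mul_le_mul_of_nonneg_right ?_ hN0
    calc t ^ ν ≤ T ^ ν := Real.rpow_le_rpow h0 htT hν.le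
      _ ≤ T ^ (1 : ℝ) := Real.rpow_le_rpow_of_exponent_le hT he.le_one
      _ = T := Real.rpow_one T
  have hR0 : 0 ≤ R := by positivity
  have hNR : N ≤ R := by
    have h1 : 0 ≤ Real.exp (-μ * T) * B := by positivity
    have h2 : 0 ≤ ‖f 0‖ := norm_nonneg _
    nlinarith
  have hfR : ‖f 0‖ ≤ R := by
    have h1 : 0 ≤ Real.exp (-μ * T) * B := by positivity
    have h2 : 0 ≤ T * N := by positivity
    linarith
  -- The drift on [T-r,T] sees y back to T - 2r, whence the window of length 2r and the factor
  -- exp(2μr) in `U₁`.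
  have hy : ∀ t, T - 2 * r ≤ t → t ≤ T → ‖y t‖ ≤ U₁ * R := by
    intro t ht htT
    have h1 := norm_le_of_dissipative hr hf hc hμ0.le hμl hexp hμκ (by linarith) hB hN'
      (by linarith : -r ≤ t) htT
    rw [← ha, ← hC₁] at h1
    have h2 : Real.exp (-μ * t) ≤ Real.exp (μ * (2 * r)) * Real.exp (-μ * T) := by
      rw [← Real.exp_add]
      exact Real.exp_le_exp.mpr (by nlinarith)
    have h3 : C₁ * B * Real.exp (-μ * t) ≤
        C₁ * Real.exp (μ * (2 * r)) * (Real.exp (-μ * T) * B) := by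
      refine (mul_le_mul_of_nonneg_left h2 (by positivity)).trans (le_of_eq (by ring))
    have h4 : c * ((‖a‖ + Cf) * (T * N) + ‖f 0‖) / (lam - c * Cf) + T * N ≤
        C₂ * (T * N + ‖f 0‖) := by
      have h5 : 0 ≤ c / (lam - c * Cf) := div_nonneg hc (by linarith)
      have h6 : (‖a‖ + Cf) * (T * N) + ‖f 0‖ ≤ (‖a‖ + Cf + 1) * (T * N + ‖f 0‖) := by
        have : 0 ≤ T * N := by positivity
        have : 0 ≤ (‖a‖ + Cf) * ‖f 0‖ := by positivity
        nlinarith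
      have h7 := mul_le_mul_of_nonneg_left h6 h5
      have e : c * ((‖a‖ + Cf) * (T * N) + ‖f 0‖) / (lam - c * Cf) =
        c / (lam - c * Cf) * ((‖a‖ + Cf) * (T * N) + ‖f 0‖) := by ring
      rw [e, hC₂]
      have : 0 ≤ ‖f 0‖ := norm_nonneg _
      nlinarith
    have h5 : 0 ≤ C₁ * Real.exp (μ * (2 * r)) := by positivity
    have h6 : 0 ≤ T * N + ‖f 0‖ := by positivity
    have h7 : 0 ≤ Real.exp (-μ * T) * B := by positivity
    rw [hU₁, hR]
    nlinarith
  have hU₁' : 0 ≤ U₁ := zero_le_one.trans hU₁0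
  clear_value U₁ R
  have hseg : ∀ u, T - r ≤ u → u ≤ T → ‖segment r y u‖ ≤ U₁ * R := by
    intro u hu huT
    refine (ContinuousMap.norm_le _ (by positivity)).mpr fun s => ?_
    rw [segment_apply]
    exact hy _ (by linarith [s.2.1]) (by linarith [s.2.2])
  have e0 : drift hr A f 0 = f 0 := by simp [drift]
  have hdr : ∀ u, T - r ≤ u → u ≤ T → ‖drift hr A f (segment r y u)‖ ≤
      R + (CF : ℝ) * (U₁ * R) := by
    intro u hu huT
    have := hF.norm_le_add (hseg u hu huT)
    rw [e0] at this
    linarith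
  have h := histBdd_of_noiseIncr hr he (by linarith) (by positivity) hN0
    (fun t h1 h2 => hy t (by linarith) h2) hdr hN
  refine h.mono ?_
  calc U₁ * R + (N + (R + (CF : ℝ) * (U₁ * R))) * (1 + r)
      ≤ U₁ * R * (1 + r) + (R + (R + (CF : ℝ) * (U₁ * R))) * (1 + r) := by
        have h1 : 0 ≤ U₁ * R * r := by positivity
        have h2 := mul_le_mul_of_nonneg_right hNR (by linarith : (0:ℝ) ≤ 1 + r)
        linarith
    _ = (2 + (CF : ℝ) * U₁ + U₁) * (1 + r) * R := by ring

end Dissipative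


/-! ### Growth and contraction over a long block -/

section Block

/-- log `growthConst` is affine in the power 1/κ of its argument, so any p ≥ 1/κ will do. With κ = ν
- β₀ this allows p = 1/(ν - β), the exponent of the moment condition. -/
theorem exists_growthConst_le {κ T a b p : ℝ} (hκ : 0 < κ) (hT : 0 ≤ T) (ha : 0 ≤ a) (hb : 0 ≤ b)
    (hp : 1 / κ ≤ p) :
    ∃ K, 0 ≤ K ∧ ∀ z, 0 ≤ z → growthConst κ T (a + b * z) ≤ Real.exp (K * (1 + z ^ p)) := by
  have hκ' : 0 < 1 / κ := by positivity
  have hp0 : 0 < p := hκ'.trans_le hp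
  set k := (4 * (a + b)) ^ (1 / κ) * 2 ^ p with hk
  have hk0 : 0 ≤ k := by positivity
  have hlog : 0 < Real.log 3 := Real.log_pos (by norm_num)
  refine ⟨Real.log 3 * (1 + T + T * k), by positivity, fun z hz => ?_⟩
  have hzp : 0 ≤ z ^ p := by positivity
  have h1 : (4 * (a + b * z)) ^ (1 / κ) ≤ k * (1 + z ^ p) := by
    calc (4 * (a + b * z)) ^ (1 / κ) ≤ (4 * (a + b) * (1 + z)) ^ (1 / κ) := by
          refine Real.rpow_le_rpow (by positivity) ?_ hκ'.le
          have h1 : 0 ≤ a * z := by positivity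
          nlinarith
      _ = (4 * (a + b)) ^ (1 / κ) * (1 + z) ^ (1 / κ) :=
          Real.mul_rpow (by positivity) (by positivity)
      _ ≤ (4 * (a + b)) ^ (1 / κ) * (1 + z) ^ p := by
          gcongr
          linarith
      _ ≤ (4 * (a + b)) ^ (1 / κ) * (2 ^ p * (1 + z ^ p)) := by
          gcongr
          have h2 : 1 + z ≤ 2 * max 1 z := by
            have := le_max_left 1 z
            have := le_max_right 1 z
            linarith
          refine (Real.rpow_le_rpow (by positivity) h2 hp0.le).trans ?_
          rw [Real.mul_rpow (by norm_num) (by positivity)]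
          gcongr
          rcases le_total z 1 with h | h
          · rw [max_eq_left h, Real.one_rpow]; linarith
          · rw [max_eq_right h]; linarith
      _ = k * (1 + z ^ p) := by rw [hk]; ring
  unfold growthConst
  rw [Real.rpow_def_of_pos (by norm_num : (0 : ℝ) < 3), mul_assoc]
  refine Real.exp_le_exp.mpr (mul_le_mul_of_nonneg_left ?_ hlog.le)
  have h2 := mul_le_mul_of_nonneg_left h1 hT
  have h3 : 0 ≤ T * z ^ p := by positivity
  nlinarith

variable {d m : ℕ} {r : ℝ} {ν β₀ : ℝ≥0}

/-- Over a block of suitable length the flow contracts, up to the effect of the noise. -/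
theorem exists_block_estimate (hr : 0 ≤ r) {A : Matrix (Fin d) (Fin d) ℝ} {f : Hist r d → Vec d}
    {Cf : ℝ≥0} (hf : LipschitzWith Cf f) {c lam : ℝ} (hc : 0 ≤ c) (hlam : 0 < lam)
    (hexp : ∀ t : ℝ, 0 ≤ t →
      ‖NormedSpace.exp (t • Matrix.toEuclideanCLM (𝕜 := ℝ) A)‖ ≤ c * Real.exp (-lam * t))
    (hκ : c * Cf < lam) (he : IsExponents β₀ ν) {p : ℝ} (hp : 1 / ((ν : ℝ) - β₀) ≤ p) (CF : ℝ≥0) :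
    ∃ T C : ℝ, 1 ≤ T ∧ 2 * r ≤ T ∧ 0 ≤ C ∧ ∀ (g : Hist r d → Vec m →L[ℝ] Vec d) (Cg : ℝ≥0)
      (hg : IsCoeff (drift hr A f) g CF Cg), ∃ D, 0 ≤ D ∧
        ∀ (ω : NoisePath ν m) (η : LittleHolder β₀ (-r) 0 d) (X : ℝ), 0 ≤ X →
          HolOn ν X 0 T ω.path →
          ‖flow hg he hr T.toNNReal ω η‖ ≤ Real.exp (-1 + C * (Cg * X) ^ p) * ‖η‖ +
            D * (1 + X ^ p) * Real.exp (C * (Cg * X) ^ p) ∧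
          ∀ t : ℝ≥0, t ≤ T → ‖flow hg he hr t ω η‖ ≤
            Real.exp (C * (1 + (Cg * X) ^ p)) * (‖η‖ + D * (1 + X ^ p)) := by
  obtain ⟨C₃, μ, hC₃, hμ, hdecay⟩ := exists_exp_decay hr hf hc hlam hexp hκ he
  have hκ0 : 0 < (ν : ℝ) - β₀ := by linarith [he.lt]
  have hp1 : 1 ≤ p := by
    refine le_trans ?_ hp
    rw [le_div_iff₀ hκ0]
    linarith [he.le_one, he.pos]
  have hp0 : 0 < p := by linarith
  -- The factor 2 comes from passing from `HistBdd` to the norm (supremum plus seminorm).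
  obtain ⟨T, hT1, hTr, hTμ⟩ : ∃ T : ℝ, 1 ≤ T ∧ 2 * r ≤ T ∧
      2 * C₃ * Real.exp (-μ * T) ≤ 1 / 8 := by
    have h : Tendsto (fun T : ℝ => 2 * C₃ * Real.exp (-μ * T)) atTop (𝓝 (2 * C₃ * 0)) := by
      refine Tendsto.const_mul _ (Real.tendsto_exp_atBot.comp ?_)
      exact tendsto_id.const_mul_atTop_of_neg (by linarith)
    rw [mul_zero] at h
    exact ((eventually_ge_atTop 1).and ((eventually_ge_atTop (2 * r)).and
      ((h.eventually_lt_const (by norm_num : (0 : ℝ) < 1 / 8)).mono fun _ h => h.le))).exists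
  have hs := (sewConst_pos he.one_lt).le
  set b := 1 + sewConst (β₀ + ν) * T with hb
  have hb0 : 0 ≤ b := by positivity
  have hTT : 0 ≤ T := by linarith
  have hT0 : 0 ≤ T * CF := by positivity
  obtain ⟨K, hK0, hK⟩ := exists_growthConst_le (b := b) hκ0 hTT hT0 hb0 hp
  set G₁ := Real.exp (K * 2) with hG₁
  have hG₁0 : 0 < G₁ := Real.exp_pos _
  set q := 2 * C₃ * T * b * G₁ with hq
  have hq0 : 0 ≤ q := by positivity
  -- Threshold between weak and strong noise in z = Cg·X: below it, feeding the a priori bound into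
  -- the noise term costs at most q·δ ≤ 1/8 of the initial norm.
  set δ := min 1 (1 / (8 * (q + 1))) with hδ
  have hδ0 : 0 < δ := by positivity
  have hδ1 : δ ≤ 1 := min_le_left _ _
  have hqδ : q * δ ≤ 1 / 8 := by
    have h1 : q * δ ≤ q * (1 / (8 * (q + 1))) := by
      gcongr
      exact min_le_right _ _
    refine h1.trans ?_
    rw [mul_one_div, div_le_iff₀ (by positivity)]
    linarith
  set C := K + 1 + (2 + K) * (δ ^ p)⁻¹ with hC
  have hC0 : 0 ≤ (2 + K) * (δ ^ p)⁻¹ := by positivity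
  clear_value b G₁ δ
  -- T and C are fixed before g, and only D depends on g, through g 0. This order allows the
  -- smallness threshold for Cg to be uniform in g.
  refine ⟨T, C, hT1, hTr, by positivity, fun g Cg hg => ?_⟩
  set D₁ := T * ‖f 0‖ + ‖g 0‖ with hD₁
  set D₂ := 2 * C₃ * (T * ‖g 0‖ + ‖f 0‖) with hD₂
  have hD₁0 : 0 ≤ D₁ := by positivity
  have hD₂0 : 0 ≤ D₂ := by positivity
  refine ⟨2 * (D₁ + D₂), by positivity, fun ω η X hX hω => ?_⟩
  set z : ℝ := Cg * X with hz
  have hz0 : 0 ≤ z := by positivity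
  have hzp : 0 ≤ z ^ p := by positivity
  have hXp : 0 ≤ X ^ p := by positivity
  have hX1 : X ≤ 1 + X ^ p := by
    rcases le_total X 1 with h | h
    · linarith
    · have := Real.rpow_le_rpow_of_exponent_le h hp1
      rw [Real.rpow_one] at this
      linarith
  set y := solPath hg he hr ω η with hy
  obtain ⟨⟨θ, C', hθ, hgerm⟩, H, hH⟩ := solPath_sol hg he hr ω η T
  have hB := (solPath_histBdd hg he hr ω η).holderBdd
  rw [← hy] at hgerm hH hB
  set G := growthConst (ν - β₀) T (T * CF + b * z) with hG
  have hap : HolderBdd β₀ r T (G * (‖η‖ + (T * ‖drift hr A f 0‖ + ‖g 0‖ * X))) y := by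
    rw [hG, hb, hz]
    exact hgerm.apriori hg.lipF hg.lip he.pos he.lt he.le_one he.one_lt hr hT1 hX hω hθ hH hB
  have e0 : drift hr A f 0 = f 0 := by simp [drift]
  rw [e0] at hap
  have hG0 : 1 ≤ G := growthConst_ge_one hTT (by positivity)
  have hGK : G ≤ Real.exp (K * (1 + z ^ p)) := hK z hz0
  set M := G * (‖η‖ + (T * ‖f 0‖ + ‖g 0‖ * X)) with hM
  have hM0 : 0 ≤ M := by positivity
  have hD₁X : T * ‖f 0‖ + ‖g 0‖ * X ≤ D₁ * (1 + X ^ p) := by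
    have h1 : 0 ≤ T * ‖f 0‖ * X ^ p := by positivity
    have h2 := mul_le_mul_of_nonneg_left hX1 (norm_nonneg (g 0))
    rw [hD₁]
    linarith
  have hMD : M ≤ G * (‖η‖ + D₁ * (1 + X ^ p)) := by
    rw [hM]; gcongr
  have hgen : ∀ t : ℝ≥0, t ≤ T → ‖flow hg he hr t ω η‖ ≤
      Real.exp (1 + K * (1 + z ^ p)) * (‖η‖ + D₁ * (1 + X ^ p)) := by
    intro t ht
    have h1 := norm_le_of_holderBdd (η := flow hg he hr t ω η)
      (hap.histBdd hr (NNReal.coe_nonneg t) ht)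
    have h2 : (2 : ℝ) ≤ Real.exp 1 := by
      have := Real.add_one_le_exp (1 : ℝ); linarith
    have h3 : 0 ≤ ‖η‖ + D₁ * (1 + X ^ p) := by positivity
    calc ‖flow hg he hr t ω η‖ ≤ 2 * M := by linarith
      _ ≤ 2 * (G * (‖η‖ + D₁ * (1 + X ^ p))) := by linarith
      _ ≤ Real.exp 1 * (Real.exp (K * (1 + z ^ p)) * (‖η‖ + D₁ * (1 + X ^ p))) := by gcongr
      _ = _ := by rw [Real.exp_add]; ring
  clear_value G
  refine ⟨?_, fun t ht => (hgen t ht).trans ?_⟩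
  -- Weak noise: decay and noise leave 1/8 + 1/8 = 1/4 < exp(-1) of the initial norm. Strong noise:
  -- z^p ≥ δ^p, so C·z^p exceeds the exponent of the general growth bound by at least 1 and no
  -- contraction is needed.
  · rcases le_total z δ with h | h
    · have hGG : G ≤ G₁ := by
        refine hGK.trans ?_
        rw [hG₁]
        have : z ^ p ≤ 1 := Real.rpow_le_one hz0 (h.trans hδ1) hp0.le
        gcongr
        linarith
      have hN : ∀ s t, 0 ≤ s → s ≤ t → t ≤ T → ‖noiseIncr (drift hr A f) y s t‖ ≤
          (b * z * M + ‖g 0‖ * X) * (t - s) ^ (ν : ℝ) := fun s t h0 hst htT => by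
        rw [hb, hz]
        exact hgerm.norm_noiseIncr_le hg.lipF hg.lip he.pos (he.lt.le.trans he.le_one)
          (he.pos.trans he.lt) he.one_lt hr hT1 hX hω hθ le_rfl hM0 hap h0 hst htT
      have h1 := hdecay y T ‖η‖ (b * z * M + ‖g 0‖ * X) hT1 hTr (by positivity)
        (fun t h1 h2 => hB.1 t h1 h2) hN
      have h2 : ‖flow hg he hr T.toNNReal ω η‖ ≤ 2 * (C₃ * (Real.exp (-μ * T) * ‖η‖ +
          T * (b * z * M + ‖g 0‖ * X) + ‖f 0‖)) := by
        rw [two_mul]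
        refine norm_le_of_holderBdd ?_
        rw [flow_path, Real.coe_toNNReal T hTT]
        exact h1
      have h3 : 2 * C₃ * T * b * z * M ≤ 1 / 8 * (‖η‖ + D₁ * (1 + X ^ p)) := by
        calc 2 * C₃ * T * b * z * M ≤ 2 * C₃ * T * b * z * (G₁ * (‖η‖ + D₁ * (1 + X ^ p))) := by
              gcongr
              exact hMD.trans (by gcongr)
          _ = q * z * (‖η‖ + D₁ * (1 + X ^ p)) := by rw [hq]; ring
          _ ≤ q * δ * (‖η‖ + D₁ * (1 + X ^ p)) := by gcongr
          _ ≤ _ := by gcongr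
      have h4 := mul_le_mul_of_nonneg_right hTμ (norm_nonneg η)
      have h5 : 2 * C₃ * (T * (‖g 0‖ * X) + ‖f 0‖) ≤ D₂ * (1 + X ^ p) := by
        have h6 : T * (‖g 0‖ * X) + ‖f 0‖ ≤ (T * ‖g 0‖ + ‖f 0‖) * (1 + X ^ p) := by
          have h7 := mul_le_mul_of_nonneg_left hX1 (by positivity : 0 ≤ T * ‖g 0‖)
          have h8 : 0 ≤ ‖f 0‖ * X ^ p := by positivity
          linarith
        have := mul_le_mul_of_nonneg_left h6 (by positivity : 0 ≤ 2 * C₃)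
        rw [hD₂]
        linarith
      have h6 : ‖flow hg he hr T.toNNReal ω η‖ ≤ 1 / 4 * ‖η‖ + 2 * (D₁ + D₂) * (1 + X ^ p) := by
        have h7 : 0 ≤ D₁ * (1 + X ^ p) := by positivity
        have h8 : 0 ≤ D₂ * (1 + X ^ p) := by positivity
        linarith
      have hCz : 0 ≤ C * z ^ p := by positivity
      have h7 : (1 : ℝ) / 4 ≤ Real.exp (-1 + C * z ^ p) := by
        have h8 : Real.exp (-1) ≤ Real.exp (-1 + C * z ^ p) := Real.exp_le_exp.mpr (by linarith)
        refine le_trans ?_ h8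
        have := Real.exp_neg_one_gt_d9
        linarith
      have h8 : 1 ≤ Real.exp (C * z ^ p) := Real.one_le_exp hCz
      refine h6.trans (add_le_add (by gcongr) (le_mul_of_one_le_right (by positivity) h8))
    · have h1 : 1 ≤ (δ ^ p)⁻¹ * z ^ p := by
        rw [← div_eq_inv_mul, one_le_div (by positivity)]
        exact Real.rpow_le_rpow hδ0.le h hp0.le
      have h2 : 1 + K * (1 + z ^ p) ≤ -1 + C * z ^ p := by
        have h3 := mul_le_mul_of_nonneg_left h1 (by positivity : 0 ≤ 2 + K)
        rw [hC]
        linarith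
      refine (hgen _ (by rw [Real.coe_toNNReal T hTT])).trans ?_
      rw [mul_add]
      have h3 : Real.exp (1 + K * (1 + z ^ p)) ≤ Real.exp (-1 + C * z ^ p) :=
        Real.exp_le_exp.mpr h2
      have h4 : Real.exp (1 + K * (1 + z ^ p)) ≤ Real.exp (C * z ^ p) :=
        Real.exp_le_exp.mpr (by linarith)
      refine add_le_add (by gcongr) ?_
      rw [mul_comm]
      have h5 : D₁ * (1 + X ^ p) ≤ 2 * (D₁ + D₂) * (1 + X ^ p) := by
        gcongr
        linarith
      gcongr
  · have h1 : Real.exp (1 + K * (1 + z ^ p)) ≤ Real.exp (C * (1 + z ^ p)) := by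
      refine Real.exp_le_exp.mpr ?_
      rw [hC]
      have : 0 ≤ (2 + K) * (δ ^ p)⁻¹ * (1 + z ^ p) := by positivity
      linarith
    have h5 : D₁ * (1 + X ^ p) ≤ 2 * (D₁ + D₂) * (1 + X ^ p) := by
      gcongr
      linarith
    gcongr

end Block


/-! ### The maximal ergodic inequality -/

section Maximal

variable {Ω : Type*} {τ : Ω → Ω} {f F : Ω → ℝ}

/-- The maximum of `0` and the first `n` partial sums of `f` along the orbits of `τ`. -/
def maxPartialSum (τ : Ω → Ω) (f : Ω → ℝ) : ℕ → Ω → ℝ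
  | 0 => fun _ => 0
  | n + 1 => fun ω => max 0 (f ω + maxPartialSum τ f n (τ ω))

theorem maxPartialSum_succ (n : ℕ) (ω : Ω) :
    maxPartialSum τ f (n + 1) ω = max 0 (f ω + maxPartialSum τ f n (τ ω)) := rfl

theorem maxPartialSum_nonneg (n : ℕ) (ω : Ω) : 0 ≤ maxPartialSum τ f n ω := by
  cases n with
  | zero => exact le_rfl
  | succ n => exact le_max_left _ _

theorem maxPartialSum_le_succ (n : ℕ) (ω : Ω) :
    maxPartialSum τ f n ω ≤ maxPartialSum τ f (n + 1) ω := by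
  induction n generalizing ω with
  | zero => exact maxPartialSum_nonneg _ _
  | succ n ih =>
    rw [maxPartialSum_succ, maxPartialSum_succ (n + 1)]
    exact max_le_max le_rfl (add_le_add le_rfl (ih _))

theorem birkhoffSum_le_maxPartialSum (n : ℕ) (ω : Ω) :
    birkhoffSum τ f n ω ≤ maxPartialSum τ f n ω := by
  induction n generalizing ω with
  | zero => simp [maxPartialSum]
  | succ n ih =>
    rw [birkhoffSum_succ', maxPartialSum_succ]
    exact (add_le_add le_rfl (ih _)).trans (le_max_right _ _)

variable [MeasurableSpace Ω] {P : Measure Ω}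

theorem integrable_maxPartialSum (hτ : MeasurePreserving τ P P) (hf : Integrable f P) (n : ℕ) :
    Integrable (maxPartialSum τ f n) P := by
  induction n with
  | zero => exact integrable_zero _ _ _
  | succ n ih =>
    exact (integrable_zero _ _ _).sup
      (hf.add ((hτ.integrable_comp ih.aestronglyMeasurable).mpr ih))

theorem measurable_maxPartialSum (hτ : Measurable τ) (hf : Measurable f) (n : ℕ) :
    Measurable (maxPartialSum τ f n) := by
  induction n with
  | zero => exact measurable_const
  | succ n ih => exact measurable_const.max (hf.add (ih.comp hτ))

/-- Garsia's argument: with f = F - l and M_n the maximal partial sum, M_n - M_n∘τ ≤ F - l on {M_n >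
0} and ≤ 0 ≤ F elsewhere. Integrating, the left side vanishes by invariance, so l·P(M_n > 0) ≤ ∫F.
-/
theorem maximal_ergodic [IsProbabilityMeasure P] (hτ : MeasurePreserving τ P P)
    (hFm : Measurable F) (hF : Integrable F P) (hF0 : ∀ ω, 0 ≤ F ω) {l : ℝ} (hl : 0 < l) :
    P {ω | ∃ n : ℕ, l * n < birkhoffSum τ F n ω} ≤ ENNReal.ofReal ((∫ ω, F ω ∂P) / l) := by
  set f : Ω → ℝ := fun ω => F ω - l with hf
  have hfm : Measurable f := hFm.sub_const l
  have hfi : Integrable f P := hF.sub (integrable_const l)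
  set A : ℕ → Set Ω := fun n => {ω | 0 < maxPartialSum τ f n ω} with hA
  have hAm : ∀ n, MeasurableSet (A n) := fun n =>
    measurableSet_lt measurable_const (measurable_maxPartialSum hτ.measurable hfm n)
  have hmono : Monotone A := monotone_nat_of_le_succ fun n ω (h : 0 < maxPartialSum τ f n ω) =>
    h.trans_le (maxPartialSum_le_succ n ω)
  have hsub : {ω | ∃ n : ℕ, l * n < birkhoffSum τ F n ω} ⊆ ⋃ n, A n := by
    rintro ω ⟨n, hn⟩
    have e : ∀ (n : ℕ) (ω : Ω), birkhoffSum τ f n ω = birkhoffSum τ F n ω - l * n := by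
      intro n
      induction n with
      | zero => simp
      | succ n ih =>
        intro ω
        rw [birkhoffSum_succ', birkhoffSum_succ', ih]
        push_cast
        ring
    refine mem_iUnion.mpr ⟨n, ?_⟩
    have h := birkhoffSum_le_maxPartialSum (τ := τ) (f := f) n ω
    rw [e] at h
    exact lt_of_lt_of_le (by linarith) h
  refine (measure_mono hsub).trans ?_
  rw [hmono.measure_iUnion]
  refine iSup_le fun n => ?_
  have hint := integrable_maxPartialSum hτ hfi n
  have hpt : ∀ ω, maxPartialSum τ f n ω - maxPartialSum τ f n (τ ω) ≤
      F ω - (A n).indicator (fun _ => l) ω := by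
    intro ω
    by_cases h : ω ∈ A n
    · rw [indicator_of_mem h]
      have h' : 0 < maxPartialSum τ f n ω := h
      cases n with
      | zero => exact absurd h' (lt_irrefl _)
      | succ n =>
        have h1 := maxPartialSum_succ (τ := τ) (f := f) n ω
        have h2 := maxPartialSum_le_succ (τ := τ) (f := f) n (τ ω)
        rcases le_total (f ω + maxPartialSum τ f n (τ ω)) 0 with h3 | h3
        · rw [max_eq_left h3] at h1; linarith
        · rw [max_eq_right h3] at h1
          simp only [hf] at h1 ⊢
          linarith
    · rw [indicator_of_notMem h]
      have h1 : maxPartialSum τ f n ω ≤ 0 := not_lt.mp h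
      have h2 := maxPartialSum_nonneg (τ := τ) (f := f) n (τ ω)
      have h3 := hF0 ω
      linarith
  have hcomp : Integrable (fun ω => maxPartialSum τ f n (τ ω)) P :=
    (hτ.integrable_comp hint.aestronglyMeasurable).mpr hint
  have hind : Integrable ((A n).indicator fun _ => l) P := (integrable_const l).indicator (hAm n)
  have h := integral_mono (hint.sub hcomp) (hF.sub hind) hpt
  have hpres : ∫ ω, maxPartialSum τ f n (τ ω) ∂P = ∫ ω, maxPartialSum τ f n ω ∂P := by
    rw [← integral_map hτ.measurable.aemeasurable (by rw [hτ.map_eq]; exact hint.aestronglyMeasurable),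
      hτ.map_eq]
  simp only [Pi.sub_apply] at h
  rw [integral_sub hint hcomp, integral_sub hF hind, hpres, sub_self,
    integral_indicator_const l (hAm n), smul_eq_mul] at h
  rw [← ENNReal.ofReal_toReal (measure_ne_top P (A n))]
  refine ENNReal.ofReal_le_ofReal ?_
  rw [le_div_iff₀ hl]
  change (P (A n)).toReal * l ≤ _
  have : P.real (A n) = (P (A n)).toReal := rfl
  rw [this] at h
  linarith

end Maximal

/-! ### Hölder constants of the noise -/

namespace NoisePath

variable {ν : ℝ≥0} {m : ℕ} {r p : ℝ}

/-- The `ν`-Hölder seminorm of `ω` on `[u-r,u+r]`. -/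
@[irreducible] def holderSup (r u : ℝ) (ω : NoisePath ν m) : ℝ≥0∞ :=
  ⨆ q : ℚ × ℚ, if -r ≤ q.1 ∧ (q.1 : ℝ) < q.2 ∧ q.2 ≤ r then
    ENNReal.ofReal (‖ω.path (u + q.2) - ω.path (u + q.1)‖ / ((q.2 : ℝ) - q.1) ^ (ν : ℝ)) else 0

theorem holderSup_shift (u v : ℝ) (ω : NoisePath ν m) :
    holderSup r u (shift v ω) = holderSup r (v + u) ω := by
  unfold holderSup
  simp only [shift_path_apply, sub_sub_sub_cancel_right, add_assoc]

/-- The supremum in `holderSup` runs over countably many rational pairs, each term being continuous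
in u and measurable in ω. -/
theorem measurable_holderSup : Measurable fun q : ℝ × NoisePath ν m => holderSup r q.1 q.2 := by
  unfold holderSup
  refine Measurable.iSup fun q => ?_
  split_ifs
  · have h : ∀ c : ℝ, Measurable fun q : ℝ × NoisePath ν m => q.2.path (q.1 + c) := by
      intro c
      refine measurable_uncurry_of_continuous_of_measurable
        (u := fun (u : ℝ) (ω : NoisePath ν m) => ω.path (u + c)) (fun ω => by fun_prop) fun u => ?_
      exact (continuous_eval (u + c)).measurable
    exact (((h _).sub (h _)).norm.div_const _).ennreal_ofReal
  · exact measurable_const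

theorem holderSup_le {H u : ℝ} {ω : NoisePath ν m} (h : HolOn ν H (u - r) (u + r) ω.path) :
    holderSup r u ω ≤ ENNReal.ofReal H := by
  unfold holderSup
  refine iSup_le fun q => ?_
  split_ifs with hq
  · obtain ⟨h1, h2, h3⟩ := hq
    refine ENNReal.ofReal_le_ofReal ?_
    have h4 : 0 < ((q.2 : ℝ) - q.1) ^ (ν : ℝ) := Real.rpow_pos_of_pos (by linarith) _
    rw [div_le_iff₀ h4]
    have := h (u + q.1) (u + q.2) (by linarith) (by linarith) (by linarith)
    rwa [add_sub_add_left_eq_sub] at this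
  · exact zero_le

theorem holderSup_lt_top (r u : ℝ) (ω : NoisePath ν m) : holderSup r u ω < ⊤ :=
  (holderSup_le (ω.holOn (u - r) (u + r))).trans_lt ENNReal.ofReal_lt_top

/-- Nothing is lost with rational pairs: a strict violation of the Hölder bound at (s,t) persists
nearby by continuity, hence at a rational pair inside the window. -/
theorem holOn_holderSup (hν : 0 < ν) (u : ℝ) (ω : NoisePath ν m) :
    HolOn ν (holderSup r u ω).toReal (u - r) (u + r) ω.path := by
  have hν' : (0 : ℝ) < ν := hν
  intro s t hs hst ht
  rcases hst.eq_or_lt with rfl | hst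
  · simp [Real.zero_rpow hν'.ne']
  by_contra! hlt
  set H := (holderSup r u ω).toReal with hH
  have hev : ∀ᶠ z : ℝ × ℝ in 𝓝 (s, t),
      H * (z.2 - z.1) ^ (ν : ℝ) < ‖ω.path z.2 - ω.path z.1‖ := by
    refine ContinuousAt.eventually_lt ?_ ?_ hlt
    · have h1 : Continuous fun x : ℝ => x ^ (ν : ℝ) :=
        continuous_id.rpow_const fun _ => Or.inr hν'.le
      have : Continuous fun z : ℝ × ℝ => H * (z.2 - z.1) ^ (ν : ℝ) :=
        continuous_const.mul (h1.comp (continuous_snd.sub continuous_fst))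
      exact this.continuousAt
    · exact Continuous.continuousAt (by fun_prop)
  obtain ⟨δ, hδ, hball⟩ := Metric.eventually_nhds_iff.mp hev
  obtain ⟨a, ha1, ha2⟩ := exists_rat_btwn (lt_min (by linarith : s - u < s - u + δ)
    (by linarith : s - u < (s - u + (t - u)) / 2))
  obtain ⟨b, hb1, hb2⟩ := exists_rat_btwn (max_lt (by linarith : t - u - δ < t - u)
    (by linarith : (s - u + (t - u)) / 2 < t - u))
  have ha3 := ha2.trans_le (min_le_left _ _)
  have ha4 := ha2.trans_le (min_le_right _ _)
  have hb3 := (le_max_left _ _).trans_lt hb1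
  have hb4 := (le_max_right _ _).trans_lt hb1
  have h1 := hball (y := (u + a, u + b)) (by
    rw [Prod.dist_eq, max_lt_iff, Real.dist_eq, Real.dist_eq, abs_lt, abs_lt]
    refine ⟨⟨?_, ?_⟩, ?_, ?_⟩ <;> dsimp only <;> linarith)
  have hab : (a : ℝ) < b := by linarith
  have h2 : ENNReal.ofReal (‖ω.path (u + b) - ω.path (u + a)‖ / ((b : ℝ) - a) ^ (ν : ℝ)) ≤
      holderSup r u ω := by
    unfold holderSup
    refine le_trans (le_of_eq ?_) (le_iSup _ (a, b))
    rw [if_pos ⟨by dsimp only; linarith, hab, by dsimp only; linarith⟩]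
  have h3 := (ENNReal.ofReal_le_iff_le_toReal (holderSup_lt_top r u ω).ne).mp h2
  rw [div_le_iff₀ (Real.rpow_pos_of_pos (by linarith) _)] at h3
  dsimp only at h1
  rw [add_sub_add_left_eq_sub] at h1
  linarith

theorem holderSup_zero_le (ω : NoisePath ν m) :
    holderSup r 0 ω ≤ eHolderNorm ν ((Icc (-r) r).domRestrict ω.path) := by
  by_cases h : MemHolder ν ((Icc (-r) r).domRestrict ω.path)
  · rw [← h.coe_nnHolderNorm_eq_eHolderNorm, ← ENNReal.ofReal_coe_nnreal]
    refine holderSup_le fun s t hs hst ht => ?_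
    rw [zero_sub] at hs
    rw [zero_add] at ht
    exact holderWith_iff_norm.mp h.holderWith ⟨s, hs, hst.trans ht⟩ ⟨t, hs.trans hst, ht⟩ hst
  · rw [eHolderNorm_eq_top.mpr h]
    exact le_top

/-- The integral over `(a,b]` of the `p`-th power of the local Hölder constant. -/
def roughness (r p a b : ℝ) (ω : NoisePath ν m) : ℝ≥0∞ :=
  ∫⁻ u in Ioc a b, holderSup r u ω ^ p

theorem measurable_holderSup_rpow :
    Measurable fun q : ℝ × NoisePath ν m => holderSup r q.1 q.2 ^ p :=
  measurable_holderSup.pow_const p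

theorem measurable_roughness (a b : ℝ) : Measurable (roughness (ν := ν) (m := m) r p a b) :=
  Measurable.lintegral_prod_left' (f := fun q : ℝ × NoisePath ν m => holderSup r q.1 q.2 ^ p)
    measurable_holderSup_rpow

/-- Hölder constants of blocks are not additive; their time integrals are. With `roughness_shift`
this turns sums over blocks into ergodic sums and makes growth conditions invariant under every real
shift. -/
theorem roughness_add {a b c : ℝ} (hab : a ≤ b) (hbc : b ≤ c) (ω : NoisePath ν m) :
    roughness r p a b ω + roughness r p b c ω = roughness r p a c ω := by
  unfold roughness
  rw [← lintegral_union measurableSet_Ioc (Ioc_disjoint_Ioc_of_le le_rfl),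
    Ioc_union_Ioc_eq_Ioc hab hbc]

theorem roughness_mono {a b a' b' : ℝ} (ha : a' ≤ a) (hb : b ≤ b') (ω : NoisePath ν m) :
    roughness r p a b ω ≤ roughness r p a' b' ω :=
  lintegral_mono_set (Ioc_subset_Ioc ha hb)

theorem roughness_shift (a b v : ℝ) (ω : NoisePath ν m) :
    roughness r p a b (shift v ω) = roughness r p (v + a) (v + b) ω := by
  unfold roughness
  simp only [holderSup_shift]
  have hm : Measurable fun u => holderSup r u ω ^ p :=
    measurable_holderSup_rpow.comp (measurable_prodMk_right (y := ω))
  have h := (measurePreserving_add_left (volume : Measure ℝ) v).setLIntegral_comp_preimage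
    (s := Ioc (v + a) (v + b)) measurableSet_Ioc hm
  have e : (fun u => v + u) ⁻¹' Ioc (v + a) (v + b) = Ioc a b := by
    ext u
    simp only [mem_preimage, mem_Ioc, add_lt_add_iff_left, add_le_add_iff_left]
  rwa [e] at h

theorem roughness_lt_top (hp : 0 ≤ p) (a b : ℝ) (ω : NoisePath ν m) :
    roughness r p a b ω < ⊤ := by
  refine setLIntegral_lt_top_of_le_nnreal (by simp)
    ⟨Real.toNNReal ‖restr (a - r) (b + r) ω‖ ^ p, fun u hu => ?_⟩
  rw [ENNReal.coe_rpow_of_nonneg _ hp]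
  refine ENNReal.rpow_le_rpow (holderSup_le ?_) hp
  exact (ω.holOn (a - r) (b + r)).mono le_rfl (by linarith [hu.1]) (by linarith [hu.2])

/-- Tonelli and invariance of the law: the mean is proportional to the length of the interval, with
the moment at time 0 as density. -/
theorem lintegral_roughness {P : Measure (NoisePath ν m)} [IsProbabilityMeasure P]
    (hP : IsErgodicFlow (NoisePath.shift (ν := ν) (m := m)) P) (a b : ℝ) :
    ∫⁻ ω, roughness r p a b ω ∂P =
      ENNReal.ofReal (b - a) * ∫⁻ ω, holderSup r 0 ω ^ p ∂P := by
  unfold roughness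
  have hm : Measurable (Function.uncurry fun (ω : NoisePath ν m) (u : ℝ) =>
      holderSup r u ω ^ p) := measurable_holderSup_rpow.comp measurable_swap
  rw [lintegral_lintegral_swap hm.aemeasurable]
  have h : ∀ u : ℝ, ∫⁻ ω, holderSup r u ω ^ p ∂P = ∫⁻ ω, holderSup r 0 ω ^ p ∂P := by
    intro u
    rw [← (hP.measurePreserving u).lintegral_comp
      (f := fun ω => holderSup r 0 ω ^ p) (measurable_holderSup_rpow.comp measurable_prodMk_left)]
    simp only [holderSup_shift, add_zero]
  simp only [h, lintegral_const, Measure.restrict_apply MeasurableSet.univ, univ_inter,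
    Real.volume_Ioc]
  rw [mul_comm]

end NoisePath


/-! ### Noise paths of linearly growing roughness -/

namespace NoisePath

variable {ν : ℝ≥0} {m : ℕ} {r p T c : ℝ}

theorem holOn_of_shift {H a b t : ℝ} {ω : NoisePath ν m} (h : HolOn ν H a b (shift t ω).path) :
    HolOn ν H (t + a) (t + b) ω.path := by
  intro s u hs hsu hu
  have := h (s - t) (u - t) (by linarith) (by linarith) (by linarith)
  simpa only [shift_path_apply, add_sub_cancel, sub_sub_sub_cancel_right] using this

theorem holOn_shift {H a b t : ℝ} {ω : NoisePath ν m} (h : HolOn ν H (t + a) (t + b) ω.path) :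
    HolOn ν H a b (shift t ω).path := by
  intro s u hs hsu hu
  have := h (t + s) (t + u) (by linarith) (by linarith) (by linarith)
  simpa only [shift_path_apply, sub_sub_sub_cancel_right, add_sub_add_left_eq_sub] using this

theorem shift_iterate (t : ℝ) (n : ℕ) (ω : NoisePath ν m) :
    (shift t)^[n] ω = shift (n * t) ω := by
  induction n with
  | zero => simp [shift_zero]
  | succ n ih =>
    rw [Function.iterate_succ_apply', ih, shift_shift]
    congr 1
    push_cast
    ring

/-- The Hölder constant on a block is controlled by the roughness of the block. -/
theorem exists_holOn_le_roughness (hν : 0 < ν) (hr : 0 < r) (hT : 0 < T) (hp : 0 < p) :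
    ∃ c, 0 ≤ c ∧ ∀ ω : NoisePath ν m, ∃ X, 0 ≤ X ∧ HolOn ν X (-T) 0 ω.path ∧
      X ^ p ≤ c * (roughness r p (-T) 0 ω).toReal := by
  have hν' : (0 : ℝ) < ν := hν
  -- Cut the block into N cells of length l ≤ r, so that for any u in a cell the window [u-r,u+r]
  -- covers the cell.
  obtain ⟨N, hN⟩ := exists_nat_gt (T / r)
  have hN0 : (0 : ℝ) < N := (div_pos hT hr).trans hN
  set l := T / N with hl
  have hl0 : 0 < l := by positivity
  have hlr : l ≤ r := by
    rw [hl, div_le_iff₀ hN0]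
    rw [div_lt_iff₀ hr] at hN
    linarith
  have hlN : (N : ℝ) * l = T := by rw [hl]; field_simp
  refine ⟨(N : ℝ) ^ p / l, by positivity, fun ω => ?_⟩
  set R := roughness r p (-T) 0 ω with hR
  have hRt : R < ⊤ := roughness_lt_top hp.le _ _ ω
  set ξ := (R.toReal / l) ^ (1 / p) with hξ
  have hR0 : 0 ≤ R.toReal := ENNReal.toReal_nonneg
  have hξ0 : 0 ≤ ξ := by positivity
  have hpiece : ∀ i : ℕ, i < N → HolOn ν ξ (-((i + 1 : ℝ) * l)) (-(i * l)) ω.path := by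
    intro i hi
    have hi' : (i : ℝ) + 1 ≤ N := by exact_mod_cast hi
    have hvol : volume (Ioc (-((i + 1 : ℝ) * l)) (-(i * l))) = ENNReal.ofReal l := by
      rw [Real.volume_Ioc]
      congr 1
      ring
    -- Some u in the cell has a local constant whose p-th power is at most the average over the
    -- cell.
    obtain ⟨u, hu, hule⟩ := exists_le_setLAverage (μ := volume)
      (s := Ioc (-((i + 1 : ℝ) * l)) (-(i * l))) (f := fun u => holderSup r u ω ^ p)
      (by rw [hvol]; simpa using hl0) (by rw [hvol]; exact ENNReal.ofReal_ne_top)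
      (measurable_holderSup_rpow.comp (measurable_prodMk_right (y := ω))).aemeasurable
    have hle : roughness r p (-((i + 1 : ℝ) * l)) (-(i * l)) ω ≤ R := by
      refine roughness_mono ?_ ?_ ω
      · nlinarith
      · have : 0 ≤ (i : ℝ) * l := by positivity
        linarith
    have h1 : holderSup r u ω ^ p ≤ R / ENNReal.ofReal l := by
      refine hule.trans ?_
      rw [setLAverage_eq, hvol]
      exact ENNReal.div_le_div_right hle _
    have h2 : (holderSup r u ω).toReal ≤ ξ := by
      have h3 := ENNReal.toReal_mono (ENNReal.div_lt_top hRt.ne (by simpa using hl0)).ne h1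
      rw [← ENNReal.toReal_rpow, ENNReal.toReal_div, ENNReal.toReal_ofReal hl0.le] at h3
      rw [hξ, one_div, Real.le_rpow_inv_iff_of_pos ENNReal.toReal_nonneg (by positivity) hp]
      exact h3
    refine (holOn_holderSup hν u ω).mono h2 ?_ ?_
    · linarith [hu.2]
    · linarith [hu.1]
  have hconcat : ∀ n : ℕ, n ≤ N → HolOn ν (n * ξ) (-(n * l)) 0 ω.path := by
    intro n
    induction n with
    | zero =>
      intro _ s t hs hst ht
      simp only [CharP.cast_eq_zero, zero_mul, neg_zero] at hs
      have : s = t := by linarith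
      rw [this]
      simp
    | succ n ih =>
      intro hn
      have h1 := hpiece n hn
      have h2 := HolOn.concat hν' hξ0 (by positivity) h1 (ih (by omega))
      push_cast
      exact h2.mono (by linarith) le_rfl le_rfl
  refine ⟨N * ξ, by positivity, ?_, ?_⟩
  · have := hconcat N le_rfl
    rwa [hlN] at this
  · rw [Real.mul_rpow hN0.le hξ0, hξ, ← Real.rpow_mul (by positivity), one_div,
      inv_mul_cancel₀ hp.ne', Real.rpow_one]
    exact le_of_eq (by ring)

/-- The noise paths whose roughness on `[-nT,0]` is at most `c (n + N)` for some `N`. -/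
def tameSet (ν : ℝ≥0) (m : ℕ) (r p T c : ℝ) : Set (NoisePath ν m) :=
  {ω | ∃ N : ℕ, ∀ n : ℕ, roughness r p (-(n * T)) 0 ω ≤ ENNReal.ofReal (c * (n + N))}

theorem measurableSet_tameSet : MeasurableSet (tameSet ν m r p T c) := by
  have e : tameSet ν m r p T c = ⋃ N : ℕ, ⋂ n : ℕ,
      {ω | roughness r p (-(n * T)) 0 ω ≤ ENNReal.ofReal (c * (n + N))} := by
    ext ω
    simp [tameSet]
  rw [e]
  exact MeasurableSet.iUnion fun N => MeasurableSet.iInter fun n =>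
    measurableSet_le (measurable_roughness _ _) measurable_const

/-- A shift by u adds at most k blocks on one side and a finite roughness on the other; both are
absorbed by enlarging N. This is why the definition has a free N. -/
theorem shift_mem_tameSet (hp : 0 ≤ p) (hT : 0 < T) (hc : 0 < c) {ω : NoisePath ν m}
    (h : ω ∈ tameSet ν m r p T c) (u : ℝ) : shift u ω ∈ tameSet ν m r p T c := by
  obtain ⟨N, hN⟩ := h
  obtain ⟨k, hk⟩ := exists_nat_gt (|u| / T)
  rw [div_lt_iff₀ hT] at hk
  have hlt := roughness_lt_top (r := r) hp 0 |u| ω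
  obtain ⟨N', hN'⟩ := exists_nat_gt ((roughness r p 0 |u| ω).toReal / c)
  rw [div_lt_iff₀ hc] at hN'
  have hu := abs_le.mp (le_refl |u|)
  refine ⟨k + N + N', fun n => ?_⟩
  rw [roughness_shift, add_zero]
  have hnk : 0 ≤ ((n + k : ℕ) : ℝ) * T := by positivity
  calc roughness r p (u + -(n * T)) u ω ≤ roughness r p (-((n + k : ℕ) * T)) |u| ω := by
        refine roughness_mono ?_ hu.2 ω
        push_cast
        nlinarith [hu.1]
    _ = roughness r p (-((n + k : ℕ) * T)) 0 ω + roughness r p 0 |u| ω :=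
        (roughness_add (by linarith) (abs_nonneg u) ω).symm
    _ ≤ ENNReal.ofReal (c * ((n + k : ℕ) + N)) + ENNReal.ofReal (N' * c) := by
        refine add_le_add (hN _) ?_
        rw [← ENNReal.ofReal_toReal hlt.ne]
        exact ENNReal.ofReal_le_ofReal hN'.le
    _ = ENNReal.ofReal (c * (n + (k + N + N' : ℕ))) := by
        rw [← ENNReal.ofReal_add (by positivity) (by positivity)]
        congr 1
        push_cast
        ring

theorem shift_preimage_tameSet (hp : 0 ≤ p) (hT : 0 < T) (hc : 0 < c) (u : ℝ) :
    shift u ⁻¹' tameSet ν m r p T c = tameSet ν m r p T c := by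
  ext ω
  refine ⟨fun h => ?_, fun h => shift_mem_tameSet hp hT hc h u⟩
  have := shift_mem_tameSet hp hT hc h (-u)
  rwa [shift_shift, neg_add_cancel, shift_zero] at this

theorem sum_roughness (hp : 0 ≤ p) (hT : 0 ≤ T) (ω : NoisePath ν m) (n : ℕ) :
    ∑ j ∈ Finset.range n, (roughness r p (-T) 0 (shift (-(j * T)) ω)).toReal =
      (roughness r p (-(n * T)) 0 ω).toReal := by
  induction n with
  | zero => simp [roughness]
  | succ n ih =>
    have h1 : 0 ≤ (n : ℝ) * T := by positivity
    rw [Finset.sum_range_succ, ih, roughness_shift, add_zero,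
      ← ENNReal.toReal_add (roughness_lt_top hp _ _ ω).ne (roughness_lt_top hp _ _ ω).ne, add_comm,
      roughness_add (by linarith) (by linarith)]
    congr 2
    push_cast
    ring

/-- The shift by T alone need not be ergodic, so averages are not computed. The maximal inequality
gives the set positive probability, and its invariance under all real shifts then forces probability
1. -/
theorem exists_measure_tameSet {P : Measure (NoisePath ν m)} [IsProbabilityMeasure P]
    (hP : IsErgodicFlow (NoisePath.shift (ν := ν) (m := m)) P) (hT : 0 < T) (hp : 0 < p)
    (hΓ : ∫⁻ ω : NoisePath ν m,
      (eHolderNorm ν ((Icc (-r) r).domRestrict ω.path)) ^ p ∂P < ⊤) :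
    ∃ c, 0 < c ∧ P (tameSet ν m r p T c) = 1 := by
  set F : NoisePath ν m → ℝ := fun ω => (roughness r p (-T) 0 ω).toReal with hF
  have hFm : Measurable F := (measurable_roughness _ _).ennreal_toReal
  have hfin : ∫⁻ ω, roughness r p (-T) 0 ω ∂P < ⊤ := by
    rw [lintegral_roughness hP]
    refine ENNReal.mul_lt_top ENNReal.ofReal_lt_top (lt_of_le_of_lt ?_ hΓ)
    exact lintegral_mono fun ω => ENNReal.rpow_le_rpow (holderSup_zero_le ω) hp.le
  have hFi : Integrable F P :=
    integrable_toReal_of_lintegral_ne_top (measurable_roughness _ _).aemeasurable hfin.ne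
  have hF0 : ∀ ω, 0 ≤ F ω := fun ω => ENNReal.toReal_nonneg
  set I := ∫ ω, F ω ∂P with hI
  have hI0 : 0 ≤ I := integral_nonneg hF0
  -- Level I + 1 makes the exceptional probability at most I/(I+1) < 1.
  refine ⟨I + 1, by linarith, ?_⟩
  have hmax := maximal_ergodic (hP.measurePreserving (-T)) hFm hFi hF0
    (by linarith : 0 < I + 1)
  have hsub : (tameSet ν m r p T (I + 1))ᶜ ⊆
      {ω | ∃ n : ℕ, (I + 1) * n < birkhoffSum (shift (-T)) F n ω} := by
    intro ω hω
    by_contra hn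
    refine hω ⟨0, fun n => ?_⟩
    have h1 : birkhoffSum (shift (-T)) F n ω ≤ (I + 1) * n := by
      by_contra! h
      exact hn ⟨n, h⟩
    have h2 : birkhoffSum (shift (-T)) F n ω = (roughness r p (-(n * T)) 0 ω).toReal := by
      rw [← sum_roughness hp.le hT.le]
      simp only [birkhoffSum, shift_iterate, hF, mul_neg]
    rw [h2] at h1
    rw [← ENNReal.ofReal_toReal (roughness_lt_top hp.le _ _ ω).ne]
    refine ENNReal.ofReal_le_ofReal ?_
    simpa using h1
  have hlt : P (tameSet ν m r p T (I + 1))ᶜ < 1 := by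
    refine ((measure_mono hsub).trans hmax).trans_lt ?_
    rw [ENNReal.ofReal_lt_one, div_lt_one (by linarith)]
    linarith
  rcases hP.ergodic _ measurableSet_tameSet
    (shift_preimage_tameSet hp.le hT (by linarith : 0 < I + 1)) with h | h
  · rw [prob_compl_eq_one_sub measurableSet_tameSet, h, tsub_zero] at hlt
    exact absurd hlt (lt_irrefl _)
  · exact h

/-- Almost surely, the `p`-th powers of the Hölder constants on the blocks `[-(j+1)T,-jT]` have
bounded averages; the exceptional set is invariant under the shift. -/
theorem exists_tame {P : Measure (NoisePath ν m)} [IsProbabilityMeasure P]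
    (hP : IsErgodicFlow (NoisePath.shift (ν := ν) (m := m)) P) (hν : 0 < ν) (hr : 0 < r)
    (hT : 0 < T) (hp : 0 < p)
    (hΓ : ∫⁻ ω : NoisePath ν m,
      (eHolderNorm ν ((Icc (-r) r).domRestrict ω.path)) ^ p ∂P < ⊤) :
    ∃ c, 0 < c ∧ ∃ Ω₀ : Set (NoisePath ν m), MeasurableSet Ω₀ ∧ P Ω₀ = 1 ∧
      (∀ ω ∈ Ω₀, ∀ t, shift t ω ∈ Ω₀) ∧ ∀ ω ∈ Ω₀, ∃ X : ℕ → ℝ, ∃ N : ℕ,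
        (∀ j : ℕ, 0 ≤ X j ∧ HolOn ν (X j) (-((j + 1 : ℝ) * T)) (-(j * T)) ω.path) ∧
        ∀ n : ℕ, ∑ j ∈ Finset.range n, X j ^ p ≤ c * (n + N) := by
  obtain ⟨c, hc, hPc⟩ := exists_measure_tameSet hP hT hp hΓ
  obtain ⟨c', hc', hX⟩ := exists_holOn_le_roughness (m := m) hν hr hT hp
  refine ⟨(c' + 1) * c, by positivity, tameSet ν m r p T c, measurableSet_tameSet, hPc,
    fun ω hω t => shift_mem_tameSet hp.le hT hc hω t, fun ω hω => ?_⟩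
  obtain ⟨N, hN⟩ := hω
  choose X hX0 hX1 hX2 using fun j : ℕ => hX (shift (-(j * T)) ω)
  refine ⟨X, N, fun j => ⟨hX0 j, ?_⟩, fun n => ?_⟩
  · have h := holOn_of_shift (hX1 j)
    rw [add_zero] at h
    exact h.mono le_rfl (by linarith) le_rfl
  · have h1 : ∑ j ∈ Finset.range n, X j ^ p ≤
        ∑ j ∈ Finset.range n, c' * (roughness r p (-T) 0 (shift (-(j * T)) ω)).toReal :=
      Finset.sum_le_sum fun j _ => hX2 j
    rw [← Finset.mul_sum, sum_roughness hp.le hT.le] at h1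
    have h2 := ENNReal.toReal_mono ENNReal.ofReal_ne_top (hN n)
    rw [ENNReal.toReal_ofReal (by positivity)] at h2
    have h3 := mul_le_mul_of_nonneg_left h2 hc'
    have h4 : 0 ≤ c * ((n : ℝ) + N) := by positivity
    linarith

end NoisePath


/-! ### Pullback attractors of cocycles with subexponential absorption -/

section Attractor

variable {Ω S : Type*} [NormedAddCommGroup S] {θ : ℝ → Ω → Ω} {φ : ℝ≥0 → Ω → S → S} {γ γ' δ : ℝ}

/-- Limits of the pulled back system, from initial values that grow at most with rate `γ`. -/
def pullbackLimit (θ : ℝ → Ω → Ω) (φ : ℝ≥0 → Ω → S → S) (γ : ℝ) (ω : Ω) : Set S :=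
  {z | ∀ ε > 0, ∀ t₀ : ℝ≥0, ∃ t, t₀ ≤ t ∧ ∃ x, ‖x‖ ≤ Real.exp (γ * t) ∧
    dist (φ t (θ (-t) ω) x) z < ε}

theorem pullbackLimit_mono (h : γ ≤ γ') (ω : Ω) :
    pullbackLimit θ φ γ ω ⊆ pullbackLimit θ φ γ' ω := by
  intro z hz ε hε t₀
  obtain ⟨t, ht, x, hx, hd⟩ := hz ε hε t₀
  exact ⟨t, ht, x, hx.trans (Real.exp_le_exp.mpr (by gcongr)), hd⟩

theorem mem_pullbackLimit_of_tendsto {ω : Ω} {t : ℕ → ℝ≥0} {x : ℕ → S} {z : S}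
    (ht : Tendsto t atTop atTop) (hx : ∀ j, ‖x j‖ ≤ Real.exp (γ * t j))
    (hz : Tendsto (fun j => φ (t j) (θ (-(t j)) ω) (x j)) atTop (𝓝 z)) :
    z ∈ pullbackLimit θ φ γ ω := by
  intro ε hε t₀
  obtain ⟨j, h1, h2⟩ := ((ht.eventually_ge_atTop t₀).and
    (hz.eventually (Metric.ball_mem_nhds z hε))).exists
  exact ⟨t j, h1, x j, hx j, h2⟩

theorem exists_tendsto_of_mem_pullbackLimit {ω : Ω} {z : S} (h : z ∈ pullbackLimit θ φ γ ω) :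
    ∃ (t : ℕ → ℝ≥0) (x : ℕ → S), Tendsto t atTop atTop ∧ (∀ j, ‖x j‖ ≤ Real.exp (γ * t j)) ∧
      Tendsto (fun j => φ (t j) (θ (-(t j)) ω) (x j)) atTop (𝓝 z) := by
  choose t ht x hx hd using fun j : ℕ => h (1 / ((j : ℝ) + 1)) (by positivity) j
  refine ⟨t, x, tendsto_atTop_mono ht tendsto_natCast_atTop_atTop, hx, ?_⟩
  rw [tendsto_iff_dist_tendsto_zero]
  exact squeeze_zero (fun _ => dist_nonneg) (fun j => (hd j).le)
    tendsto_one_div_add_atTop_nhds_zero_nat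

theorem isClosed_pullbackLimit (ω : Ω) : IsClosed (pullbackLimit θ φ γ ω) := by
  refine isClosed_of_closure_subset fun z hz ε hε t₀ => ?_
  obtain ⟨w, hw, hzw⟩ := Metric.mem_closure_iff.mp hz (ε / 2) (half_pos hε)
  obtain ⟨t, ht, x, hx, hd⟩ := hw (ε / 2) (half_pos hε) t₀
  refine ⟨t, ht, x, hx, ?_⟩
  rw [dist_comm] at hzw
  linarith [dist_triangle (φ t (θ (-t) ω) x) w z]

/-- Initial values of growth rate `γ` are eventually mapped into a compact set. -/
def Captures (θ : ℝ → Ω → Ω) (φ : ℝ≥0 → Ω → S → S) (γ : ℝ) (ω : Ω) : Prop :=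
  ∃ K : Set S, IsCompact K ∧ ∀ᶠ t : ℝ≥0 in atTop, ∀ x, ‖x‖ ≤ Real.exp (γ * t) →
    φ t (θ (-t) ω) x ∈ K

theorem Captures.exists_tendsto {ω : Ω} (h : Captures θ φ γ ω) {t : ℕ → ℝ≥0} {x : ℕ → S}
    (ht : Tendsto t atTop atTop) (hx : ∀ j, ‖x j‖ ≤ Real.exp (γ * t j)) :
    ∃ z ∈ pullbackLimit θ φ γ ω, ∃ ψ : ℕ → ℕ, StrictMono ψ ∧
      Tendsto (fun j => φ (t (ψ j)) (θ (-(t (ψ j))) ω) (x (ψ j))) atTop (𝓝 z) := by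
  obtain ⟨K, hK, hev⟩ := h
  have h1 : ∀ᶠ j in atTop, φ (t j) (θ (-(t j)) ω) (x j) ∈ K :=
    (ht.eventually hev).mono fun j hj => hj _ (hx j)
  obtain ⟨z, -, ψ, hψ, hz⟩ := hK.tendsto_subseq' h1.frequently
  exact ⟨z, mem_pullbackLimit_of_tendsto (ht.comp hψ.tendsto_atTop) (fun j => hx (ψ j)) hz,
    ψ, hψ, hz⟩

theorem Captures.isCompact {ω : Ω} (h : Captures θ φ γ ω) : IsCompact (pullbackLimit θ φ γ ω) := by
  obtain ⟨K, hK, hev⟩ := h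
  refine hK.of_isClosed_subset (isClosed_pullbackLimit ω) fun z hz => ?_
  obtain ⟨t, x, ht, hx, hz⟩ := exists_tendsto_of_mem_pullbackLimit hz
  exact hK.isClosed.mem_of_tendsto hz ((ht.eventually hev).mono fun j hj => hj _ (hx j))

theorem Captures.nonempty {ω : Ω} (h : Captures θ φ γ ω) : (pullbackLimit θ φ γ ω).Nonempty := by
  obtain ⟨z, hz, -⟩ := h.exists_tendsto (t := fun j => (j : ℝ≥0)) (x := fun _ => 0)
    tendsto_natCast_atTop_atTop fun j => by rw [norm_zero]; positivity
  exact ⟨z, hz⟩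

theorem Captures.attracts {ω : Ω} (h : Captures θ φ γ ω) {ε : ℝ} (hε : 0 < ε) :
    ∀ᶠ t : ℝ≥0 in atTop, ∀ x, ‖x‖ ≤ Real.exp (γ * t) →
      ∃ z ∈ pullbackLimit θ φ γ ω, dist (φ t (θ (-t) ω) x) z < ε := by
  by_contra hcon
  rw [not_eventually, frequently_atTop] at hcon
  choose t ht hx using fun j : ℕ => hcon j
  push Not at hx
  choose x hx hd using hx
  obtain ⟨z, hz, ψ, hψ, hlim⟩ := h.exists_tendsto
    (tendsto_atTop_mono ht tendsto_natCast_atTop_atTop) hx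
  obtain ⟨j, hj⟩ := (hlim.eventually (Metric.ball_mem_nhds z hε)).exists
  exact absurd hj (not_lt.mpr (hd (ψ j) z hz))

theorem Captures.mono {ω : Ω} (h : Captures θ φ γ' ω) (hγ : γ ≤ γ') : Captures θ φ γ ω := by
  obtain ⟨K, hK, hev⟩ := h
  exact ⟨K, hK, hev.mono fun t ht x hx => ht x (hx.trans (Real.exp_le_exp.mpr (by gcongr)))⟩

/-- The pull-backs at the times `kτ`, `k ≥ n`, of the points of a sequence. -/
def pullbackPoints (θ : ℝ → Ω → Ω) (φ : ℝ≥0 → Ω → S → S) (D : ℕ → S) (δ : ℝ) (τ : ℝ≥0) (n : ℕ)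
    (ω : Ω) : Set S :=
  {z | ∃ k i : ℕ, (n ≤ k ∧ ‖D i‖ < Real.exp (δ * (k * τ : ℝ≥0))) ∧
    φ (k * τ) (θ (-(k * τ : ℝ≥0)) ω) (D i) = z}

/-- After the time lag `kτ`, for large `k`, initial values of growth rate `3δ` are absorbed by the
ball of radius `exp(δ k τ)`. -/
def Absorbs (θ : ℝ → Ω → Ω) (φ : ℝ≥0 → Ω → S → S) (δ : ℝ) (τ : ℝ≥0) (ω : Ω) : Prop :=
  ∀ᶠ k : ℕ in atTop, ∀ᶠ t : ℝ≥0 in atTop, ∀ x, ‖x‖ ≤ Real.exp (3 * δ * t) →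
    ‖φ t (θ (-(t + (k * τ : ℝ≥0))) ω) x‖ < Real.exp (δ * (k * τ : ℝ≥0))

/-! ### Reduction to countably many initial values and discrete times. -/

section Density

variable {D : ℕ → S} {τ : ℝ≥0}

theorem mem_pullbackLimit_of_mem_closure (hτ : 0 < τ) {ω : Ω} {z : S}
    (h : ∀ n, z ∈ closure (pullbackPoints θ φ D δ τ n ω)) : z ∈ pullbackLimit θ φ δ ω := by
  intro ε hε t₀
  obtain ⟨n, hn⟩ := exists_nat_ge (t₀ / τ)
  obtain ⟨_, ⟨k, i, ⟨hk, hi⟩, rfl⟩, hd⟩ := Metric.mem_closure_iff.mp (h n) ε hε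
  refine ⟨k * τ, ?_, D i, hi.le, by rwa [dist_comm] at hd⟩
  rw [div_le_iff₀ hτ] at hn
  refine hn.trans ?_
  gcongr

theorem infEDist_pullbackPoints (n : ℕ) (ω : Ω) (η : S) :
    Metric.infEDist η (pullbackPoints θ φ D δ τ n ω) =
      ⨅ q : ℕ × ℕ, ⨅ _ : n ≤ q.1 ∧ ‖D q.2‖ < Real.exp (δ * (q.1 * τ : ℝ≥0)),
        edist η (φ (q.1 * τ) (θ (-(q.1 * τ : ℝ≥0)) ω) (D q.2)) := by
  refine le_antisymm (le_iInf₂ fun q hq => Metric.infEDist_le_edist_of_mem ⟨q.1, q.2, hq, rfl⟩) ?_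
  refine Metric.le_infEDist.mpr ?_
  rintro _ ⟨k, i, hki, rfl⟩
  exact iInf₂_le (k, i) hki

variable [MeasurableSpace Ω] [MeasurableSpace S]

/-- Split the pullback time as t = u + kτ. Absorption puts the state after time u into the ball of
radius exp(δkτ), where it can be replaced by a point of the dense sequence, using continuity of the
remaining flow of fixed length kτ. -/
theorem pullbackLimit_subset_closure (hφ : IsContinuousRDS θ φ)
    (hθ : ∀ s t ω, θ s (θ t ω) = θ (s + t) ω) (hδ : 0 < δ) (hD : DenseRange D) {ω : Ω}
    (h : Absorbs θ φ δ τ ω) (n : ℕ) :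
    pullbackLimit θ φ (2 * δ) ω ⊆ closure (pullbackPoints θ φ D δ τ n ω) := by
  intro z hz
  rw [Metric.mem_closure_iff]
  intro ε hε
  obtain ⟨k, hk, hnk⟩ := (h.and (eventually_ge_atTop n)).exists
  obtain ⟨t₁, ht₁⟩ := eventually_atTop.mp hk
  set s : ℝ≥0 := k * τ with hs
  -- The margin 3s gives u ≥ 2s, hence 2δt = 2δ(s + u) ≤ 3δu: rate 2δ over t is rate 3δ over u.
  obtain ⟨t, ht, x, hx, hd⟩ := hz (ε / 2) (half_pos hε) (t₁ + 3 * s)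
  have hst : s ≤ t := le_trans (by
    have : s ≤ 3 * s := le_mul_of_one_le_left (zero_le) (by norm_num)
    exact this.trans le_add_self) ht
  set u := t - s with hu
  have htu : t = s + u := (add_tsub_cancel_of_le hst).symm
  have hu2 : t₁ + 2 * s ≤ u := by
    have h1 : t₁ + 3 * s = (t₁ + 2 * s) + s := by ring
    rw [h1] at ht
    exact le_tsub_of_add_le_right ht
  have hxu : ‖x‖ ≤ Real.exp (3 * δ * u) := by
    refine hx.trans (Real.exp_le_exp.mpr ?_)
    have h1 : (2 : ℝ) * s ≤ u := by exact_mod_cast le_add_self.trans hu2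
    rw [htu, NNReal.coe_add]
    nlinarith
  have hw := ht₁ u (le_self_add.trans hu2) x hxu
  have e1 : θ (-((u : ℝ) + (s : ℝ≥0))) ω = θ (-t) ω := by
    congr 1; rw [htu, NNReal.coe_add]; ring
  rw [e1] at hw
  set w := φ u (θ (-t) ω) x with hwdef
  have e2 : θ u (θ (-t) ω) = θ (-s) ω := by
    rw [hθ]; congr 1; rw [htu, NNReal.coe_add]; ring
  have e3 : φ t (θ (-t) ω) x = φ s (θ (-s) ω) w := by
    conv_lhs => rw [htu]
    rw [hφ.cocycle, ← htu, e2]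
  have hc : Continuous (φ s (θ (-s) ω)) := (hφ.continuous _).comp (Continuous.prodMk_right s)
  obtain ⟨η, hη, hcont⟩ := Metric.continuous_iff.mp hc w (ε / 2) (half_pos hε)
  have hopen : IsOpen (Metric.ball w η ∩ {v | ‖v‖ < Real.exp (δ * s)}) :=
    Metric.isOpen_ball.inter (isOpen_lt continuous_norm continuous_const)
  obtain ⟨i, hi1, hi2⟩ := hD.exists_mem_open hopen ⟨w, Metric.mem_ball_self hη, hw⟩
  refine ⟨_, ⟨k, i, ⟨hnk, hi2⟩, rfl⟩, ?_⟩
  rw [e3] at hd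
  have h1 := hcont _ hi1
  rw [dist_comm] at h1 hd
  linarith [dist_triangle z (φ s (θ (-s) ω) w) (φ s (θ (-s) ω) (D i))]

theorem measurable_infEDist_pullbackPoints [BorelSpace S] [SecondCountableTopology S]
    (hφ : IsContinuousRDS θ φ) (hθm : ∀ t, Measurable (θ t)) (n : ℕ) (η : S) :
    Measurable fun ω => Metric.infEDist η (pullbackPoints θ φ D δ τ n ω) := by
  simp only [infEDist_pullbackPoints]
  refine Measurable.iInf fun q => Measurable.iInf fun _ => ?_
  refine measurable_const.edist ?_
  exact hφ.measurable.comp (measurable_const.prodMk ((hθm _).prodMk measurable_const))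

/-- A countable formula for the distance, hence measurability. Near-minimizers at times tending to
infinity accumulate in the limit set by capture; conversely the limit set lies in every closure. -/
theorem infEDist_pullbackLimit (hτ : 0 < τ) (hD : DenseRange D)
    (hφ : IsContinuousRDS θ φ) (hθ : ∀ s t ω, θ s (θ t ω) = θ (s + t) ω) (hδ : 0 < δ) {ω : Ω}
    (hcap : Captures θ φ (2 * δ) ω) (habs : Absorbs θ φ δ τ ω) (η : S) :
    Metric.infEDist η (pullbackLimit θ φ δ ω) =
      ⨆ n, Metric.infEDist η (pullbackPoints θ φ D δ τ n ω) := by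
  have hle : δ ≤ 2 * δ := by linarith
  apply le_antisymm
  · by_contra! hlt
    obtain ⟨c, hc1, hc2⟩ := exists_between hlt
    have h1 : ∀ n : ℕ, ∃ k i : ℕ, (n ≤ k ∧ ‖D i‖ < Real.exp (δ * (k * τ : ℝ≥0))) ∧
        edist η (φ (k * τ) (θ (-(k * τ : ℝ≥0)) ω) (D i)) < c := by
      intro n
      obtain ⟨_, ⟨k, i, hki, rfl⟩, hd⟩ :=
        Metric.infEDist_lt_iff.mp ((le_iSup _ n).trans_lt hc1)
      exact ⟨k, i, hki, hd⟩
    choose k i hki hd using h1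
    have hk : Tendsto (fun n => (k n : ℝ≥0) * τ) atTop atTop :=
      (tendsto_natCast_atTop_atTop.comp (tendsto_atTop_mono (fun n => (hki n).1)
        tendsto_id)).atTop_mul_const hτ
    obtain ⟨z, hz, ψ, hψ, hlim⟩ := (hcap.mono hle).exists_tendsto hk fun n => (hki n).2.le
    have h2 : edist η z ≤ c :=
      le_of_tendsto (tendsto_const_nhds.edist hlim) (Eventually.of_forall fun j => (hd (ψ j)).le)
    exact absurd ((Metric.infEDist_le_edist_of_mem hz).trans h2) (not_le.mpr hc2)
  · refine iSup_le fun n => ?_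
    rw [← Metric.infEDist_closure]
    exact Metric.infEDist_anti ((pullbackLimit_mono hle ω).trans
      (pullbackLimit_subset_closure hφ hθ hδ hD habs n))

/-- Every limit with rate 2δ is already a limit of dense points of rate δ. This recovers the loss of
rate in `pullbackLimit_subset_map`. -/
theorem pullbackLimit_two_mul (hτ : 0 < τ) [TopologicalSpace.SeparableSpace S]
    (hφ : IsContinuousRDS θ φ) (hθ : ∀ s t ω, θ s (θ t ω) = θ (s + t) ω) (hδ : 0 < δ) {ω : Ω}
    (habs : Absorbs θ φ δ τ ω) : pullbackLimit θ φ (2 * δ) ω = pullbackLimit θ φ δ ω :=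
  Subset.antisymm (fun _ hz => mem_pullbackLimit_of_mem_closure hτ fun n =>
    pullbackLimit_subset_closure hφ hθ hδ (TopologicalSpace.denseRange_denseSeq S) habs n hz)
    (pullbackLimit_mono (by linarith) ω)

end Density

open Classical in
/-- The pullback limits on `Ω₀`, and the trivial set outside of it. -/
def attractor (θ : ℝ → Ω → Ω) (φ : ℝ≥0 → Ω → S → S) (δ : ℝ) (Ω₀ : Set Ω) (ω : Ω) : Set S :=
  if ω ∈ Ω₀ then pullbackLimit θ φ δ ω else {0}

theorem attractor_of_mem {Ω₀ : Set Ω} {ω : Ω} (h : ω ∈ Ω₀) :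
    attractor θ φ δ Ω₀ ω = pullbackLimit θ φ δ ω := if_pos h

theorem attractor_of_notMem {Ω₀ : Set Ω} {ω : Ω} (h : ω ∉ Ω₀) :
    attractor θ φ δ Ω₀ ω = {0} := if_neg h

variable [MeasurableSpace Ω] [MeasurableSpace S]

theorem map_pullbackLimit_subset (hφ : IsContinuousRDS θ φ) (hγ : 0 ≤ γ)
    (hθ0 : ∀ ω, θ 0 ω = ω) (hθ : ∀ s t ω, θ s (θ t ω) = θ (s + t) ω) (t : ℝ≥0) (ω : Ω) :
    φ t ω '' pullbackLimit θ φ γ ω ⊆ pullbackLimit θ φ γ (θ t ω) := by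
  rintro _ ⟨z, hz, rfl⟩ ε hε t₀
  have hc : Continuous (φ t ω) := (hφ.continuous ω).comp (Continuous.prodMk_right t)
  obtain ⟨ε', hε', hcont⟩ := Metric.continuous_iff.mp hc z ε hε
  obtain ⟨s, hs, x, hx, hd⟩ := hz ε' hε' t₀
  refine ⟨t + s, hs.trans le_add_self, x, hx.trans (Real.exp_le_exp.mpr ?_), ?_⟩
  · push_cast
    have : 0 ≤ γ * t := by positivity
    linarith
  · have e : θ (-((t + s : ℝ≥0) : ℝ)) (θ t ω) = θ (-s) ω := by
      rw [hθ]; congr 1; push_cast; ring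
    rw [e, hφ.cocycle]
    rw [hθ, add_neg_cancel, hθ0]
    exact hcont _ hd

/-- Stop the pullback at ω, a time t before its end: by capture the intermediate states accumulate
at some w, and z = φ(t,ω,w). The initial values are now compared with the shorter time s - t, which
requires a larger rate γ'. -/
theorem pullbackLimit_subset_map (hφ : IsContinuousRDS θ φ) (hγ' : γ < γ')
    (hθ0 : ∀ ω, θ 0 ω = ω) (hθ : ∀ s t ω, θ s (θ t ω) = θ (s + t) ω) (t : ℝ≥0) {ω : Ω}
    (h : Captures θ φ γ' ω) :
    pullbackLimit θ φ γ (θ t ω) ⊆ φ t ω '' pullbackLimit θ φ γ' ω := by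
  intro z hz
  obtain ⟨s, x, hs, hx, hlim⟩ := exists_tendsto_of_mem_pullbackLimit hz
  have hlarge : ∀ᶠ j in atTop, t ≤ s j ∧ γ * s j ≤ γ' * (s j - t : ℝ≥0) := by
    obtain ⟨s₀, hs₀⟩ := exists_nat_gt (γ' * t / (γ' - γ))
    filter_upwards [hs.eventually_ge_atTop t, hs.eventually_ge_atTop (s₀ : ℝ≥0)] with j h1 h2
    refine ⟨h1, ?_⟩
    have h3 : (s₀ : ℝ) ≤ s j := by exact_mod_cast h2
    rw [div_lt_iff₀ (by linarith)] at hs₀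
    rw [NNReal.coe_sub h1]
    nlinarith
  obtain ⟨J, hJ⟩ := eventually_atTop.mp hlarge
  have hs' : Tendsto (fun j => s (j + J) - t) atTop atTop := by
    refine tendsto_atTop_atTop.mpr fun b => ?_
    obtain ⟨i, hi⟩ := tendsto_atTop_atTop.mp hs (b + t)
    exact ⟨i, fun a ha => le_tsub_of_add_le_right (hi _ (by omega))⟩
  obtain ⟨w, hw, ψ, hψ, hwlim⟩ := h.exists_tendsto (t := fun j => s (j + J) - t)
    (x := fun j => x (j + J)) hs' fun j => (hx _).trans
      (Real.exp_le_exp.mpr (hJ (j + J) (by omega)).2)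
  refine ⟨w, hw, ?_⟩
  have hc : Continuous (φ t ω) := (hφ.continuous ω).comp (Continuous.prodMk_right t)
  have h1 := (hc.tendsto w).comp hwlim
  have h2 := (hlim.comp (tendsto_add_atTop_nat J)).comp hψ.tendsto_atTop
  refine tendsto_nhds_unique h1 (h2.congr fun j => ?_)
  have hle := (hJ (ψ j + J) (by omega)).1
  simp only [Function.comp_apply]
  set u := s (ψ j + J) - t with hu
  have hsu : s (ψ j + J) = t + u := (add_tsub_cancel_of_le hle).symm
  have e1 : θ (-((t + u : ℝ≥0) : ℝ)) (θ t ω) = θ (-u) ω := by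
    rw [hθ]; congr 1; push_cast; ring
  have e2 : θ u (θ (-u) ω) = ω := by rw [hθ, add_neg_cancel, hθ0]
  rw [hsu, e1, hφ.cocycle, e2]

theorem _root_.Real.le_exp_of_posLog_le {x a : ℝ} (h : Real.posLog x ≤ a) : x ≤ Real.exp a := by
  rcases le_or_gt x 0 with hx | hx
  · exact hx.trans (Real.exp_pos a).le
  · rw [← Real.log_le_iff_le_exp hx]
    exact (le_max_right _ _).trans h

/-- A continuous random dynamical system which absorbs and captures initial values of small
exponential growth has a pullback attractor for the tempered random sets. -/
theorem isPullbackAttractor_attractor [BorelSpace S] [SecondCountableTopology S] {P : Measure Ω}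
    [IsProbabilityMeasure P] (hφ : IsContinuousRDS θ φ) (hθ0 : ∀ ω, θ 0 ω = ω)
    (hθ : ∀ s t ω, θ s (θ t ω) = θ (s + t) ω) (hθm : ∀ t, Measurable (θ t)) {Ω₀ : Set Ω}
    (hm : MeasurableSet Ω₀) (hfull : P Ω₀ = 1) (hinv : ∀ ω ∈ Ω₀, ∀ t, θ t ω ∈ Ω₀)
    (hδ : 0 < δ) {τ : ℝ≥0} (hτ : 0 < τ) (hcap : ∀ ω ∈ Ω₀, Captures θ φ (2 * δ) ω)
    (habs : ∀ ω ∈ Ω₀, Absorbs θ φ δ τ ω) :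
    IsPullbackAttractor θ P φ (temperedUniverse θ P) (attractor θ φ δ Ω₀) := by
  have hae : ∀ᵐ ω ∂P, ω ∈ Ω₀ := (mem_ae_iff_prob_eq_one hm).mpr hfull
  have hcap1 : ∀ ω ∈ Ω₀, Captures θ φ δ ω := fun ω hω => (hcap ω hω).mono (by linarith)
  have hne : ∀ ω, (attractor θ φ δ Ω₀ ω).Nonempty := fun ω => by
    by_cases h : ω ∈ Ω₀
    · rw [attractor_of_mem h]; exact (hcap1 ω h).nonempty
    · rw [attractor_of_notMem h]; exact singleton_nonempty 0
  have hco : ∀ ω, IsCompact (attractor θ φ δ Ω₀ ω) := fun ω => by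
    by_cases h : ω ∈ Ω₀
    · rw [attractor_of_mem h]; exact (hcap1 ω h).isCompact
    · rw [attractor_of_notMem h]; exact isCompact_singleton
  have hinf : ∀ η : S, Measurable fun ω => Metric.infDist η (attractor θ φ δ Ω₀ ω) := by
    intro η
    classical
    have e : (fun ω => Metric.infDist η (attractor θ φ δ Ω₀ ω)) = fun ω =>
        if ω ∈ Ω₀ then (⨆ n, Metric.infEDist η
          (pullbackPoints θ φ (TopologicalSpace.denseSeq S) δ τ n ω)).toReal else dist η 0 := by
      funext ω
      split_ifs with h
      · rw [attractor_of_mem h, Metric.infDist, infEDist_pullbackLimit hτ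
          (TopologicalSpace.denseRange_denseSeq S) hφ hθ hδ (hcap ω h) (habs ω h)]
      · rw [attractor_of_notMem h, Metric.infDist_singleton]
    rw [e]
    exact Measurable.ite hm (Measurable.iSup fun n =>
      measurable_infEDist_pullbackPoints hφ hθm n η).ennreal_toReal measurable_const
  have hgraph : IsRandomSet (attractor θ φ δ Ω₀) := by
    -- The distance is continuous in η and measurable in ω, hence jointly measurable; the graph of a
    -- closed-valued map is its zero set.
    have h1 : Measurable (Function.uncurry fun (η : S) (ω : Ω) =>
        Metric.infDist η (attractor θ φ δ Ω₀ ω)) :=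
      measurable_uncurry_of_continuous_of_measurable
        (fun ω => Metric.continuous_infDist_pt _) hinf
    have e : {p : Ω × S | p.2 ∈ attractor θ φ δ Ω₀ p.1} = (fun p : Ω × S =>
        Metric.infDist p.2 (attractor θ φ δ Ω₀ p.1)) ⁻¹' {0} := by
      ext p
      exact (hco p.1).isClosed.mem_iff_infDist_zero (hne p.1)
    unfold IsRandomSet
    rw [e]
    exact (h1.comp measurable_swap) (measurableSet_singleton 0)
  refine ⟨⟨hgraph, hne, hco, hinf⟩, ?_, ?_⟩
  · filter_upwards [hae] with ω hω t
    rw [attractor_of_mem hω, attractor_of_mem (hinv ω hω t)]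
    refine Subset.antisymm (map_pullbackLimit_subset hφ hδ.le hθ0 hθ t ω) ?_
    refine (pullbackLimit_subset_map hφ (by linarith : δ < 2 * δ) hθ0 hθ t (hcap ω hω)).trans ?_
    rw [pullbackLimit_two_mul hτ hφ hθ hδ (habs ω hω)]
  · rintro D ⟨-, ρ, hρ, hD⟩
    filter_upwards [hae, hD, hρ.atBot] with ω hω hDω hbot
    rw [attractor_of_mem hω, ENNReal.tendsto_nhds_zero]
    intro ε hε
    obtain ⟨ε', hε', hεε'⟩ := ENNReal.lt_iff_exists_nnreal_btwn.mp hε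
    have hε0 : (0 : ℝ) < ε' := by exact_mod_cast hε'
    have hneg : Tendsto (fun t : ℝ≥0 => -(t : ℝ)) atTop atBot :=
      tendsto_neg_atTop_atBot.comp (NNReal.tendsto_coe_atTop.mpr tendsto_id)
    -- Temperedness at -∞ gives ρ(θ_{-t}ω) ≤ exp(δt) for large t, so tempered sets lie among the
    -- initial values of rate δ.
    have h1 := (hbot.comp hneg).eventually (Metric.ball_mem_nhds 0 hδ)
    filter_upwards [(hcap1 ω hω).attracts hε0, h1, eventually_gt_atTop 0] with t ht ht1 ht0
    refine iSup₂_le ?_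
    rintro _ ⟨x, hx, rfl⟩
    have ht0' : (0 : ℝ) < t := ht0
    have hx1 : ‖x‖ ≤ Real.exp (δ * t) := by
      have h2 := hDω (-t) hx
      rw [mem_closedBall_zero_iff] at h2
      refine h2.trans (Real.le_exp_of_posLog_le ?_)
      rw [dist_zero_right, Function.comp_apply, norm_mul, Real.norm_eq_abs,
        Real.norm_eq_abs, abs_div, abs_one, abs_neg, abs_of_pos ht0', one_div,
        inv_mul_lt_iff₀ ht0', mul_comm] at ht1
      exact (le_abs_self _).trans ht1.le
    obtain ⟨z, hz, hd⟩ := ht x hx1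
    refine (Metric.infEDist_le_edist_of_mem hz).trans (le_trans ?_ hεε'.le)
    rw [edist_dist]
    exact ENNReal.ofReal_le_of_le_toReal (by simpa using hd.le)

end Attractor


/-! ### Absorption by iteration over blocks -/

section Absorption

variable {Ω S : Type*} [NormedAddCommGroup S] {θ : ℝ → Ω → Ω} {φ : ℝ≥0 → Ω → S → S}
  {τ : ℝ≥0} {C D c e : ℝ} {ω : Ω}

/-- Bounds for a cocycle over the blocks `[-(j+1)τ,-jτ]` in terms of quantities `q j` with bounded
averages. -/
structure BlockBounds (θ : ℝ → Ω → Ω) (φ : ℝ≥0 → Ω → S → S) (τ : ℝ≥0) (C D c e : ℝ) (N : ℕ)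
    (q : ℕ → ℝ) (ω : Ω) : Prop where
  nonneg : ∀ j, 0 ≤ q j
  sum_le : ∀ n : ℕ, ∑ j ∈ Finset.range n, q j ≤ c * (n + N)
  block : ∀ (j : ℕ) (x : S), ‖φ τ (θ (-((j + 1 : ℕ) * τ)) ω) x‖ ≤
    Real.exp (-1 + e * q j) * ‖x‖ + D * (1 + q j) * Real.exp (e * q j)
  part : ∀ (j : ℕ) (σ : ℝ≥0), σ ≤ τ → ∀ x : S, ‖φ σ (θ (-((j + 1 : ℕ) * τ + σ)) ω) x‖ ≤
    Real.exp (C + e * (q j + q (j + 1))) * (‖x‖ + D * (1 + (q j + q (j + 1))))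

theorem one_add_mul_le_exp {c z : ℝ} (hc : 0 ≤ c) (hz : 0 ≤ z) :
    1 + c * z ≤ (1 + 32 * c) * Real.exp (z / 32) := by
  have h := Real.add_one_le_exp (z / 32)
  have h1 : (1 + 32 * c) * (z / 32 + 1) ≤ (1 + 32 * c) * Real.exp (z / 32) := by gcongr
  nlinarith

theorem sum_exp_neg_le (l : ℕ) : ∑ j ∈ Finset.range l, Real.exp (-(15 / 16 * (j : ℝ))) ≤ 3 := by
  have h1 : Real.exp (-(15 / 16)) ≤ 2 / 3 := by
    rw [Real.exp_neg]
    have h := Real.add_one_le_exp (15 / 16 : ℝ)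
    exact (inv_anti₀ (by norm_num) (by linarith : (3 / 2 : ℝ) ≤ _)).trans (by norm_num)
  have h2 : ∀ j : ℕ, Real.exp (-(15 / 16 * (j : ℝ))) ≤ (2 / 3) ^ j := by
    intro j
    have e : -(15 / 16 * (j : ℝ)) = j * -(15 / 16) := by ring
    rw [e, Real.exp_nat_mul]
    gcongr
  refine (Finset.sum_le_sum fun j _ => h2 j).trans ?_
  rw [geom_sum_eq (by norm_num)]
  have : (0 : ℝ) ≤ (2 / 3) ^ l := by positivity
  rw [div_le_iff_of_neg (by norm_num)]
  linarith

variable {N : ℕ} {q : ℕ → ℝ}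

theorem BlockBounds.sum_shift_le (h : BlockBounds θ φ τ C D c e N q ω) (k l : ℕ) :
    ∑ j ∈ Finset.range l, q (k + j) ≤ c * ((k + l : ℕ) + N) := by
  refine le_trans ?_ (h.sum_le (k + l))
  rw [Finset.sum_range_add]
  exact le_add_of_nonneg_left (Finset.sum_nonneg fun j _ => h.nonneg j)

variable [MeasurableSpace Ω] [MeasurableSpace S]

/-- Discrete variation of constants: iterate the affine block bound, peeling off the earliest block.
-/
theorem BlockBounds.norm_iterate_le (h : BlockBounds θ φ τ C D c e N q ω)
    (hφ : IsContinuousRDS θ φ) (hθ : ∀ s t ω, θ s (θ t ω) = θ (s + t) ω) (k l : ℕ) (x : S) :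
    ‖φ (l * τ) (θ (-((k + l : ℕ) * τ)) ω) x‖ ≤
      Real.exp (-l + e * ∑ j ∈ Finset.range l, q (k + j)) * ‖x‖ +
      ∑ j ∈ Finset.range l, D * (1 + q (k + j)) *
        Real.exp (-j + e * ∑ i ∈ Finset.range (j + 1), q (k + i)) := by
  induction l generalizing x with
  | zero => simp [hφ.map_zero]
  | succ l ih =>
    have e1 : ((l + 1 : ℕ) : ℝ≥0) * τ = l * τ + τ := by push_cast; ring
    have e2 : θ τ (θ (-((k + (l + 1) : ℕ) * τ)) ω) = θ (-((k + l : ℕ) * τ)) ω := by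
      rw [hθ]; congr 1; push_cast; ring
    rw [e1, hφ.cocycle, e2]
    refine (ih _).trans ?_
    have h1 := h.block (k + l) x
    rw [add_assoc k l 1] at h1
    rw [Finset.sum_range_succ _ l, Finset.sum_range_succ _ l]
    set E := ∑ j ∈ Finset.range l, q (k + j) with hE
    have h2 := mul_le_mul_of_nonneg_left h1 (Real.exp_pos (-l + e * E)).le
    have e3 : Real.exp (-l + e * E) * (Real.exp (-1 + e * q (k + l)) * ‖x‖ +
        D * (1 + q (k + l)) * Real.exp (e * q (k + l))) =
        Real.exp (-(l + 1 : ℕ) + e * (E + q (k + l))) * ‖x‖ +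
        D * (1 + q (k + l)) * Real.exp (-l + e * (E + q (k + l))) := by
      have e4 : Real.exp (-(l + 1 : ℕ) + e * (E + q (k + l))) =
          Real.exp (-l + e * E) * Real.exp (-1 + e * q (k + l)) := by
        rw [← Real.exp_add]; congr 1; push_cast; ring
      have e5 : Real.exp (-l + e * (E + q (k + l))) =
          Real.exp (-l + e * E) * Real.exp (e * q (k + l)) := by
        rw [← Real.exp_add]; congr 1; ring
      rw [e4, e5]; ring
    rw [Finset.sum_range_succ (fun i => q (k + i)) l, ← hE]
    linarith

/-- With e·c ≤ 1/32 the accumulated noise costs 1/32 per block, and the factor 1 + q another 1/32;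
the net decay rate 15/16 makes the inhomogeneous sum geometric. -/
theorem BlockBounds.norm_iterate_le' (h : BlockBounds θ φ τ C D c e N q ω)
    (hφ : IsContinuousRDS θ φ) (hθ : ∀ s t ω, θ s (θ t ω) = θ (s + t) ω) (hD : 0 ≤ D) (hc : 0 ≤ c)
    (he : 0 ≤ e) (hec : e * c ≤ 1 / 32) (k l : ℕ) (x : S) :
    ‖φ (l * τ) (θ (-((k + l : ℕ) * τ)) ω) x‖ ≤
      Real.exp (-l + (k + l + N) / 32) * ‖x‖ +
        3 * (D * (1 + 32 * c)) * Real.exp ((k + N + 1) / 16) := by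
  have hexp : ∀ k l : ℕ, e * ∑ j ∈ Finset.range l, q (k + j) ≤ ((k : ℝ) + l + N) / 32 := by
    intro k l
    refine (mul_le_mul_of_nonneg_left (h.sum_shift_le k l) he).trans ?_
    rw [← mul_assoc]
    refine (mul_le_mul_of_nonneg_right hec (by positivity)).trans (le_of_eq ?_)
    push_cast
    ring
  refine (h.norm_iterate_le hφ hθ k l x).trans (add_le_add ?_ ?_)
  · gcongr
    exact hexp k l
  · have hterm : ∀ j ∈ Finset.range l, D * (1 + q (k + j)) *
        Real.exp (-j + e * ∑ i ∈ Finset.range (j + 1), q (k + i)) ≤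
        D * (1 + 32 * c) * Real.exp ((k + N + 1) / 16) * Real.exp (-(15 / 16 * (j : ℝ))) := by
      intro j _
      have h1 : q (k + j) ≤ c * ((k : ℝ) + j + 1 + N) := by
        have h2 := h.sum_le (k + j + 1)
        rw [Finset.sum_range_succ] at h2
        have h3 : 0 ≤ ∑ j ∈ Finset.range (k + j), q j := Finset.sum_nonneg fun j _ => h.nonneg j
        push_cast at h2
        linarith
      have h2 : 1 + q (k + j) ≤ (1 + 32 * c) * Real.exp (((k : ℝ) + j + 1 + N) / 32) :=
        le_trans (by linarith) (one_add_mul_le_exp hc (by positivity))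
      have h3 := hexp k (j + 1)
      push_cast at h3
      calc D * (1 + q (k + j)) * Real.exp (-j + e * ∑ i ∈ Finset.range (j + 1), q (k + i))
          ≤ D * ((1 + 32 * c) * Real.exp (((k : ℝ) + j + 1 + N) / 32)) *
            Real.exp (-j + ((k : ℝ) + (j + 1) + N) / 32) := by gcongr
        _ = D * (1 + 32 * c) * (Real.exp (((k : ℝ) + j + 1 + N) / 32) *
            Real.exp (-j + ((k : ℝ) + (j + 1) + N) / 32)) := by ring
        _ = _ := by
          rw [mul_assoc (D * (1 + 32 * c)), ← Real.exp_add, ← Real.exp_add]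
          congr 2
          ring
    refine (Finset.sum_le_sum hterm).trans ?_
    rw [← Finset.mul_sum]
    refine (mul_le_mul_of_nonneg_left (sum_exp_neg_le l) (by positivity)).trans (le_of_eq (by ring))

/-- Initial values of growth rate `1/(2τ)` are absorbed. -/
theorem BlockBounds.eventually_norm_le (h : BlockBounds θ φ τ C D c e N q ω)
    (hφ : IsContinuousRDS θ φ) (hθ : ∀ s t ω, θ s (θ t ω) = θ (s + t) ω) (hτ : 0 < τ) (hD : 0 ≤ D)
    (hc : 0 ≤ c) (he : 0 ≤ e) (hec : e * c ≤ 1 / 32) :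
    ∃ R, 0 ≤ R ∧ ∀ k : ℕ, ∀ᶠ t : ℝ≥0 in atTop, ∀ x, ‖x‖ ≤ Real.exp (t / (2 * τ)) →
      ‖φ t (θ (-(t + (k * τ : ℝ≥0))) ω) x‖ ≤ R * Real.exp (k / 16) := by
  have hτ' : (0 : ℝ) < τ := hτ
  refine ⟨1 + 3 * (D * (1 + 32 * c)) * Real.exp ((N + 1) / 16), by positivity, fun k => ?_⟩
  set D' := D * (1 + 32 * c) with hD'
  have hD'0 : 0 ≤ D' := by positivity
  have hlim : Tendsto (fun l : ℕ => (1 + D') * Real.exp (C + 1 + (k + N) / 8) *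
      Real.exp (-(1 / 4) * l)) atTop (𝓝 ((1 + D') * Real.exp (C + 1 + (k + N) / 8) * 0)) := by
    refine Tendsto.const_mul _ (Real.tendsto_exp_atBot.comp ?_)
    exact tendsto_natCast_atTop_atTop.const_mul_atTop_of_neg (by norm_num)
  rw [mul_zero] at hlim
  obtain ⟨L, hL⟩ := eventually_atTop.mp (hlim.eventually_le_const one_pos)
  filter_upwards [eventually_ge_atTop ((L + 1 : ℕ) * τ)] with t ht x hx
  -- t = lτ + σ: a partial block of length σ at the far end, bounded by `part`, then l full blocks.
  set l := ⌊t / τ⌋₊ with hl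
  have hlL : L + 1 ≤ l := Nat.le_floor (by rwa [le_div_iff₀ hτ])
  have hl1 : (l : ℝ≥0) * τ ≤ t := by
    rw [← le_div_iff₀ hτ]; exact Nat.floor_le (zero_le)
  have hl2 : t < ((l : ℝ≥0) + 1) * τ := by
    rw [← div_lt_iff₀ hτ]; exact Nat.lt_floor_add_one _
  set σ := t - l * τ with hσ
  have htσ : t = l * τ + σ := (add_tsub_cancel_of_le hl1).symm
  have hσr : (t : ℝ) = l * τ + σ := by rw [htσ]; push_cast; ring
  have hl2' : (t : ℝ) < ((l : ℝ) + 1) * τ := by exact_mod_cast hl2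
  have hστ : σ ≤ τ := by
    have : (σ : ℝ) ≤ τ := by linarith
    exact this
  obtain ⟨n, hn⟩ : ∃ n, k + l = n + 1 := ⟨k + l - 1, by omega⟩
  have hn' : (n : ℝ) + 1 = k + l := by exact_mod_cast hn.symm
  have e1 : θ (-((t : ℝ) + (k * τ : ℝ≥0))) ω = θ (-((n + 1 : ℕ) * τ + σ)) ω := by
    congr 1
    push_cast
    rw [hσr, hn']
    ring
  have e2 : θ σ (θ (-((n + 1 : ℕ) * τ + σ)) ω) = θ (-((k + l : ℕ) * τ)) ω := by
    rw [hθ, hn]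
    congr 1
    ring
  have hpart := h.part n σ hστ x
  set w := φ σ (θ (-((n + 1 : ℕ) * τ + σ)) ω) x with hw
  have e3 : φ t (θ (-(t + (k * τ : ℝ≥0))) ω) x = φ (l * τ) (θ (-((k + l : ℕ) * τ)) ω) w := by
    rw [e1]
    conv_lhs => rw [htσ]
    rw [hφ.cocycle, e2]
  rw [e3]
  have hit := h.norm_iterate_le' hφ hθ hD hc he hec k l w
  have hqq : q n + q (n + 1) ≤ c * ((k : ℝ) + l + 1 + N) := by
    have h1 := h.sum_le (n + 2)
    rw [Finset.sum_range_succ, Finset.sum_range_succ] at h1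
    have h3 : 0 ≤ ∑ j ∈ Finset.range n, q j := Finset.sum_nonneg fun j _ => h.nonneg j
    push_cast at h1
    have e5 : (n : ℝ) + 2 + N = k + l + 1 + N := by linarith
    rw [e5] at h1
    linarith
  have hx' : ‖x‖ ≤ Real.exp (((l : ℝ) + 1) / 2 + (k + N) / 32) := by
    refine hx.trans (Real.exp_le_exp.mpr ?_)
    have h1 : (t : ℝ) / (2 * τ) ≤ ((l : ℝ) + 1) / 2 := by
      rw [div_le_iff₀ (by positivity)]
      linarith
    have h2 : (0 : ℝ) ≤ (k + N) / 32 := by positivity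
    linarith
  have hz0 : (0 : ℝ) ≤ (k : ℝ) + l + 1 + N := by positivity
  have h1 : D * (1 + (q n + q (n + 1))) ≤ D' * Real.exp (((l : ℝ) + 1) / 2 + (k + N) / 32) := by
    have h2 : 1 + (q n + q (n + 1)) ≤ (1 + 32 * c) * Real.exp (((k : ℝ) + l + 1 + N) / 32) :=
      le_trans (by linarith) (one_add_mul_le_exp hc hz0)
    have h3 : Real.exp (((k : ℝ) + l + 1 + N) / 32) ≤
        Real.exp (((l : ℝ) + 1) / 2 + (k + N) / 32) := by
      refine Real.exp_le_exp.mpr ?_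
      have : (0 : ℝ) ≤ l := by positivity
      linarith
    rw [hD', mul_assoc]
    gcongr
    exact h2.trans (by gcongr)
  have h2 : e * (q n + q (n + 1)) ≤ ((k : ℝ) + l + 1 + N) / 32 := by
    refine (mul_le_mul_of_nonneg_left hqq he).trans ?_
    rw [← mul_assoc]
    refine (mul_le_mul_of_nonneg_right hec hz0).trans (le_of_eq (by ring))
  have h3 : ‖w‖ ≤ Real.exp (C + ((k : ℝ) + l + 1 + N) / 32) *
      ((1 + D') * Real.exp (((l : ℝ) + 1) / 2 + (k + N) / 32)) := by
    refine hpart.trans ?_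
    have h4 : ‖x‖ + D * (1 + (q n + q (n + 1))) ≤
        (1 + D') * Real.exp (((l : ℝ) + 1) / 2 + (k + N) / 32) := by linarith
    have h5 : 0 ≤ ‖x‖ + D * (1 + (q n + q (n + 1))) := by
      have := h.nonneg n
      have := h.nonneg (n + 1)
      positivity
    gcongr
  -- Coefficient of l in the exponent: -1 from contraction, 1/32 from the blocks, 1/32 from the
  -- partial block and 1/2 from the growth of the initial values; the sum is -7/16 ≤ -1/4.
  have h4 : Real.exp (-l + (k + l + N) / 32) * ‖w‖ ≤ 1 := by
    refine le_trans ?_ (hL l (by omega))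
    calc Real.exp (-l + (k + l + N) / 32) * ‖w‖
        ≤ Real.exp (-l + (k + l + N) / 32) * (Real.exp (C + ((k : ℝ) + l + 1 + N) / 32) *
          ((1 + D') * Real.exp (((l : ℝ) + 1) / 2 + (k + N) / 32))) := by gcongr
      _ = (1 + D') * (Real.exp (-l + (k + l + N) / 32) *
          Real.exp (C + ((k : ℝ) + l + 1 + N) / 32) *
          Real.exp (((l : ℝ) + 1) / 2 + (k + N) / 32)) := by ring
      _ = (1 + D') * Real.exp ((-l + (k + l + N) / 32) + (C + ((k : ℝ) + l + 1 + N) / 32) +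
          (((l : ℝ) + 1) / 2 + (k + N) / 32)) := by rw [← Real.exp_add, ← Real.exp_add]
      _ ≤ (1 + D') * Real.exp ((C + 1 + (k + N) / 8) + -(1 / 4) * l) := by
          have h6 : (0 : ℝ) ≤ l := by positivity
          have h7 : (0 : ℝ) ≤ k := by positivity
          have h8 : (0 : ℝ) ≤ N := by positivity
          exact mul_le_mul_of_nonneg_left (Real.exp_le_exp.mpr (by linarith)) (by positivity)
      _ = _ := by rw [Real.exp_add]; ring
  have h5 : Real.exp (((k : ℝ) + N + 1) / 16) = Real.exp ((N + 1) / 16) * Real.exp (k / 16) := by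
    rw [← Real.exp_add]; congr 1; ring
  have h6 : 1 ≤ Real.exp ((k : ℝ) / 16) := Real.one_le_exp (by positivity)
  rw [h5] at hit
  calc ‖φ (l * τ) (θ (-((k + l : ℕ) * τ)) ω) w‖
      ≤ 1 + 3 * D' * (Real.exp ((N + 1) / 16) * Real.exp (k / 16)) := hit.trans (by linarith)
    _ ≤ _ := by linarith

/-- With δ = 1/(6τ) the target radius is exp(k/6), which beats the absorbing radius R·exp(k/16) for
large k, and 3δ is the admissible rate 1/(2τ). -/
theorem BlockBounds.absorbs (h : BlockBounds θ φ τ C D c e N q ω)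
    (hφ : IsContinuousRDS θ φ) (hθ : ∀ s t ω, θ s (θ t ω) = θ (s + t) ω) (hτ : 0 < τ) (hD : 0 ≤ D)
    (hc : 0 ≤ c) (he : 0 ≤ e) (hec : e * c ≤ 1 / 32) : Absorbs θ φ (1 / (6 * τ)) τ ω := by
  have hτ' : (0 : ℝ) < τ := hτ
  obtain ⟨R, hR, hev⟩ := h.eventually_norm_le hφ hθ hτ hD hc he hec
  obtain ⟨n, hn⟩ := exists_nat_gt (10 * R)
  filter_upwards [eventually_ge_atTop n] with k hk
  filter_upwards [hev k] with t ht x hx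
  have e1 : 3 * (1 / (6 * (τ : ℝ))) * t = t / (2 * τ) := by ring
  rw [e1] at hx
  refine (ht x hx).trans_lt ?_
  have e2 : 1 / (6 * (τ : ℝ)) * ((k * τ : ℝ≥0) : ℝ) = k / 6 := by push_cast; field_simp
  have e3 : Real.exp ((k : ℝ) / 6) = Real.exp (5 * k / 48) * Real.exp (k / 16) := by
    rw [← Real.exp_add]; congr 1; ring
  rw [e2, e3]
  have hk' : (n : ℝ) ≤ k := by exact_mod_cast hk
  have h1 := Real.add_one_le_exp (5 * (k : ℝ) / 48)
  have h2 : R < Real.exp (5 * k / 48) := by linarith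
  gcongr

/-- Absorption at the base point θ_{-T₁}ω brings the state into a fixed ball, and the last stretch
of length T₁ maps this ball into a compact set. Rate 1/(3τ) over t is rate 1/(2τ) over t - T₁ once t
≥ 3T₁. -/
theorem BlockBounds.captures {T₁ : ℝ≥0}
    (h : BlockBounds θ φ τ C D c e N q (θ (-T₁) ω))
    (hφ : IsContinuousRDS θ φ) (hθ : ∀ s t ω, θ s (θ t ω) = θ (s + t) ω) (hτ : 0 < τ) (hD : 0 ≤ D)
    (hc : 0 ≤ c) (he : 0 ≤ e) (hec : e * c ≤ 1 / 32)
    (hcpt : ∀ R : ℝ, ∃ K : Set S, IsCompact K ∧ ∀ x, ‖x‖ ≤ R → φ T₁ (θ (-T₁) ω) x ∈ K) :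
    Captures θ φ (2 * (1 / (6 * τ))) ω := by
  have hτ' : (0 : ℝ) < τ := hτ
  obtain ⟨R, hR, hev⟩ := h.eventually_norm_le hφ hθ hτ hD hc he hec
  obtain ⟨K, hK, hKx⟩ := hcpt R
  obtain ⟨t₀, ht₀⟩ := eventually_atTop.mp (hev 0)
  refine ⟨K, hK, ?_⟩
  filter_upwards [eventually_ge_atTop (t₀ + 3 * T₁)] with t ht x hx
  have hT₁t : T₁ ≤ t := le_trans (le_trans (le_mul_of_one_le_left (zero_le) (by norm_num))
    le_add_self) ht
  set u := t - T₁ with hu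
  have htu : t = T₁ + u := (add_tsub_cancel_of_le hT₁t).symm
  have htur : (t : ℝ) = T₁ + u := by rw [htu]; push_cast; ring
  have hu0 : t₀ + 2 * T₁ ≤ u := by
    have : (t₀ : ℝ) + 3 * T₁ ≤ t := by exact_mod_cast ht
    have h2 : (t₀ : ℝ) + 2 * T₁ ≤ u := by linarith
    exact_mod_cast h2
  have hu0' : (2 : ℝ) * T₁ ≤ u := by exact_mod_cast le_add_self.trans hu0
  have e1 : θ (-((u : ℝ) + ((0 : ℕ) * τ : ℝ≥0))) (θ (-T₁) ω) = θ (-t) ω := by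
    rw [hθ, htur]
    congr 1
    push_cast
    ring
  have h1 := ht₀ u (le_self_add.trans hu0) x (hx.trans (Real.exp_le_exp.mpr (by
    have e : 2 * (1 / (6 * (τ : ℝ))) * t = t / (3 * τ) := by ring
    rw [e, div_le_div_iff₀ (by positivity) (by positivity), htur]
    nlinarith)))
  rw [e1] at h1
  have e2 : θ u (θ (-t) ω) = θ (-T₁) ω := by rw [hθ, htur]; congr 1; ring
  have e3 : φ t (θ (-t) ω) x = φ T₁ (θ (-T₁) ω) (φ u (θ (-t) ω) x) := by
    conv_lhs => rw [htu]
    rw [hφ.cocycle, ← htu, e2]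
  rw [e3]
  exact hKx _ (by simpa using h1)

end Absorption


/-! ### The pullback attractor of the delay equation -/

section FlowAttractor

variable {d m : ℕ} {r : ℝ} {ν β₀ : ℝ≥0}

/-- For τ ≥ r the final segment involves positive times only, where the solution has the exponent ν
of the noise: the flow regularizes. -/
theorem flow_mem_holderBall {F : Hist r d → Vec d} {g : Hist r d → Vec m →L[ℝ] Vec d}
    {CF Cg : ℝ≥0} (hc : IsCoeff F g CF Cg) (he : IsExponents β₀ ν) (hr : 0 ≤ r) {τ : ℝ≥0}
    (hτ : 1 ≤ τ) (hτr : r ≤ τ) (ω : NoisePath ν m) (R : ℝ) : ∃ C, 0 ≤ C ∧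
      ∀ η : LittleHolder β₀ (-r) 0 d, ‖η‖ ≤ R →
        flow hc he hr τ ω η ∈ LittleHolder.holderBall β₀ (-r) 0 d ν C := by
  have hτ1 : (1 : ℝ) ≤ τ := by exact_mod_cast hτ
  have hX : 0 ≤ ‖NoisePath.restr 0 τ ω‖ := norm_nonneg _
  obtain ⟨K₁, hK₁, h₁⟩ := IsYoungSol.apriori_const hc he hr hτ1 hX
  obtain ⟨K₂, hK₂, h₂⟩ := IsYoungSol.holOn_const hc he hr hτ1 hX
  refine ⟨(K₁ + K₂) * (|R| + 1), by positivity, fun η hη => ?_⟩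
  have hsol := solPath_sol hc he hr ω η τ
  have h0 : HistBdd β₀ |R| (segment r (solPath hc he hr ω η) 0) :=
    (solPath_histBdd hc he hr ω η).mono (hη.trans (le_abs_self R))
  have hb := h₁ ω.path _ _ (ω.holOn 0 τ) hsol h0
  have hh := h₂ ω.path _ _ (ω.holOn 0 τ) hsol h0
  have hR : 0 ≤ |R| + 1 := by positivity
  refine ⟨fun t => ?_, fun s t hst => ?_⟩
  · rw [flow_path, segment_apply]
    refine (hb.bdd _ (by linarith [t.2.1]) (by linarith [t.2.2])).trans ?_
    gcongr
    linarith
  · have hst' : (s : ℝ) ≤ t := hst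
    rw [flow_path, segment_apply, segment_apply]
    have := hh (τ + s) (τ + t) (by linarith [s.2.1]) (by linarith) (by linarith [t.2.2])
    rw [add_sub_add_left_eq_sub] at this
    have h3 : 0 ≤ ((t : ℝ) - s) ^ (ν : ℝ) := Real.rpow_nonneg (by linarith) _
    refine this.trans ?_
    gcongr
    linarith

theorem LittleHolder.memHolder_of_mem_holderBall {β : ℝ≥0} (hβ : β < ν) {C : ℝ} (hC : 0 ≤ C)
    (hr : 0 ≤ r) {η : LittleHolder β₀ (-r) 0 d}
    (h : η ∈ LittleHolder.holderBall β₀ (-r) 0 d ν C) : MemHolder β η.path := by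
  have hβ' : (β : ℝ) < ν := hβ
  refine ⟨(C * (1 + r) ^ ((ν : ℝ) - β)).toNNReal, holderWith_iff_norm.mpr fun s t hst => ?_⟩
  have hst' : (s : ℝ) ≤ t := hst
  rw [Real.coe_toNNReal _ (by positivity)]
  refine (h.2 s t hst).trans ?_
  have hs := s.2.1
  have ht := t.2.2
  have hν0 : (0 : ℝ) < ν := (NNReal.coe_nonneg β).trans_lt hβ'
  rcases hst'.eq_or_lt with he | hlt
  · rw [he, sub_self, Real.zero_rpow hν0.ne', mul_zero]
    positivity
  · have h1 : 0 < (t : ℝ) - s := by linarith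
    have e : ((t : ℝ) - s) ^ (ν : ℝ) = ((t : ℝ) - s) ^ ((ν : ℝ) - β) * ((t : ℝ) - s) ^ (β : ℝ) := by
      rw [← Real.rpow_add h1, sub_add_cancel]
    rw [e, ← mul_assoc]
    have h2 : ((t : ℝ) - s) ^ ((ν : ℝ) - β) ≤ (1 + r) ^ ((ν : ℝ) - β) :=
      Real.rpow_le_rpow h1.le (by linarith) (by linarith)
    gcongr

theorem rpow_add_le_two_rpow_mul {p x y : ℝ} (hp : 0 ≤ p) (hx : 0 ≤ x) (hy : 0 ≤ y) :
    (x + y) ^ p ≤ 2 ^ p * (x ^ p + y ^ p) := by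
  have h : x + y ≤ 2 * max x y := by linarith [le_max_left x y, le_max_right x y]
  refine (Real.rpow_le_rpow (by positivity) h hp).trans ?_
  rw [Real.mul_rpow (by norm_num) (le_max_of_le_left hx)]
  gcongr
  have hx' : 0 ≤ x ^ p := by positivity
  have hy' : 0 ≤ y ^ p := by positivity
  rcases le_total x y with h | h
  · rw [max_eq_right h]; linarith
  · rw [max_eq_left h]; linarith

theorem blockBounds_flow {F : Hist r d → Vec d} {g : Hist r d → Vec m →L[ℝ] Vec d}
    {CF Cg : ℝ≥0} (hg : IsCoeff F g CF Cg) (he : IsExponents β₀ ν) (hr : 0 ≤ r) {T C D p c : ℝ}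
    (hT : 1 ≤ T) (hp : 0 ≤ p) (hC : 0 ≤ C) (hD : 0 ≤ D)
    (hest : ∀ (ω : NoisePath ν m) (η : LittleHolder β₀ (-r) 0 d) (X : ℝ), 0 ≤ X →
      HolOn ν X 0 T ω.path →
      ‖flow hg he hr T.toNNReal ω η‖ ≤ Real.exp (-1 + C * (Cg * X) ^ p) * ‖η‖ +
        D * (1 + X ^ p) * Real.exp (C * (Cg * X) ^ p) ∧
      ∀ t : ℝ≥0, t ≤ T → ‖flow hg he hr t ω η‖ ≤
        Real.exp (C * (1 + (Cg * X) ^ p)) * (‖η‖ + D * (1 + X ^ p)))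
    {ω : NoisePath ν m} {X : ℕ → ℝ} {N : ℕ}
    (hX : ∀ j : ℕ, 0 ≤ X j ∧ HolOn ν (X j) (-((j + 1 : ℝ) * T)) (-(j * T)) ω.path)
    (hsum : ∀ n : ℕ, ∑ j ∈ Finset.range n, X j ^ p ≤ c * (n + N)) :
    BlockBounds NoisePath.shift (flow hg he hr) T.toNNReal C (D * 2 ^ p) c
      (C * ((Cg : ℝ) ^ p * 2 ^ p)) N (fun j => X j ^ p) ω := by
  have hTT : (T.toNNReal : ℝ) = T := Real.coe_toNNReal _ (by linarith)
  have h2 : (1 : ℝ) ≤ 2 ^ p := Real.one_le_rpow (by norm_num) hp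
  have hCg : (0 : ℝ) ≤ (Cg : ℝ) ^ p := by positivity
  refine ⟨fun j => Real.rpow_nonneg (hX j).1 _, hsum, fun j η => ?_, fun j σ hσ η => ?_⟩
  · have hXj := (hX j).1
    have hXp : 0 ≤ X j ^ p := by positivity
    have hh : HolOn ν (X j) 0 T (NoisePath.shift (-((j + 1 : ℕ) * (T.toNNReal : ℝ))) ω).path := by
      refine NoisePath.holOn_shift ((hX j).2.mono le_rfl ?_ ?_) <;> rw [hTT] <;> push_cast <;>
        linarith
    refine (hest _ η _ hXj hh).1.trans ?_
    rw [Real.mul_rpow (NNReal.coe_nonneg _) hXj]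
    have h3 : C * ((Cg : ℝ) ^ p * X j ^ p) ≤ C * ((Cg : ℝ) ^ p * 2 ^ p) * X j ^ p := by
      rw [mul_assoc C, mul_assoc ((Cg : ℝ) ^ p)]
      gcongr
      exact le_mul_of_one_le_left hXp h2
    have h4 : D ≤ D * 2 ^ p := le_mul_of_one_le_right hD h2
    gcongr
  · have hX0 := (hX j).1
    have hX1 := (hX (j + 1)).1
    -- The window of length T starting at -((j+1)T + σ) straddles the blocks j + 1 and j, hence the
    -- sum of two Hölder constants and the factor 2^p.
    set Y := X (j + 1) + X j with hY
    have hY0 : 0 ≤ Y := by positivity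
    have hσ' : (σ : ℝ) ≤ T := by rw [← hTT]; exact hσ
    have hσ0 := NNReal.coe_nonneg σ
    have hcat : HolOn ν Y (-((j + 1 + 1 : ℝ) * T)) (-(j * T)) ω.path := by
      have h := (hX (j + 1)).2
      push_cast at h
      exact HolOn.concat (he.pos.trans he.lt) hX1 hX0 h (hX j).2
    have hh : HolOn ν Y 0 T (NoisePath.shift (-((j + 1 : ℕ) * (T.toNNReal : ℝ) + σ)) ω).path := by
      refine NoisePath.holOn_shift (hcat.mono le_rfl ?_ ?_) <;> rw [hTT] <;> push_cast <;>
        linarith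
    have hYp : Y ^ p ≤ 2 ^ p * (X j ^ p + X (j + 1) ^ p) := by
      rw [add_comm (X j ^ p)]
      exact rpow_add_le_two_rpow_mul hp hX1 hX0
    have hq : 0 ≤ X j ^ p + X (j + 1) ^ p := by positivity
    refine ((hest _ η _ hY0 hh).2 σ hσ').trans ?_
    rw [Real.mul_rpow (NNReal.coe_nonneg _) hY0]
    have h3 : C * (1 + (Cg : ℝ) ^ p * Y ^ p) ≤
        C + C * ((Cg : ℝ) ^ p * 2 ^ p) * (X j ^ p + X (j + 1) ^ p) := by
      have h4 := mul_le_mul_of_nonneg_left hYp (mul_nonneg hC hCg)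
      linarith
    have h5 : D * (1 + Y ^ p) ≤ D * 2 ^ p * (1 + (X j ^ p + X (j + 1) ^ p)) := by
      rw [mul_assoc]
      refine mul_le_mul_of_nonneg_left ?_ hD
      linarith
    have h6 : 0 ≤ D * (1 + Y ^ p) := by positivity
    gcongr

theorem isPullbackAttractor_flow {F : Hist r d → Vec d} {g : Hist r d → Vec m →L[ℝ] Vec d}
    {CF Cg : ℝ≥0} (hg : IsCoeff F g CF Cg) (he : IsExponents β₀ ν) (hr : 0 ≤ r)
    {P : Measure (NoisePath ν m)} [IsProbabilityMeasure P]
    (hP : IsErgodicFlow (NoisePath.shift (ν := ν) (m := m)) P) {τ : ℝ≥0} (hτ : 1 ≤ τ)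
    (hτr : r ≤ τ) {C D c e : ℝ} (hD : 0 ≤ D) (hc : 0 ≤ c) (he0 : 0 ≤ e) (hec : e * c ≤ 1 / 32)
    {Ω₀ : Set (NoisePath ν m)} (hm : MeasurableSet Ω₀) (hfull : P Ω₀ = 1)
    (hinv : ∀ ω ∈ Ω₀, ∀ t, NoisePath.shift t ω ∈ Ω₀)
    (hb : ∀ ω ∈ Ω₀, ∃ N q, BlockBounds NoisePath.shift (flow hg he hr) τ C D c e N q ω) :
    ∃ 𝒜 : NoisePath ν m → Set (LittleHolder β₀ (-r) 0 d),
      IsPullbackAttractor NoisePath.shift P (flow hg he hr)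
        (temperedUniverse NoisePath.shift P) 𝒜 ∧
      ∀ ω, ∀ η ∈ 𝒜 ω, ∃ C, 0 ≤ C ∧ η ∈ LittleHolder.holderBall β₀ (-r) 0 d ν C := by
  have : TopologicalSpace.SeparableSpace (LittleHolder β₀ (-r) 0 d) :=
    LittleHolder.separableSpace he.nnreal_pos he.nnreal_lt_one (by linarith)
  have : SecondCountableTopology (LittleHolder β₀ (-r) 0 d) :=
    UniformSpace.secondCountable_of_separable _
  have hτ0 : 0 < τ := one_pos.trans_le hτ
  have hφ := isContinuousRDS_flow (m := m) hg he hr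
  set δ : ℝ := 1 / (6 * τ) with hδ
  have hδ0 : 0 < δ := by
    have : (0 : ℝ) < τ := hτ0
    positivity
  have hcap : ∀ ω ∈ Ω₀, Captures NoisePath.shift (flow hg he hr) (2 * δ) ω := by
    intro ω hω
    obtain ⟨N, q, h⟩ := hb _ (hinv ω hω (-τ))
    refine h.captures hφ NoisePath.shift_shift hτ0 hD hc he0 hec fun R => ?_
    obtain ⟨K, hK0, hK⟩ := flow_mem_holderBall hg he hr hτ hτr (NoisePath.shift (-τ) ω) R
    exact ⟨_, LittleHolder.isCompact_holderBall he.nnreal_pos he.lt (by linarith) hK0, hK⟩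
  have habs : ∀ ω ∈ Ω₀, Absorbs NoisePath.shift (flow hg he hr) δ τ ω := by
    intro ω hω
    obtain ⟨N, q, h⟩ := hb ω hω
    exact h.absorbs hφ NoisePath.shift_shift hτ0 hD hc he0 hec
  refine ⟨attractor NoisePath.shift (flow hg he hr) δ Ω₀,
    isPullbackAttractor_attractor hφ NoisePath.shift_zero NoisePath.shift_shift
      (fun t => (hP.measurePreserving t).measurable) hm hfull hinv hδ0 hτ0 hcap habs,
    fun ω η hη => ?_⟩
  by_cases hω : ω ∈ Ω₀
  · rw [attractor_of_mem hω] at hη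
    have e1 : NoisePath.shift τ (NoisePath.shift (-τ) ω) = ω := by
      rw [NoisePath.shift_shift, add_neg_cancel, NoisePath.shift_zero]
    -- Each point of the attractor is an image under the flow of length τ ≥ r, hence ν-Hölder.
    have h := pullbackLimit_subset_map hφ (by linarith : δ < 2 * δ) NoisePath.shift_zero
      NoisePath.shift_shift τ (hcap _ (hinv ω hω (-τ)))
    rw [e1] at h
    obtain ⟨ζ, -, rfl⟩ := h hη
    obtain ⟨K, hK0, hK⟩ := flow_mem_holderBall hg he hr hτ hτr (NoisePath.shift (-τ) ω) ‖ζ‖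
    exact ⟨K, hK0, hK ζ le_rfl⟩
  · rw [attractor_of_notMem hω, mem_singleton_iff] at hη
    subst hη
    have h0 : (0 : LittleHolder β₀ (-r) 0 d).path = 0 := rfl
    exact ⟨0, le_rfl, fun t => by rw [h0]; simp, fun s t _ => by rw [h0]; simp⟩

end FlowAttractor

end YoungDelay

end

theorem theorem4p5 (d m : ℕ) (r : ℝ) (hr : 0 < r)
    -- the Hölder exponents: `1/2 < ν ≤ 1`, `1 - ν < β₀ < β < ν`
    (ν β₀ β : ℝ≥0) (hν : 1 / 2 < ν) (hν1 : ν ≤ 1) (hβ₀ : 1 < β₀ + ν) (hβ : β₀ < β) (hβν : β < ν)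
    -- the law of the noise on its canonical path space: stationary increments, ergodic
    (P : Measure (NoisePath ν m)) [IsProbabilityMeasure P]
    (hP : IsErgodicFlow (NoisePath.shift (ν := ν) (m := m)) P)
    -- the moment condition
    (hΓ : ∫⁻ ω : NoisePath ν m,
      (eHolderNorm ν ((Icc (-r) r).domRestrict ω.path)) ^ (1 / ((ν : ℝ) - β)) ∂P < ⊤)
    -- the matrix `A` is Hurwitz
    (A : Matrix (Fin d) (Fin d) ℝ)
    (hA : ∀ μ ∈ spectrum ℂ (A.map (algebraMap ℝ ℂ)), μ.re < 0)
    -- any constants with `‖exp(tA)‖ ≤ C_A exp(-λt)` for `t ≥ 0`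
    (C_A lam : ℝ) (hC_A : 0 < C_A) (hlam : 0 < lam)
    (hexp : ∀ t : ℝ, 0 ≤ t →
      ‖NormedSpace.exp (t • Matrix.toEuclideanCLM (𝕜 := ℝ) A)‖ ≤ C_A * Real.exp (-lam * t))
    -- `f` is globally Lipschitz
    (f : Hist r d → Vec d) (C_f : ℝ≥0) (hf : LipschitzWith C_f f)
    (hsmall : C_A * C_f < lam * Real.exp (-lam * r)) :
    ∃ ε : ℝ, 0 < ε ∧
      -- for every `C¹` map `g` with derivative bounded by `C_g < ε` and locally Lipschitz
      ∀ (g : Hist r d → Vec m →L[ℝ] Vec d) (C_g : ℝ), C_g < ε → ContDiff ℝ 1 g →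
        (∀ ξ, ‖fderiv ℝ g ξ‖ ≤ C_g) →
        (∀ M : ℝ, 0 < M → ∃ L : ℝ, ∀ ξ η : Hist r d, ‖ξ‖ ≤ M → ‖η‖ ≤ M →
          ‖fderiv ℝ g ξ - fderiv ℝ g η‖ ≤ L * ‖ξ - η‖) →
        -- the solution flow is a well-defined continuous random dynamical system ...
        ∃ φ : ℝ≥0 → NoisePath ν m → LittleHolder β₀ (-r) 0 d → LittleHolder β₀ (-r) 0 d,
          IsSolutionFlow r β₀ A f g φ ∧ IsContinuousRDS NoisePath.shift φ ∧
          -- ... with a random pullback attractor for the tempered random sets, inside `C^β`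
          ∃ 𝒜 : NoisePath ν m → Set (LittleHolder β₀ (-r) 0 d),
            IsPullbackAttractor NoisePath.shift P φ (temperedUniverse NoisePath.shift P) 𝒜 ∧
            ∀ ω, ∀ η ∈ 𝒜 ω, MemHolder β η.path := by
  have he : IsExponents β₀ ν :=
    ⟨by have h : (1 : ℝ) < β₀ + ν := by exact_mod_cast hβ₀
        have h' : (ν : ℝ) ≤ 1 := by exact_mod_cast hν1
        linarith, by exact_mod_cast hβ.trans hβν, by exact_mod_cast hν1, by exact_mod_cast hβ₀⟩
  have hν0 : 0 < ν := zero_le.trans_lt hβν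
  have hβν' : (β : ℝ) < ν := hβν
  have hβ' : (β₀ : ℝ) < β := hβ
  set p : ℝ := 1 / ((ν : ℝ) - β) with hp
  have hp0 : 0 < p := one_div_pos.mpr (by linarith)
  have hκ : C_A * C_f < lam := by
    have h1 : Real.exp (-lam * r) ≤ 1 := Real.exp_le_one_iff.mpr (by nlinarith)
    nlinarith
  -- β₀ < β gives 1/(ν - β₀) ≤ 1/(ν - β) = p: the growth of the flow is covered by the moment
  -- condition.
  obtain ⟨T, C, hT1, hTr, hC, hest⟩ := exists_block_estimate (m := m) hr.le hf hC_A.le hlam hexp hκ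
    he (p := p) (one_div_le_one_div_of_le (by linarith) (by linarith))
    (‖Matrix.toEuclideanCLM (𝕜 := ℝ) A‖₊ + C_f)
  obtain ⟨c, hc, Ω₀, hm, hfull, hinv, htame⟩ := NoisePath.exists_tame hP hν0 hr
    (by linarith : 0 < T) hp0 hΓ
  -- Chosen so that Cg^p ≤ b implies C·2^p·c·Cg^p ≤ 1/32, the smallness required for absorption;
  -- hence ε = b^(1/p).
  set b : ℝ := 1 / (32 * (C * 2 ^ p * c + 1)) with hb
  have hb0 : 0 < b := by positivity
  refine ⟨b ^ (1 / p), by positivity, fun g C_g hCg hg hbound hlip => ?_⟩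
  have hCg0 : 0 ≤ C_g := (norm_nonneg (fderiv ℝ g 0)).trans (hbound 0)
  have hcoe : (C_g.toNNReal : ℝ) = C_g := Real.coe_toNNReal _ hCg0
  have hcf : IsCoeff (drift hr.le A f) g (‖Matrix.toEuclideanCLM (𝕜 := ℝ) A‖₊ + C_f)
      C_g.toNNReal :=
    ⟨lipschitzWith_drift hr.le A hf, hg.differentiable one_ne_zero,
      fun ξ => (hbound ξ).trans_eq hcoe.symm, hlip⟩
  obtain ⟨D, hD, hflow⟩ := hest g _ hcf
  have hCgp : (C_g.toNNReal : ℝ) ^ p ≤ b := by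
    rw [hcoe]
    calc C_g ^ p ≤ (b ^ (1 / p)) ^ p := Real.rpow_le_rpow hCg0 hCg.le hp0.le
      _ = b := by rw [← Real.rpow_mul hb0.le, one_div_mul_cancel hp0.ne', Real.rpow_one]
  have hsmall' : C * ((C_g.toNNReal : ℝ) ^ p * 2 ^ p) * c ≤ 1 / 32 := by
    have h1 : 0 ≤ C * 2 ^ p * c := by positivity
    have h2 := mul_le_mul_of_nonneg_left hCgp h1
    have h3 : C * 2 ^ p * c * b ≤ 1 / 32 := by
      rw [hb, mul_one_div, div_le_div_iff₀ (by positivity) (by norm_num)]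
      linarith
    linarith
  obtain ⟨𝒜, h𝒜, hreg⟩ := isPullbackAttractor_flow hcf he hr.le hP (τ := T.toNNReal) (C := C) (D := D * 2 ^ p)
    (by rwa [Real.one_le_toNNReal]) (by rw [Real.coe_toNNReal _ (by linarith)]; linarith)
    (by positivity) hc.le (by positivity) hsmall' hm hfull hinv fun ω hω => by
      obtain ⟨X, N, hX, hsum⟩ := htame ω hω
      exact ⟨N, _, blockBounds_flow hcf he hr.le hT1 hp0.le hC hD hflow hX hsum⟩
  refine ⟨flow hcf he hr.le, isSolutionFlow_flow hr.le hcf he, isContinuousRDS_flow hcf he hr.le,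
    𝒜, h𝒜, fun ω η hη => ?_⟩
  obtain ⟨K, hK0, hK⟩ := hreg ω η hη
  exact LittleHolder.memHolder_of_mem_holderBall hβν hK0 hr.le hK
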